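/- Consider equations $$u_t+u^nu_x+h(t)u=g(t)u_{xx},\qquad n\ne0,\tag{1}$$ where $n$ is a real constant and $h$, $g$ are smooth real functions on an open interval $I$ of values of $t$, $g$ having no zeros on $I$. Here $x\in\mathbb R$, and $u>0$ if $n\neq1$, $u\in\mathbb R$ if $n=1$. The maximal Lie invariance algebra $A^{\max}$ of an equation is the set of all smooth vector fields $Q=\tau\partial_t+\xi\partial_x+\eta\partial_u$ on the domain of the variables $(t,x,u)$ that satisfy the infinitesimal invariance criterion (the second prolongation $Q^{(2)}$ annihilates the equation on the manifold it defines in the second-order jet space). A point transformation between two equations is a smooth map of $(t,x,u)$ with nonvanishing Jacobian whose prolongation identifies the two equations in the second-order jet space; two equations are point equivalent if they are linked by a point transformation that maps the whole domain of one bijectively onto the whole domain of the other. **Table 1 (classification up to point equivalence; $h=0$; $\varepsilon=\pm1$, $\rho\ne0$; $t>0$ in Cases 2 and 6).** $n\ne1$: 1. $g$ arbitrary: $\langle\partial_x\rangle$; 2. $g=\varepsilon t^\rho$: $\langle\partial_x,\ 2nt\partial_t+n(\rho+1)x\partial_x+(\rho-1)u\partial_u\rangle$; 3. $g=\varepsilon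 e^t$: $\langle\partial_x,\ 2n\partial_t+nx\partial_x+u\partial_u\rangle$; 4. $g=1$: $\langle\partial_x,\ \partial_t,\ 2nt\partial_t+nx\partial_x-u\partial_u\rangle$. $n=1$: 5. $g$ arbitrary: $\langle\partial_x,\ t\partial_x+\partial_u\rangle$; 6. $g=\varepsilon t^\rho$: $\langle\partial_x,\ t\partial_x+\partial_u,\ 2t\partial_t+(\rho+1)x\partial_x+(\rho-1)u\partial_u\rangle$; 7. $g=\varepsilon e^t$: $\langle\partial_x,\ t\partial_x+\partial_u,\ 2\partial_t+x\partial_x+u\partial_u\rangle$; 8. $g=\varepsilon e^{2\rho\arctan t}$: $\langle\partial_x,\ t\partial_x+\partial_u,\ (t^2+1)\partial_t+(t+\rho)x\partial_x+(x+(\rho-t)u)\partial_u\rangle$; 9. $g=1$: $\langle\partial_x,\ t\partial_x+\partial_u,\ \partial_t,\ 2t\partial_t+x\partial_x-u\partial_u,\ t^2\partial_t+tx\partial_x+(x-tu)\partial_u\rangle$. Every equation (1) is point equivalent to an equation with the same $n$ and $h=0$ that either belongs to one of Cases 2–4, 6–9 or has the algebra of Case 1 ($n\neq1$) or Case 5 ($n=1$)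 as its $A^{\max}$, and these two possibilities exclude each other. In each of Cases 2–4, 6–9, the listed vector fields form a basis of $A^{\max}$. If two equations of Cases 2–4, 6–9 are linked by a point transformation, even one defined only on some nonempty open set of $(t,x,u)$, then they have the same $n$, belong to the same case and have the same parameters, except that $(\varepsilon,\rho)$ may be replaced by $(-\varepsilon,-\rho)$ in Cases 6 and 8. Conversely, in Cases 6 and 8 every equation with parameters $(\varepsilon,\rho)$ is point equivalent to one with $(-\varepsilon,-\rho)$, so that one can set either $\rho>0$ or $\rho<0$. **Table 3 (complete list for arbitrary $h$).** Let $T=\int e^{-n\int h\,dt}\,dt$ and $T_t=e^{-n\int h\,dt}$, for any fixed choice of the antiderivatives on $I$. Then the values of $g$ below, where $g$ is to be well defined on $I$, with the listed bases of $A^{\max}$, are the following; if $g$ has none of the forms 2–4, 6–9 on $I$, then $A^{\max}$ is that of Case 1 ($n\ne1$) or Case 5 ($n=1$). For any given $n$, $I$ and $h$, Case 1 (resp. 5) does occur as $A^{\max}$ for some $g$. $n\ne1$: 1. $\langle\partial_x\rangle$; 2. $g=\lambda T_t(\alpha T+\beta)^\rho$: $\partial_x$, $2n(\alpha T+\beta)T_t^{-1}\partial_t+\alpha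 n(\rho+1)x\partial_x+\big(\alpha(\rho-1)-2nh(\alpha T+\beta)T_t^{-1}\big)u\partial_u$; 3. $g=\lambda T_te^{\alpha T}$: $\partial_x$, $2nT_t^{-1}\partial_t+\alpha nx\partial_x+(\alpha-2nhT_t^{-1})u\partial_u$; 4. $g=\lambda T_t$: $\partial_x$, $T_t^{-1}\partial_t-hT_t^{-1}u\partial_u$, $2nTT_t^{-1}\partial_t+nx\partial_x-(2nhTT_t^{-1}+1)u\partial_u$. $n=1$: 5. $\langle\partial_x,\ T\partial_x+T_t\partial_u\rangle$; 6. $g=\lambda T_t\big(\frac{\alpha T+\beta}{\gamma T+\delta}\big)^\rho$: $\partial_x$, $T\partial_x+T_t\partial_u$, $(\alpha T+\beta)(\gamma T+\delta)T_t^{-1}\partial_t+\big(\frac12(\rho-1)\Delta+\alpha(\gamma T+\delta)\big)x\partial_x+\big(\big[-\alpha(\gamma T+\delta)-h(\alpha T+\beta)(\gamma T+\delta)T_t^{-1}+\frac12(\rho+1)\Delta\big]u+\alpha\gamma T_tx\big)\partial_u$; 7. $g=\lambda T_t\exp\frac{\alpha T+\beta}{\gamma T+\delta}$: $\partial_x$,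 $T\partial_x+T_t\partial_u$, $(\gamma T+\delta)^2T_t^{-1}\partial_t+\big(\gamma(\gamma T+\delta)+\frac12\Delta\big)x\partial_x+\big(\big[-\gamma(\gamma T+\delta)-h(\gamma T+\delta)^2T_t^{-1}+\frac12\Delta\big]u+\gamma^2T_tx\big)\partial_u$; 8. $g=\lambda T_te^{2\rho\arctan(\alpha T+\beta)}$: $\partial_x$, $T\partial_x+T_t\partial_u$, $\big((\alpha T+\beta)^2+1\big)T_t^{-1}\partial_t+\alpha(\alpha T+\rho+\beta)x\partial_x+\big(\big[\alpha(-\alpha T+\rho-\beta)-h\big((\alpha T+\beta)^2+1\big)T_t^{-1}\big]u+\alpha^2T_tx\big)\partial_u$; 9. $g=\lambda T_t$: $\partial_x$, $T\partial_x+T_t\partial_u$, $2TT_t^{-1}\partial_t+x\partial_x-(2hTT_t^{-1}+1)u\partial_u$, $T_t^{-1}\partial_t-hT_t^{-1}u\partial_u$, $T^2T_t^{-1}\partial_t+Tx\partial_x+\big(T_tx-(hT^2T_t^{-1}+T)u\big)\partial_u$. Here $\lambda$ and $\rho$ are nonzero constants; $\alpha=\pm1$ and $\alpha T+\beta>0$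 on $I$ in Case 2; $\alpha\neq0$ in Cases 3 and 8; $\Delta=\alpha\delta-\beta\gamma\ne0$ in Cases 6 and 7, where $\gamma T+\delta\neq0$ on $I$, and $\frac{\alpha T+\beta}{\gamma T+\delta}>0$ on $I$ in Case 6. In Case 7 one can set $(\alpha,\beta,\gamma,\delta)$ equal to $(\alpha',0,0,1)$ or $(0,\beta',1,\delta')$, changing $\lambda$ if necessary. **Table 2 (complete list for $h=0$).** The corresponding complete list for equations with $h=0$ is obtained by putting $h=0$, $T=t$, $T_t=1$ in Table 3; the algebra in Case 9, for instance, is $\langle\partial_t,\ \partial_x,\ t\partial_x+\partial_u,\ 2t\partial_t+x\partial_x-u\partial_u,\ t^2\partial_t+tx\partial_x+(x-tu)\partial_u\rangle$. -/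

import Mathlib

open Set Filter Topology
open scoped ContDiff

noncomputable section

namespace Burgers

/-- The space of the variables `(t, x, u)`. -/
abbrev Pt : Type := ℝ × ℝ × ℝ

/-- A vector field `τ ∂_t + ξ ∂_x + η ∂_u`, given by its coefficients `(τ, ξ, η)`
as functions of `(t, x, u)`. -/
abbrev VF : Type := Pt → Pt

/-- An equation `u_t + u ^ n u_x + h(t) u = g(t) u_xx` with `n ≠ 0`, where `h` and `g` are smooth
on the open interval `I` of values of `t` and `g` has no zeros there. -/
structure Eqn where
  n : ℝ
  I : Set ℝ
  h : ℝ → ℝ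
  g : ℝ → ℝ
  n_ne_zero : n ≠ 0
  isOpen_I : IsOpen I
  isConnected_I : IsConnected I
  smooth_h : ContDiffOn ℝ ∞ h I
  smooth_g : ContDiffOn ℝ ∞ g I
  g_ne_zero : ∀ t ∈ I, g t ≠ 0

/-- `∂f/∂t` for a function `f` of `(t, x)`. -/
def dt (f : ℝ → ℝ → ℝ) (t x : ℝ) : ℝ := deriv (fun s => f s x) t

/-- `∂f/∂x` for a function `f` of `(t, x)`. -/
def dx (f : ℝ → ℝ → ℝ) (t x : ℝ) : ℝ := deriv (fun y => f t y) x

/-- The point `(t, x, u(t, x))` of the graph of `u`. -/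
def lift (u : ℝ → ℝ → ℝ) (t x : ℝ) : Pt := (t, x, u t x)

/-- Smoothness of a function of `(t, x)` at a point. -/
def SmoothAt (u : ℝ → ℝ → ℝ) (t x : ℝ) : Prop :=
  ContDiffAt ℝ ∞ (fun q : ℝ × ℝ => u q.1 q.2) (t, x)

/-! Prolongation of a vector field to second-order jets. A jet is represented by a function `u`
having it; a total derivative is the derivative along such a function. -/

/-- `η^t = D_t η - u_t D_t τ - u_x D_t ξ`. -/
def prolT (Q : VF) (u : ℝ → ℝ → ℝ) (t x : ℝ) : ℝ :=
  dt (fun s y => (Q (lift u s y)).2.2) t x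
    - dt u t x * dt (fun s y => (Q (lift u s y)).1) t x
    - dx u t x * dt (fun s y => (Q (lift u s y)).2.1) t x

/-- `η^x = D_x η - u_t D_x τ - u_x D_x ξ`. -/
def prolX (Q : VF) (u : ℝ → ℝ → ℝ) (t x : ℝ) : ℝ :=
  dx (fun s y => (Q (lift u s y)).2.2) t x
    - dt u t x * dx (fun s y => (Q (lift u s y)).1) t x
    - dx u t x * dx (fun s y => (Q (lift u s y)).2.1) t x

/-- `η^{xx} = D_x η^x - u_{tx} D_x τ - u_{xx} D_x ξ`. -/
def prolXX (Q : VF) (u : ℝ → ℝ → ℝ) (t x : ℝ) : ℝ :=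
  dx (prolX Q u) t x
    - dx (dt u) t x * dx (fun s y => (Q (lift u s y)).1) t x
    - dx (dx u) t x * dx (fun s y => (Q (lift u s y)).2.1) t x

namespace Eqn

/-- The values of `u`: all of `ℝ` if `n = 1`, the positive reals otherwise. -/
def U (E : Eqn) : Set ℝ := if E.n = 1 then univ else Ioi 0

/-- The domain `I × ℝ × U` of the variables `(t, x, u)`. -/
def domain (E : Eqn) : Set Pt := {p | p.1 ∈ E.I ∧ p.2.2 ∈ E.U}

/-- The second-order jet of `u` at `(t, x)` satisfies the equation. -/
def HoldsAt (E : Eqn) (u : ℝ → ℝ → ℝ) (t x : ℝ) : Prop :=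
  dt u t x + u t x ^ E.n * dx u t x + E.h t * u t x = E.g t * dx (dx u) t x

/-- The value of `Q^{(2)} {u_t + u ^ n u_x + h(t) u - g(t) u_xx}` at the second-order jet of `u`
at `(t, x)`. -/
def prolApply (E : Eqn) (Q : VF) (u : ℝ → ℝ → ℝ) (t x : ℝ) : ℝ :=
  (Q (lift u t x)).1 * (deriv E.h t * u t x - deriv E.g t * dx (dx u) t x)
    + (Q (lift u t x)).2.2 * (E.n * u t x ^ (E.n - 1) * dx u t x + E.h t)
    + prolT Q u t x + u t x ^ E.n * prolX Q u t x - E.g t * prolXX Q u t x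

/-- `Q` is a smooth vector field on the domain that meets the infinitesimal invariance criterion:
`Q^{(2)}` annihilates the equation on the manifold that the equation defines in the
second-order jet space. -/
def IsLieSymmetry (E : Eqn) (Q : VF) : Prop :=
  ContDiffOn ℝ ∞ Q E.domain ∧
    ∀ (u : ℝ → ℝ → ℝ) (t x : ℝ), lift u t x ∈ E.domain → SmoothAt u t x →
      E.HoldsAt u t x → E.prolApply Q u t x = 0

/-- The maximal Lie invariance algebra, as a set of vector fields on the domain. -/
def maxAlgebra (E : Eqn) : Set (E.domain → Pt) :=
  {V | ∃ Q : VF, E.IsLieSymmetry Q ∧ V = E.domain.domRestrict Q}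

/-- The vector fields in the list `B`, restricted to the domain, form a basis of the maximal Lie
invariance algebra. -/
def HasMaxAlgebra (E : Eqn) (B : List VF) : Prop :=
  LinearIndependent ℝ (fun i : Fin B.length => E.domain.domRestrict (B.get i)) ∧
    E.maxAlgebra =
      (Submodule.span ℝ (Set.range fun i : Fin B.length => E.domain.domRestrict (B.get i)) :
        Set (E.domain → Pt))

/-- `Φ`, on the open subset `Ω` of the domain of `E`, is a point transformation with nonvanishing
Jacobian that links `E` with `E'`: whenever the graph of `u` is mapped, near a point, to the
graph of `v`, the jet of `u` at that point satisfies `E` if and only if the jet of `v` at the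
image point satisfies `E'`; that is, the prolongation of `Φ` identifies the two equations as
submanifolds of the second-order jet space. -/
structure IsPointTransformation (E E' : Eqn) (Ω : Set Pt) (Φ : Pt → Pt) : Prop where
  isOpen : IsOpen Ω
  subset : Ω ⊆ E.domain
  mapsTo : MapsTo Φ Ω E'.domain
  smooth : ContDiffOn ℝ ∞ Φ Ω
  jacobian_ne_zero : ∀ p ∈ Ω, (fderiv ℝ Φ p).det ≠ 0
  holdsAt_iff : ∀ (u v : ℝ → ℝ → ℝ) (t x : ℝ), lift u t x ∈ Ω → SmoothAt u t x →
    SmoothAt v (Φ (lift u t x)).1 (Φ (lift u t x)).2.1 →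
    (∀ᶠ q : ℝ × ℝ in 𝓝 (t, x), (Φ (lift u q.1 q.2)).2.2 =
      v (Φ (lift u q.1 q.2)).1 (Φ (lift u q.1 q.2)).2.1) →
    (E.HoldsAt u t x ↔ E'.HoldsAt v (Φ (lift u t x)).1 (Φ (lift u t x)).2.1)

/-- Point equivalence: the equations are linked by a point transformation that maps the whole
domain of the first bijectively onto the whole domain of the second. -/
def PointEquiv (E E' : Eqn) : Prop :=
  ∃ Φ : Pt → Pt, E.IsPointTransformation E' E.domain Φ ∧ BijOn Φ E.domain E'.domain

/-- The equations are linked by a point transformation that is defined on some nonempty open set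
only. -/
def LocallyPointEquiv (E E' : Eqn) : Prop :=
  ∃ (Ω : Set Pt) (Φ : Pt → Pt), Ω.Nonempty ∧ E.IsPointTransformation E' Ω Φ

end Eqn

/-- The vector field `τ ∂_t + ξ ∂_x + η ∂_u` from expressions in `t`, `x`, `u`. -/
def vf (f : ℝ → ℝ → ℝ → Pt) : VF := fun p => f p.1 p.2.1 p.2.2

/-- The vector field `∂_x`. -/
def delX : VF := vf fun _ _ _ => (0, 1, 0)

/-! ### Table 1 -/

/-- The cases of Table 1 with a specific `g`, with their parameters. -/
inductive Row1 where
  | case2 (ε ρ : ℝ)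
  | case3 (ε : ℝ)
  | case4
  | case6 (ε ρ : ℝ)
  | case7 (ε : ℝ)
  | case8 (ε ρ : ℝ)
  | case9

namespace Row1

/-- The restrictions on the parameters and on `n`. -/
def Valid (n : ℝ) : Row1 → Prop
  | case2 ε ρ => n ≠ 1 ∧ (ε = 1 ∨ ε = -1) ∧ ρ ≠ 0
  | case3 ε => n ≠ 1 ∧ (ε = 1 ∨ ε = -1)
  | case4 => n ≠ 1
  | case6 ε ρ => n = 1 ∧ (ε = 1 ∨ ε = -1) ∧ ρ ≠ 0
  | case7 ε => n = 1 ∧ (ε = 1 ∨ ε = -1)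
  | case8 ε ρ => n = 1 ∧ (ε = 1 ∨ ε = -1) ∧ ρ ≠ 0
  | case9 => n = 1

/-- The values of `t` for which `g` is considered. -/
def tDomain : Row1 → Set ℝ
  | case2 _ _ => Ioi 0
  | case6 _ _ => Ioi 0
  | _ => univ

/-- The arbitrary element `g`. -/
def g : Row1 → ℝ → ℝ
  | case2 ε ρ, t => ε * t ^ ρ
  | case3 ε, t => ε * Real.exp t
  | case4, _ => 1
  | case6 ε ρ, t => ε * t ^ ρ
  | case7 ε, t => ε * Real.exp t
  | case8 ε ρ, t => ε * Real.exp (2 * ρ * Real.arctan t)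
  | case9, _ => 1

/-- The basis operators. -/
def basis (n : ℝ) : Row1 → List VF
  | case2 _ ρ => [delX, vf fun t x u => (2 * n * t, n * (ρ + 1) * x, (ρ - 1) * u)]
  | case3 _ => [delX, vf fun _ x u => (2 * n, n * x, u)]
  | case4 => [delX, vf fun _ _ _ => (1, 0, 0), vf fun t x u => (2 * n * t, n * x, -u)]
  | case6 _ ρ => [delX, vf fun t _ _ => (0, t, 1),
      vf fun t x u => (2 * t, (ρ + 1) * x, (ρ - 1) * u)]
  | case7 _ => [delX, vf fun t _ _ => (0, t, 1), vf fun _ x u => (2, x, u)]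
  | case8 _ ρ => [delX, vf fun t _ _ => (0, t, 1),
      vf fun t x u => (t ^ 2 + 1, (t + ρ) * x, x + (ρ - t) * u)]
  | case9 => [delX, vf fun t _ _ => (0, t, 1), vf fun _ _ _ => (1, 0, 0),
      vf fun t x u => (2 * t, x, -u), vf fun t x u => (t ^ 2, t * x, x - t * u)]

/-- The change of signs `(ε, ρ) ↦ (-ε, -ρ)` in Cases 6 and 8. -/
def flip : Row1 → Row1
  | case6 ε ρ => case6 (-ε) (-ρ)
  | case8 ε ρ => case8 (-ε) (-ρ)
  | r => r

end Row1

/-- The equation has `h = 0` and the value of `g` given by the row `r` of Table 1. -/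
def Eqn.IsRow1 (E : Eqn) (r : Row1) : Prop :=
  r.Valid E.n ∧ E.I ⊆ r.tDomain ∧ ∀ t ∈ E.I, E.h t = 0 ∧ E.g t = r.g t

/-- Cases 1 and 5 of Tables 1 and 2. -/
def genericBasis (n : ℝ) : List VF :=
  if n = 1 then [delX, vf fun t _ _ => (0, t, 1)] else [delX]

/-! ### Tables 2 and 3 -/

/-- The cases of Tables 2 and 3 with a specific `g`, with their parameters. -/
inductive Row where
  | case2 (lam α β ρ : ℝ)
  | case3 (lam α : ℝ)
  | case4 (lam : ℝ)
  | case6 (lam α β γ δ ρ : ℝ)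
  | case7 (lam α β γ δ : ℝ)
  | case8 (lam α β ρ : ℝ)
  | case9 (lam : ℝ)

namespace Row

/-- The restrictions on the parameters and on `n`, with the condition that `g` makes sense on `I`;
Table 2 is about `T t = t`. -/
def Valid (n : ℝ) (I : Set ℝ) (T : ℝ → ℝ) : Row → Prop
  | case2 lam α β ρ => n ≠ 1 ∧ lam ≠ 0 ∧ ρ ≠ 0 ∧ (α = 1 ∨ α = -1) ∧ ∀ t ∈ I, 0 < α * T t + β
  | case3 lam α => n ≠ 1 ∧ lam ≠ 0 ∧ α ≠ 0
  | case4 lam => n ≠ 1 ∧ lam ≠ 0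
  | case6 lam α β γ δ ρ => n = 1 ∧ lam ≠ 0 ∧ ρ ≠ 0 ∧ α * δ - β * γ ≠ 0 ∧
      ∀ t ∈ I, γ * T t + δ ≠ 0 ∧ 0 < (α * T t + β) / (γ * T t + δ)
  | case7 lam α β γ δ => n = 1 ∧ lam ≠ 0 ∧ α * δ - β * γ ≠ 0 ∧ ∀ t ∈ I, γ * T t + δ ≠ 0
  | case8 lam α _ ρ => n = 1 ∧ lam ≠ 0 ∧ ρ ≠ 0 ∧ α ≠ 0
  | case9 lam => n = 1 ∧ lam ≠ 0

/-- The arbitrary element `g` in Table 2. -/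
def g2 : Row → ℝ → ℝ
  | case2 lam α β ρ, t => lam * (α * t + β) ^ ρ
  | case3 lam α, t => lam * Real.exp (α * t)
  | case4 lam, _ => lam
  | case6 lam α β γ δ ρ, t => lam * ((α * t + β) / (γ * t + δ)) ^ ρ
  | case7 lam α β γ δ, t => lam * Real.exp ((α * t + β) / (γ * t + δ))
  | case8 lam α β ρ, t => lam * Real.exp (2 * ρ * Real.arctan (α * t + β))
  | case9 lam, _ => lam

/-- The basis operators in Table 2. -/
def basis2 (n : ℝ) : Row → List VF
  | case2 _ α β ρ => [delX,
      vf fun t x u => (2 * n * (α * t + β), α * n * (ρ + 1) * x, α * (ρ - 1) * u)]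
  | case3 _ α => [delX, vf fun _ x u => (2 * n, α * n * x, α * u)]
  | case4 _ => [vf fun _ _ _ => (1, 0, 0), delX, vf fun t x u => (2 * n * t, n * x, -u)]
  | case6 _ α β γ δ ρ => [delX, vf fun t _ _ => (0, t, 1),
      vf fun t x u =>
        ((α * t + β) * (γ * t + δ),
          (1 / 2 * (ρ - 1) * (α * δ - β * γ) + α * (γ * t + δ)) * x,
          (1 / 2 * (ρ + 1) * (α * δ - β * γ) - α * (γ * t + δ)) * u + α * γ * x)]
  | case7 _ α β γ δ => [delX, vf fun t _ _ => (0, t, 1),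
      vf fun t x u =>
        ((γ * t + δ) ^ 2,
          (1 / 2 * (α * δ - β * γ) + γ * (γ * t + δ)) * x,
          (1 / 2 * (α * δ - β * γ) - γ * (γ * t + δ)) * u + γ ^ 2 * x)]
  | case8 _ α β ρ => [delX, vf fun t _ _ => (0, t, 1),
      vf fun t x u =>
        ((α * t + β) ^ 2 + 1,
          α * (α * t + ρ + β) * x,
          α * ((-α * t + ρ - β) * u + α * x))]
  | case9 _ => [vf fun _ _ _ => (1, 0, 0), delX, vf fun t _ _ => (0, t, 1),
      vf fun t x u => (2 * t, x, -u), vf fun t x u => (t ^ 2, t * x, x - t * u)]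

/-- The arbitrary element `g` in Table 3; `Tt` is the derivative of `T`. -/
def g3 (T Tt : ℝ → ℝ) : Row → ℝ → ℝ
  | case2 lam α β ρ, t => lam * Tt t * (α * T t + β) ^ ρ
  | case3 lam α, t => lam * Tt t * Real.exp (α * T t)
  | case4 lam, t => lam * Tt t
  | case6 lam α β γ δ ρ, t => lam * Tt t * ((α * T t + β) / (γ * T t + δ)) ^ ρ
  | case7 lam α β γ δ, t => lam * Tt t * Real.exp ((α * T t + β) / (γ * T t + δ))
  | case8 lam α β ρ, t => lam * Tt t * Real.exp (2 * ρ * Real.arctan (α * T t + β))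
  | case9 lam, t => lam * Tt t

/-- The basis operators in Table 3; `Tt` is the derivative of `T`. -/
def basis3 (n : ℝ) (h T Tt : ℝ → ℝ) : Row → List VF
  | case2 _ α β ρ => [delX,
      vf fun t x u =>
        (2 * n * (α * T t + β) * (Tt t)⁻¹,
          α * n * (ρ + 1) * x,
          (α * (ρ - 1) - 2 * n * h t * (α * T t + β) * (Tt t)⁻¹) * u)]
  | case3 _ α => [delX,
      vf fun t x u => (2 * n * (Tt t)⁻¹, α * n * x, (α - 2 * n * h t * (Tt t)⁻¹) * u)]
  | case4 _ => [delX,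
      vf fun t _ u => ((Tt t)⁻¹, 0, -(h t * (Tt t)⁻¹ * u)),
      vf fun t x u => (2 * n * T t * (Tt t)⁻¹, n * x, -(2 * n * h t * T t * (Tt t)⁻¹ + 1) * u)]
  | case6 _ α β γ δ ρ => [delX, vf fun t _ _ => (0, T t, Tt t),
      vf fun t x u =>
        ((α * T t + β) * (γ * T t + δ) * (Tt t)⁻¹,
          (1 / 2 * (ρ - 1) * (α * δ - β * γ) + α * (γ * T t + δ)) * x,
          (-α * (γ * T t + δ) - h t * (α * T t + β) * (γ * T t + δ) * (Tt t)⁻¹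
            + 1 / 2 * (ρ + 1) * (α * δ - β * γ)) * u + α * γ * Tt t * x)]
  | case7 _ α β γ δ => [delX, vf fun t _ _ => (0, T t, Tt t),
      vf fun t x u =>
        ((γ * T t + δ) ^ 2 * (Tt t)⁻¹,
          (γ * (γ * T t + δ) + 1 / 2 * (α * δ - β * γ)) * x,
          (-γ * (γ * T t + δ) - h t * (γ * T t + δ) ^ 2 * (Tt t)⁻¹
            + 1 / 2 * (α * δ - β * γ)) * u + γ ^ 2 * Tt t * x)]
  | case8 _ α β ρ => [delX, vf fun t _ _ => (0, T t, Tt t),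
      vf fun t x u =>
        (((α * T t + β) ^ 2 + 1) * (Tt t)⁻¹,
          α * (α * T t + ρ + β) * x,
          (α * (-α * T t + ρ - β) - h t * ((α * T t + β) ^ 2 + 1) * (Tt t)⁻¹) * u
            + α ^ 2 * Tt t * x)]
  | case9 _ => [delX, vf fun t _ _ => (0, T t, Tt t),
      vf fun t x u => (2 * T t * (Tt t)⁻¹, x, -(2 * h t * T t * (Tt t)⁻¹ + 1) * u),
      vf fun t _ u => ((Tt t)⁻¹, 0, -(h t * (Tt t)⁻¹ * u)),
      vf fun t x u =>
        (T t ^ 2 * (Tt t)⁻¹, T t * x, Tt t * x - (h t * T t ^ 2 * (Tt t)⁻¹ + T t) * u)]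

end Row

/-- Cases 1 and 5 of Table 3; `Tt` is the derivative of `T`. -/
def genericBasis3 (n : ℝ) (T Tt : ℝ → ℝ) : List VF :=
  if n = 1 then [delX, vf fun t _ _ => (0, T t, Tt t)] else [delX]

/-- The equation has `h = 0` and the value of `g` given by the row `r` of Table 2. -/
def Eqn.IsRow2 (E : Eqn) (r : Row) : Prop :=
  r.Valid E.n E.I (fun t => t) ∧ ∀ t ∈ E.I, E.h t = 0 ∧ E.g t = r.g2 t

/-- `T = ∫ e^{-n ∫ h dt} dt` and `Tt = e^{-n ∫ h dt}` for some choice of the antiderivatives. -/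
def Eqn.IsGauge (E : Eqn) (T Tt : ℝ → ℝ) : Prop :=
  ∃ H : ℝ → ℝ, ∀ t ∈ E.I, HasDerivAt H (E.h t) t ∧ Tt t = Real.exp (-E.n * H t) ∧
    HasDerivAt T (Tt t) t

/-- The value of `g` is given by the row `r` of Table 3. -/
def Eqn.IsRow3 (E : Eqn) (T Tt : ℝ → ℝ) (r : Row) : Prop :=
  r.Valid E.n E.I T ∧ ∀ t ∈ E.I, E.g t = r.g3 T Tt t

end Burgers

end

noncomputable section

namespace Burgers

/-! ### Partial derivatives of functions of `(t, x, u)` -/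

/-- `∂f/∂t` -/
def partT (f : Pt → ℝ) : Pt → ℝ := fun p => fderiv ℝ f p (1, 0, 0)

/-- `∂f/∂x` -/
def partX (f : Pt → ℝ) : Pt → ℝ := fun p => fderiv ℝ f p (0, 1, 0)

/-- `∂f/∂u` -/
def partU (f : Pt → ℝ) : Pt → ℝ := fun p => fderiv ℝ f p (0, 0, 1)

section Partial

variable {Ω : Set Pt} {f g : Pt → ℝ}

theorem contDiffOn_fderiv_apply (hΩ : IsOpen Ω) (hf : ContDiffOn ℝ ∞ f Ω) (e : Pt) :
    ContDiffOn ℝ ∞ (fun p => fderiv ℝ f p e) Ω :=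
  (hf.fderiv_of_isOpen hΩ (m := ∞) (by simp)).clm_apply contDiffOn_const

theorem contDiffOn_partT (hΩ : IsOpen Ω) (hf : ContDiffOn ℝ ∞ f Ω) :
    ContDiffOn ℝ ∞ (partT f) Ω := contDiffOn_fderiv_apply hΩ hf _

theorem contDiffOn_partX (hΩ : IsOpen Ω) (hf : ContDiffOn ℝ ∞ f Ω) :
    ContDiffOn ℝ ∞ (partX f) Ω := contDiffOn_fderiv_apply hΩ hf _

theorem contDiffOn_partU (hΩ : IsOpen Ω) (hf : ContDiffOn ℝ ∞ f Ω) :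
    ContDiffOn ℝ ∞ (partU f) Ω := contDiffOn_fderiv_apply hΩ hf _

theorem hasFDerivAt_of_contDiffOn (hΩ : IsOpen Ω) (hf : ContDiffOn ℝ ∞ f Ω) {p : Pt}
    (hp : p ∈ Ω) : HasFDerivAt f (fderiv ℝ f p) p :=
  ((hf.contDiffAt (hΩ.mem_nhds hp)).differentiableAt (by simp)).hasFDerivAt

theorem fderiv_apply_eq (f : Pt → ℝ) (p : Pt) (a b c : ℝ) :
    fderiv ℝ f p (a, b, c) = partT f p * a + partX f p * b + partU f p * c := by
  have : ((a, b, c) : Pt) = a • (1, 0, 0) + b • (0, 1, 0) + c • (0, 0, 1) := by simp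
  rw [this, map_add, map_add, map_smul, map_smul, map_smul]
  simp only [partT, partX, partU, smul_eq_mul]
  ring

theorem hasDerivAt_comp_curve (hΩ : IsOpen Ω) (hf : ContDiffOn ℝ ∞ f Ω) {a b c : ℝ → ℝ}
    {a' b' c' s : ℝ} (hp : (a s, b s, c s) ∈ Ω) (ha : HasDerivAt a a' s) (hb : HasDerivAt b b' s)
    (hc : HasDerivAt c c' s) :
    HasDerivAt (fun s => f (a s, b s, c s)) (partT f (a s, b s, c s) * a'
      + partX f (a s, b s, c s) * b' + partU f (a s, b s, c s) * c') s := by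
  rw [← fderiv_apply_eq]
  exact (hasFDerivAt_of_contDiffOn hΩ hf hp).comp_hasDerivAt s (ha.prodMk (hb.prodMk hc))

theorem hasDerivAt_partT (hΩ : IsOpen Ω) (hf : ContDiffOn ℝ ∞ f Ω) {t x u : ℝ}
    (hp : (t, x, u) ∈ Ω) : HasDerivAt (fun s => f (s, x, u)) (partT f (t, x, u)) t := by
  simpa using hasDerivAt_comp_curve hΩ hf (a := fun s => s) (b := fun _ => x) (c := fun _ => u) hp
    (hasDerivAt_id t) (hasDerivAt_const t x) (hasDerivAt_const t u)

theorem hasDerivAt_partX (hΩ : IsOpen Ω) (hf : ContDiffOn ℝ ∞ f Ω) {t x u : ℝ}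
    (hp : (t, x, u) ∈ Ω) : HasDerivAt (fun y => f (t, y, u)) (partX f (t, x, u)) x := by
  simpa using hasDerivAt_comp_curve hΩ hf (a := fun _ => t) (b := fun y => y) (c := fun _ => u) hp
    (hasDerivAt_const x t) (hasDerivAt_id x) (hasDerivAt_const x u)

theorem hasDerivAt_partU (hΩ : IsOpen Ω) (hf : ContDiffOn ℝ ∞ f Ω) {t x u : ℝ}
    (hp : (t, x, u) ∈ Ω) : HasDerivAt (fun w => f (t, x, w)) (partU f (t, x, u)) u := by
  simpa using hasDerivAt_comp_curve hΩ hf (a := fun _ => t) (b := fun _ => x) (c := fun w => w) hp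
    (hasDerivAt_const u t) (hasDerivAt_const u x) (hasDerivAt_id u)

theorem fderiv_fderiv_apply (hΩ : IsOpen Ω) (hf : ContDiffOn ℝ ∞ f Ω) {p : Pt} (hp : p ∈ Ω)
    (a b : Pt) : fderiv ℝ (fun q => fderiv ℝ f q b) p a = fderiv ℝ (fderiv ℝ f) p a b := by
  have h : HasFDerivAt (fderiv ℝ f) (fderiv ℝ (fderiv ℝ f) p) p :=
    (((hf.fderiv_of_isOpen hΩ (m := ∞) (by simp)).contDiffAt
      (hΩ.mem_nhds hp)).differentiableAt (by simp)).hasFDerivAt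
  have := (h.clm_apply (hasFDerivAt_const b p)).fderiv
  rw [this]
  simp

theorem fderiv_fderiv_comm (hΩ : IsOpen Ω) (hf : ContDiffOn ℝ ∞ f Ω) {p : Pt} (hp : p ∈ Ω)
    (a b : Pt) :
    fderiv ℝ (fun q => fderiv ℝ f q b) p a = fderiv ℝ (fun q => fderiv ℝ f q a) p b := by
  rw [fderiv_fderiv_apply hΩ hf hp, fderiv_fderiv_apply hΩ hf hp]
  exact ((hf.contDiffAt (hΩ.mem_nhds hp)).isSymmSndFDerivAt
    (by rw [minSmoothness_of_isRCLikeNormedField]; exact WithTop.coe_le_coe.2 (le_top : (2 : ℕ∞) ≤ ⊤))).eq _ _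

theorem partX_partT (hΩ : IsOpen Ω) (hf : ContDiffOn ℝ ∞ f Ω) {p : Pt} (hp : p ∈ Ω) :
    partX (partT f) p = partT (partX f) p := fderiv_fderiv_comm hΩ hf hp _ _

theorem partU_partT (hΩ : IsOpen Ω) (hf : ContDiffOn ℝ ∞ f Ω) {p : Pt} (hp : p ∈ Ω) :
    partU (partT f) p = partT (partU f) p := fderiv_fderiv_comm hΩ hf hp _ _

theorem partU_partX (hΩ : IsOpen Ω) (hf : ContDiffOn ℝ ∞ f Ω) {p : Pt} (hp : p ∈ Ω) :
    partU (partX f) p = partX (partU f) p := fderiv_fderiv_comm hΩ hf hp _ _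

theorem fderiv_congr_of_eqOn (hΩ : IsOpen Ω) (h : EqOn f g Ω) {p : Pt} (hp : p ∈ Ω) :
    fderiv ℝ f p = fderiv ℝ g p :=
  (h.eventuallyEq_of_mem (hΩ.mem_nhds hp)).fderiv_eq

theorem partT_congr (hΩ : IsOpen Ω) (h : EqOn f g Ω) : EqOn (partT f) (partT g) Ω :=
  fun p hp => by simp only [partT, fderiv_congr_of_eqOn hΩ h hp]

theorem partX_congr (hΩ : IsOpen Ω) (h : EqOn f g Ω) : EqOn (partX f) (partX g) Ω :=
  fun p hp => by simp only [partX, fderiv_congr_of_eqOn hΩ h hp]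

theorem partU_congr (hΩ : IsOpen Ω) (h : EqOn f g Ω) : EqOn (partU f) (partU g) Ω :=
  fun p hp => by simp only [partU, fderiv_congr_of_eqOn hΩ h hp]

theorem partT_eq_zero (hΩ : IsOpen Ω) (h : ∀ p ∈ Ω, f p = 0) : ∀ p ∈ Ω, partT f p = 0 :=
  fun p hp => by rw [partT_congr hΩ (g := fun _ => 0) h hp]; simp [partT]

theorem partX_eq_zero (hΩ : IsOpen Ω) (h : ∀ p ∈ Ω, f p = 0) : ∀ p ∈ Ω, partX f p = 0 :=
  fun p hp => by rw [partX_congr hΩ (g := fun _ => 0) h hp]; simp [partX]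

theorem partU_eq_zero (hΩ : IsOpen Ω) (h : ∀ p ∈ Ω, f p = 0) : ∀ p ∈ Ω, partU f p = 0 :=
  fun p hp => by rw [partU_congr hΩ (g := fun _ => 0) h hp]; simp [partU]

theorem derivT_unique (hΩ : IsOpen Ω) (h : EqOn f g Ω) {t x u a b : ℝ} (hp : (t, x, u) ∈ Ω)
    (ha : HasDerivAt (fun s => f (s, x, u)) a t) (hb : HasDerivAt (fun s => g (s, x, u)) b t) :
    a = b := by
  refine ha.unique (hb.congr_of_eventuallyEq ?_)
  have hc : ContinuousAt (fun s : ℝ => ((s, x, u) : Pt)) t := by fun_prop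
  filter_upwards [hc.preimage_mem_nhds (hΩ.mem_nhds hp)] with s hs using h hs

theorem derivX_unique (hΩ : IsOpen Ω) (h : EqOn f g Ω) {t x u a b : ℝ} (hp : (t, x, u) ∈ Ω)
    (ha : HasDerivAt (fun y => f (t, y, u)) a x) (hb : HasDerivAt (fun y => g (t, y, u)) b x) :
    a = b := by
  refine ha.unique (hb.congr_of_eventuallyEq ?_)
  have hc : ContinuousAt (fun y : ℝ => ((t, y, u) : Pt)) x := by fun_prop
  filter_upwards [hc.preimage_mem_nhds (hΩ.mem_nhds hp)] with s hs using h hs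

theorem derivU_unique (hΩ : IsOpen Ω) (h : EqOn f g Ω) {t x u a b : ℝ} (hp : (t, x, u) ∈ Ω)
    (ha : HasDerivAt (fun w => f (t, x, w)) a u) (hb : HasDerivAt (fun w => g (t, x, w)) b u) :
    a = b := by
  refine ha.unique (hb.congr_of_eventuallyEq ?_)
  have hc : ContinuousAt (fun w : ℝ => ((t, x, w) : Pt)) u := by fun_prop
  filter_upwards [hc.preimage_mem_nhds (hΩ.mem_nhds hp)] with s hs using h hs

end Partial

/-! ### Functions of `(t, x)` -/

section SmoothAt

variable {u : ℝ → ℝ → ℝ} {t x : ℝ}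

theorem dt_eq_fderiv (h : DifferentiableAt ℝ (fun q : ℝ × ℝ => u q.1 q.2) (t, x)) :
    dt u t x = fderiv ℝ (fun q : ℝ × ℝ => u q.1 q.2) (t, x) (1, 0) := by
  have := h.hasFDerivAt.comp_hasDerivAt t
    ((hasDerivAt_id t).prodMk (hasDerivAt_const t x))
  exact this.deriv

theorem dx_eq_fderiv (h : DifferentiableAt ℝ (fun q : ℝ × ℝ => u q.1 q.2) (t, x)) :
    dx u t x = fderiv ℝ (fun q : ℝ × ℝ => u q.1 q.2) (t, x) (0, 1) := by
  have := h.hasFDerivAt.comp_hasDerivAt x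
    ((hasDerivAt_const x t).prodMk (hasDerivAt_id x))
  exact this.deriv

theorem SmoothAt.differentiableAt (h : SmoothAt u t x) :
    DifferentiableAt ℝ (fun q : ℝ × ℝ => u q.1 q.2) (t, x) :=
  ContDiffAt.differentiableAt h (by simp)

theorem SmoothAt.eventually_differentiableAt (h : SmoothAt u t x) :
    ∀ᶠ q : ℝ × ℝ in 𝓝 (t, x),
      DifferentiableAt ℝ (fun q : ℝ × ℝ => u q.1 q.2) (q.1, q.2) := by
  have h1 : ContDiffAt ℝ 1 (fun q : ℝ × ℝ => u q.1 q.2) (t, x) := ContDiffAt.of_le h (by simp)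
  filter_upwards [h1.eventually (by simp)] with q hq using hq.differentiableAt (by simp)

theorem SmoothAt.fderiv_apply (h : SmoothAt u t x) (e : ℝ × ℝ) :
    ContDiffAt ℝ ∞ (fun q => fderiv ℝ (fun q : ℝ × ℝ => u q.1 q.2) q e) (t, x) :=
  (ContDiffAt.fderiv_right h (m := ∞) (by simp)).clm_apply contDiffAt_const

theorem SmoothAt.dt (h : SmoothAt u t x) : SmoothAt (dt u) t x := by
  refine (h.fderiv_apply (1, 0)).congr_of_eventuallyEq ?_
  filter_upwards [h.eventually_differentiableAt] with q hq using dt_eq_fderiv hq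

theorem SmoothAt.dx (h : SmoothAt u t x) : SmoothAt (dx u) t x := by
  refine (h.fderiv_apply (0, 1)).congr_of_eventuallyEq ?_
  filter_upwards [h.eventually_differentiableAt] with q hq using dx_eq_fderiv hq

theorem hasDerivAt_comp_plane_curve {a b : ℝ → ℝ} {a' b' s : ℝ}
    (h : DifferentiableAt ℝ (fun q : ℝ × ℝ => u q.1 q.2) (a s, b s)) (ha : HasDerivAt a a' s)
    (hb : HasDerivAt b b' s) :
    HasDerivAt (fun s => u (a s) (b s)) (dt u (a s) (b s) * a' + dx u (a s) (b s) * b') s := by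
  have := h.hasFDerivAt.comp_hasDerivAt s (ha.prodMk hb)
  have e : ((a', b') : ℝ × ℝ) = a' • (1, 0) + b' • (0, 1) := by simp
  rw [e, map_add, map_smul, map_smul, ← dt_eq_fderiv h, ← dx_eq_fderiv h, smul_eq_mul,
    smul_eq_mul, mul_comm a', mul_comm b'] at this
  exact this

theorem SmoothAt.hasDerivAt_dt (h : SmoothAt u t x) :
    HasDerivAt (fun s => u s x) (Burgers.dt u t x) t := by
  simpa using hasDerivAt_comp_plane_curve (a := fun s => s) (b := fun _ => x) h.differentiableAt
    (hasDerivAt_id t) (hasDerivAt_const t x)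

theorem SmoothAt.hasDerivAt_dx (h : SmoothAt u t x) :
    HasDerivAt (fun y => u t y) (Burgers.dx u t x) x := by
  simpa using hasDerivAt_comp_plane_curve (a := fun _ => t) (b := fun y => y) h.differentiableAt
    (hasDerivAt_const x t) (hasDerivAt_id x)

theorem SmoothAt.eventually_hasDerivAt_dx (h : SmoothAt u t x) :
    ∀ᶠ y in 𝓝 x, HasDerivAt (fun y => u t y) (Burgers.dx u t y) y := by
  have hc : ContinuousAt (fun y : ℝ => (t, y)) x := by fun_prop
  filter_upwards [hc.eventually h.eventually_differentiableAt] with y hy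
  simpa using hasDerivAt_comp_plane_curve (a := fun _ => t) (b := fun y => y) hy
    (hasDerivAt_const y t) (hasDerivAt_id y)

end SmoothAt

theorem Eqn.isOpen_U (E : Eqn) : IsOpen E.U := by
  unfold Eqn.U
  split_ifs
  exacts [isOpen_univ, isOpen_Ioi]

theorem Eqn.isOpen_domain (E : Eqn) : IsOpen E.domain :=
  (E.isOpen_I.preimage continuous_fst).inter
    (E.isOpen_U.preimage (continuous_snd.comp continuous_snd))

/-! ### Total derivatives along a function of `(t, x)` -/

/-- The total derivative `D_x f`. -/
def totalX (f : Pt → ℝ) (u : ℝ → ℝ → ℝ) (t x : ℝ) : ℝ :=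
  partX f (lift u t x) + partU f (lift u t x) * dx u t x

/-- The total derivative `D_t f`. -/
def totalT (f : Pt → ℝ) (u : ℝ → ℝ → ℝ) (t x : ℝ) : ℝ :=
  partT f (lift u t x) + partU f (lift u t x) * dt u t x

/-- The second total derivative `D_x ^ 2 f`. -/
def totalXX (f : Pt → ℝ) (u : ℝ → ℝ → ℝ) (t x : ℝ) : ℝ :=
  partX (partX f) (lift u t x) + 2 * partX (partU f) (lift u t x) * dx u t x
    + partU (partU f) (lift u t x) * dx u t x ^ 2 + partU f (lift u t x) * dx (dx u) t x

section Total

variable {Ω : Set Pt} {f : Pt → ℝ} {u : ℝ → ℝ → ℝ} {t x : ℝ}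

theorem eventually_lift_mem (hΩ : IsOpen Ω) (hu : SmoothAt u t x) (hp : lift u t x ∈ Ω) :
    ∀ᶠ q : ℝ × ℝ in 𝓝 (t, x), lift u q.1 q.2 ∈ Ω := by
  have hc : ContinuousAt (fun q : ℝ × ℝ => lift u q.1 q.2) (t, x) :=
    continuousAt_fst.prodMk (continuousAt_snd.prodMk hu.differentiableAt.continuousAt)
  exact hc.preimage_mem_nhds (hΩ.mem_nhds hp)

theorem eventually_lift_mem_x (hΩ : IsOpen Ω) (hu : SmoothAt u t x) (hp : lift u t x ∈ Ω) :
    ∀ᶠ y in 𝓝 x, lift u t y ∈ Ω := by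
  have hc : ContinuousAt (fun y : ℝ => (t, y)) x := by fun_prop
  exact hc.eventually (eventually_lift_mem hΩ hu hp)

theorem hasDerivAt_totalT (hΩ : IsOpen Ω) (hf : ContDiffOn ℝ ∞ f Ω) (hu : SmoothAt u t x)
    (hp : lift u t x ∈ Ω) : HasDerivAt (fun s => f (lift u s x)) (totalT f u t x) t := by
  have := hasDerivAt_comp_curve hΩ hf (a := fun s => s) (b := fun _ => x) (c := fun s => u s x) hp
    (hasDerivAt_id t) (hasDerivAt_const t x) hu.hasDerivAt_dt
  simpa [totalT, lift] using this

theorem hasDerivAt_totalX_of (hΩ : IsOpen Ω) (hf : ContDiffOn ℝ ∞ f Ω)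
    (hu : HasDerivAt (fun y => u t y) (dx u t x) x)
    (hp : lift u t x ∈ Ω) : HasDerivAt (fun y => f (lift u t y)) (totalX f u t x) x := by
  have := hasDerivAt_comp_curve hΩ hf (a := fun _ => t) (b := fun y => y) (c := fun y => u t y) hp
    (hasDerivAt_const x t) (hasDerivAt_id x) hu
  simpa [totalX, lift] using this

theorem hasDerivAt_totalX (hΩ : IsOpen Ω) (hf : ContDiffOn ℝ ∞ f Ω) (hu : SmoothAt u t x)
    (hp : lift u t x ∈ Ω) : HasDerivAt (fun y => f (lift u t y)) (totalX f u t x) x :=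
  hasDerivAt_totalX_of hΩ hf hu.hasDerivAt_dx hp

theorem eventually_dx_comp_lift (hΩ : IsOpen Ω) (hf : ContDiffOn ℝ ∞ f Ω) (hu : SmoothAt u t x)
    (hp : lift u t x ∈ Ω) :
    ∀ᶠ y in 𝓝 x, dx (fun s y => f (lift u s y)) t y = totalX f u t y := by
  filter_upwards [eventually_lift_mem_x hΩ hu hp, hu.eventually_hasDerivAt_dx] with y h1 h2
    using (hasDerivAt_totalX_of hΩ hf h2 h1).deriv

theorem hasDerivAt_totalXX (hΩ : IsOpen Ω) (hf : ContDiffOn ℝ ∞ f Ω) (hu : SmoothAt u t x)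
    (hp : lift u t x ∈ Ω) : HasDerivAt (fun y => totalX f u t y) (totalXX f u t x) x := by
  have h := (hasDerivAt_totalX hΩ (contDiffOn_partX hΩ hf) hu hp).add
    ((hasDerivAt_totalX hΩ (contDiffOn_partU hΩ hf) hu hp).mul hu.dx.hasDerivAt_dx)
  refine h.congr_deriv ?_
  simp only [totalX, totalXX, partU_partX hΩ hf hp]
  ring

end Total

section Prolongation

variable {Ω : Set Pt} {Q : VF} {u : ℝ → ℝ → ℝ} {t x : ℝ}

/-- The coefficient of `∂_t`. -/
def coeffT (Q : VF) : Pt → ℝ := fun p => (Q p).1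

/-- The coefficient of `∂_x`. -/
def coeffX (Q : VF) : Pt → ℝ := fun p => (Q p).2.1

/-- The coefficient of `∂_u`. -/
def coeffU (Q : VF) : Pt → ℝ := fun p => (Q p).2.2

theorem contDiffOn_coeffT (h : ContDiffOn ℝ ∞ Q Ω) : ContDiffOn ℝ ∞ (coeffT Q) Ω :=
  contDiff_fst.comp_contDiffOn h

theorem contDiffOn_coeffX (h : ContDiffOn ℝ ∞ Q Ω) : ContDiffOn ℝ ∞ (coeffX Q) Ω :=
  (contDiff_fst.comp contDiff_snd).comp_contDiffOn h

theorem contDiffOn_coeffU (h : ContDiffOn ℝ ∞ Q Ω) : ContDiffOn ℝ ∞ (coeffU Q) Ω :=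
  (contDiff_snd.comp contDiff_snd).comp_contDiffOn h

theorem prolT_eq (hΩ : IsOpen Ω) (hQ : ContDiffOn ℝ ∞ Q Ω) (hu : SmoothAt u t x)
    (hp : lift u t x ∈ Ω) :
    prolT Q u t x = totalT (coeffU Q) u t x - dt u t x * totalT (coeffT Q) u t x
      - dx u t x * totalT (coeffX Q) u t x := by
  have hU := (hasDerivAt_totalT hΩ (contDiffOn_coeffU hQ) hu hp).deriv
  have hT := (hasDerivAt_totalT hΩ (contDiffOn_coeffT hQ) hu hp).deriv
  have hX := (hasDerivAt_totalT hΩ (contDiffOn_coeffX hQ) hu hp).deriv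
  rw [← hU, ← hT, ← hX]
  rfl

theorem eventually_prolX_eq (hΩ : IsOpen Ω) (hQ : ContDiffOn ℝ ∞ Q Ω) (hu : SmoothAt u t x)
    (hp : lift u t x ∈ Ω) :
    ∀ᶠ y in 𝓝 x, prolX Q u t y = totalX (coeffU Q) u t y - dt u t y * totalX (coeffT Q) u t y
      - dx u t y * totalX (coeffX Q) u t y := by
  filter_upwards [eventually_dx_comp_lift hΩ (contDiffOn_coeffU hQ) hu hp,
    eventually_dx_comp_lift hΩ (contDiffOn_coeffT hQ) hu hp,
    eventually_dx_comp_lift hΩ (contDiffOn_coeffX hQ) hu hp] with y hU hT hX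
  rw [← hU, ← hT, ← hX]
  rfl

theorem prolXX_eq (hΩ : IsOpen Ω) (hQ : ContDiffOn ℝ ∞ Q Ω) (hu : SmoothAt u t x)
    (hp : lift u t x ∈ Ω) :
    prolXX Q u t x = totalXX (coeffU Q) u t x - dt u t x * totalXX (coeffT Q) u t x
      - dx u t x * totalXX (coeffX Q) u t x - 2 * dx (dt u) t x * totalX (coeffT Q) u t x
      - 2 * dx (dx u) t x * totalX (coeffX Q) u t x := by
  have h := ((hasDerivAt_totalXX hΩ (contDiffOn_coeffU hQ) hu hp).sub
    (hu.dt.hasDerivAt_dx.mul (hasDerivAt_totalXX hΩ (contDiffOn_coeffT hQ) hu hp))).sub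
    (hu.dx.hasDerivAt_dx.mul (hasDerivAt_totalXX hΩ (contDiffOn_coeffX hQ) hu hp))
  have h1 : dx (prolX Q u) t x = _ :=
    (h.congr_of_eventuallyEq (eventually_prolX_eq hΩ hQ hu hp)).deriv
  have hT : dx (fun s y => (Q (lift u s y)).1) t x = _ :=
    (eventually_dx_comp_lift hΩ (contDiffOn_coeffT hQ) hu hp).self_of_nhds
  have hX : dx (fun s y => (Q (lift u s y)).2.1) t x = _ :=
    (eventually_dx_comp_lift hΩ (contDiffOn_coeffX hQ) hu hp).self_of_nhds
  rw [prolXX, h1, hT, hX]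
  ring

end Prolongation

/-! ### Polynomial representatives of jets -/

/-- A polynomial in `(s, y)` with given derivatives at `(t, x)`. -/
def jet (t x v p q r w e : ℝ) (s y : ℝ) : ℝ :=
  v + p * (s - t) + q * (y - x) + r / 2 * (y - x) ^ 2 + w * (s - t) * (y - x) + e * (s - t) ^ 2

section Jet

variable (t x v p q r w e s y : ℝ)

theorem smoothAt_jet : SmoothAt (jet t x v p q r w e) s y := by
  unfold SmoothAt jet
  fun_prop

theorem dt_jet : dt (jet t x v p q r w e) s y = p + w * (y - x) + 2 * e * (s - t) := by
  have h := (hasDerivAt_id s).sub_const t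
  have := (((((hasDerivAt_const s v).add (h.const_mul p)).add_const (q * (y - x))).add_const
    (r / 2 * (y - x) ^ 2)).add ((h.const_mul w).mul_const (y - x))).add ((h.pow 2).const_mul e)
  refine (this.congr_deriv ?_).deriv
  simp
  ring

theorem dx_jet : dx (jet t x v p q r w e) s y = q + r * (y - x) + w * (s - t) := by
  have h := (hasDerivAt_id y).sub_const x
  have := (((h.const_mul q).const_add (v + p * (s - t))).add ((h.pow 2).const_mul (r / 2))).add
    (h.const_mul (w * (s - t))) |>.add_const (e * (s - t) ^ 2)
  refine (this.congr_deriv ?_).deriv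
  simp
  ring

@[simp] theorem jet_base : jet t x v p q r w e t x = v := by simp [jet]

@[simp] theorem lift_jet_base : lift (jet t x v p q r w e) t x = (t, x, v) := by simp [lift]

@[simp] theorem dt_jet_base : dt (jet t x v p q r w e) t x = p := by simp [dt_jet]

@[simp] theorem dx_jet_base : dx (jet t x v p q r w e) t x = q := by simp [dx_jet]

@[simp] theorem dx_dx_jet_base : dx (dx (jet t x v p q r w e)) t x = r := by
  have h : dx (jet t x v p q r w e) = fun s y => q + r * (y - x) + w * (s - t) := by
    ext s y
    exact dx_jet ..
  rw [h]
  have := ((((hasDerivAt_id x).sub_const x).const_mul r).const_add q).add_const (w * (t - t))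
  exact this.deriv.trans (by simp)

@[simp] theorem dx_dt_jet_base : dx (dt (jet t x v p q r w e)) t x = w := by
  have h : dt (jet t x v p q r w e) = fun s y => p + w * (y - x) + 2 * e * (s - t) := by
    ext s y
    exact dt_jet ..
  rw [h]
  have := ((((hasDerivAt_id x).sub_const x).const_mul w).const_add p).add_const (2 * e * (t - t))
  exact this.deriv.trans (by simp)

theorem holdsAt_jet (E : Eqn) : E.HoldsAt (jet t x v p q r w e) t x ↔
    p + v ^ E.n * q + E.h t * v = E.g t * r := by
  simp [Eqn.HoldsAt]

end Jet

/-! ### Determining equations -/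

section Determining

variable {E : Eqn} {Q : VF}

theorem Eqn.IsLieSymmetry.jet_identity (hQ : E.IsLieSymmetry Q) {t x v : ℝ}
    (hp : (t, x, v) ∈ E.domain) (q r w : ℝ) :
    let P : Pt := (t, x, v)
    let τ := coeffT Q
    let ξ := coeffX Q
    let η := coeffU Q
    let p := E.g t * r - v ^ E.n * q - E.h t * v
    τ P * (deriv E.h t * v - deriv E.g t * r) + η P * (E.n * v ^ (E.n - 1) * q + E.h t)
      + (partT η P + partU η P * p - p * (partT τ P + partU τ P * p)
        - q * (partT ξ P + partU ξ P * p))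
      + v ^ E.n * (partX η P + partU η P * q - p * (partX τ P + partU τ P * q)
        - q * (partX ξ P + partU ξ P * q))
      - E.g t * (partX (partX η) P + 2 * partX (partU η) P * q + partU (partU η) P * q ^ 2
          + partU η P * r
        - p * (partX (partX τ) P + 2 * partX (partU τ) P * q + partU (partU τ) P * q ^ 2
          + partU τ P * r)
        - q * (partX (partX ξ) P + 2 * partX (partU ξ) P * q + partU (partU ξ) P * q ^ 2
          + partU ξ P * r)
        - 2 * w * (partX τ P + partU τ P * q) - 2 * r * (partX ξ P + partU ξ P * q)) = 0 := by
  intro P τ ξ η p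
  have hu := smoothAt_jet t x v p q r w 0 t x
  have hl : lift (jet t x v p q r w 0) t x ∈ E.domain := by simpa using hp
  have h := hQ.2 _ t x hl hu ((holdsAt_jet ..).2 (by simp only [p]; ring))
  have hX := (eventually_prolX_eq E.isOpen_domain hQ.1 hu hl).self_of_nhds
  rw [Eqn.prolApply, prolT_eq E.isOpen_domain hQ.1 hu hl, hX,
    prolXX_eq E.isOpen_domain hQ.1 hu hl] at h
  simp only [totalX, totalT, totalXX, lift_jet_base, dt_jet_base, dx_jet_base, dx_dx_jet_base,
    dx_dt_jet_base, jet_base] at h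
  exact h

theorem Eqn.IsLieSymmetry.coeffT_eq (hQ : E.IsLieSymmetry Q) :
    ∀ P ∈ E.domain, partX (coeffT Q) P = 0 ∧ partU (coeffT Q) P = 0 := by
  rintro ⟨t, x, v⟩ hp
  have hg := E.g_ne_zero t hp.1
  have key : ∀ q, E.g t * (partX (coeffT Q) (t, x, v) + partU (coeffT Q) (t, x, v) * q) = 0 := by
    intro q
    have h1 := hQ.jet_identity hp q 0 1
    have h0 := hQ.jet_identity hp q 0 0
    simp only at h1 h0
    linear_combination (h1 - h0) / 2
  have h0 := (mul_eq_zero.1 (key 0)).resolve_left hg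
  have h1 := (mul_eq_zero.1 (key 1)).resolve_left hg
  constructor <;> linarith

theorem Eqn.IsLieSymmetry.coeffX_eq (hQ : E.IsLieSymmetry Q) :
    ∀ P ∈ E.domain, partU (coeffX Q) P = 0 ∧
      2 * E.g P.1 * partX (coeffX Q) P
        = coeffT Q P * deriv E.g P.1 + E.g P.1 * partT (coeffT Q) P := by
  have hx := partX_eq_zero E.isOpen_domain fun P hP => (hQ.coeffT_eq P hP).1
  have hxu := partX_eq_zero E.isOpen_domain fun P hP => (hQ.coeffT_eq P hP).2
  have huu := partU_eq_zero E.isOpen_domain fun P hP => (hQ.coeffT_eq P hP).2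
  rintro ⟨t, x, v⟩ hp
  have hg := E.g_ne_zero t hp.1
  have key : ∀ q, 2 * E.g t * partX (coeffX Q) (t, x, v) + 2 * E.g t * partU (coeffX Q) (t, x, v) * q
      = coeffT Q (t, x, v) * deriv E.g t + E.g t * partT (coeffT Q) (t, x, v) := by
    intro q
    have h1 := hQ.jet_identity hp q 1 0
    have h0 := hQ.jet_identity hp q 0 0
    simp only [hx _ hp, hxu _ hp, huu _ hp, (hQ.coeffT_eq _ hp).1, (hQ.coeffT_eq _ hp).2] at h1 h0
    linear_combination h1 - h0
  have h0 := key 0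
  have h1 := key 1
  have : E.g t * partU (coeffX Q) (t, x, v) = 0 := by linarith
  exact ⟨(mul_eq_zero.1 this).resolve_left hg, by simpa using h0⟩

theorem Eqn.IsLieSymmetry.partX_partX_coeffX (hQ : E.IsLieSymmetry Q) :
    ∀ P ∈ E.domain, partX (partX (coeffX Q)) P = 0 := by
  rintro ⟨t, x, v⟩ hp
  have hO := E.isOpen_domain
  have hsT := contDiffOn_coeffT hQ.1
  have hsX := contDiffOn_coeffX hQ.1
  have h := derivX_unique hO
    (f := fun P => 2 * E.g P.1 * partX (coeffX Q) P)
    (g := fun P => coeffT Q P * deriv E.g P.1 + E.g P.1 * partT (coeffT Q) P)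
    (fun P hP => (hQ.coeffX_eq P hP).2) hp
    ((hasDerivAt_partX hO (contDiffOn_partX hO hsX) hp).const_mul (2 * E.g t))
    (((hasDerivAt_partX hO hsT hp).mul_const (deriv E.g t)).add
      ((hasDerivAt_partX hO (contDiffOn_partT hO hsT) hp).const_mul (E.g t)))
  rw [(hQ.coeffT_eq _ hp).1, partX_partT hO hsT hp,
    partT_eq_zero hO (fun P hP => (hQ.coeffT_eq P hP).1) _ hp] at h
  have hg := E.g_ne_zero t hp.1
  simpa [hg] using h

theorem Eqn.IsLieSymmetry.coeffU_eq (hQ : E.IsLieSymmetry Q) {t x v : ℝ}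
    (hp : (t, x, v) ∈ E.domain) :
    let P : Pt := (t, x, v)
    let τ := coeffT Q
    let ξ := coeffX Q
    let η := coeffU Q
    partU (partU η) P = 0 ∧
    E.n * v ^ (E.n - 1) * η P + v ^ E.n * (partT τ P - partX ξ P)
      = partT ξ P + 2 * E.g t * partX (partU η) P ∧
    τ P * deriv E.h t * v + E.h t * η P + partT η P - E.h t * v * partU η P
      + E.h t * v * partT τ P + v ^ E.n * partX η P - E.g t * partX (partX η) P = 0 := by
  intro P τ ξ η
  have hO := E.isOpen_domain
  have hx := partX_eq_zero hO fun P hP => (hQ.coeffT_eq P hP).1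
  have hxu := partX_eq_zero hO fun P hP => (hQ.coeffT_eq P hP).2
  have huu := partU_eq_zero hO fun P hP => (hQ.coeffT_eq P hP).2
  have kxu := partX_eq_zero hO fun P hP => (hQ.coeffX_eq P hP).1
  have kuu := partU_eq_zero hO fun P hP => (hQ.coeffX_eq P hP).1
  have hg := E.g_ne_zero t hp.1
  have h1 := hQ.jet_identity hp 1 0 0
  have h0 := hQ.jet_identity hp 0 0 0
  have h2 := hQ.jet_identity hp (-1) 0 0
  simp only [hx _ hp, hxu _ hp, huu _ hp, (hQ.coeffT_eq _ hp).1, (hQ.coeffT_eq _ hp).2,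
    (hQ.coeffX_eq _ hp).1, kxu _ hp, kuu _ hp, hQ.partX_partX_coeffX _ hp] at h1 h0 h2
  refine ⟨?_, ?_, ?_⟩
  · have : E.g t * partU (partU η) P = 0 := by linear_combination h0 - (h1 + h2) / 2
    exact (mul_eq_zero.1 this).resolve_left hg
  · linear_combination (h1 - h2) / 2
  · linear_combination h0

end Determining

theorem eq_of_hasDerivAt_zero {s : Set ℝ} (hs : IsOpen s) (hc : IsPreconnected s) {f : ℝ → ℝ}
    (hf : ∀ x ∈ s, HasDerivAt f 0 x) {x y : ℝ} (hx : x ∈ s) (hy : y ∈ s) : f x = f y :=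
  hs.is_const_of_deriv_eq_zero hc (fun z hz => (hf z hz).differentiableAt.differentiableWithinAt)
    (fun z hz => (hf z hz).deriv) hx hy

theorem exists_const_of_hasDerivAt_zero {s : Set ℝ} (hs : IsOpen s) (hc : IsConnected s)
    {f : ℝ → ℝ} (hf : ∀ x ∈ s, HasDerivAt f 0 x) : ∃ c, ∀ x ∈ s, f x = c := by
  obtain ⟨y, hy⟩ := hc.nonempty
  exact ⟨f y, fun x hx => eq_of_hasDerivAt_zero hs hc.isPreconnected hf hx hy⟩

/-! ### The gauge functions -/

namespace Eqn.IsGauge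

variable {E : Eqn} {T Tt : ℝ → ℝ}

theorem pos (hT : E.IsGauge T Tt) {t : ℝ} (ht : t ∈ E.I) : 0 < Tt t := by
  obtain ⟨H, hH⟩ := hT
  rw [(hH t ht).2.1]
  exact Real.exp_pos _

theorem ne_zero (hT : E.IsGauge T Tt) {t : ℝ} (ht : t ∈ E.I) : Tt t ≠ 0 := (hT.pos ht).ne'

theorem hasDerivAt (hT : E.IsGauge T Tt) {t : ℝ} (ht : t ∈ E.I) : HasDerivAt T (Tt t) t := by
  obtain ⟨H, hH⟩ := hT
  exact (hH t ht).2.2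

theorem hasDerivAt_Tt (hT : E.IsGauge T Tt) {t : ℝ} (ht : t ∈ E.I) :
    HasDerivAt Tt (-(E.n * E.h t * Tt t)) t := by
  obtain ⟨H, hH⟩ := hT
  have h := ((hH t ht).1.const_mul (-E.n)).exp
  have h2 : Tt =ᶠ[𝓝 t] fun s => Real.exp (-E.n * H s) :=
    eventually_of_mem (E.isOpen_I.mem_nhds ht) fun s hs => (hH s hs).2.1
  refine (h.congr_of_eventuallyEq h2).congr_deriv ?_
  rw [(hH t ht).2.1]
  ring

theorem contDiffOn_Tt (hT : E.IsGauge T Tt) : ContDiffOn ℝ ∞ Tt E.I := by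
  obtain ⟨H, hH⟩ := hT
  have h1 : ContDiffOn ℝ ∞ H E.I := by
    rw [contDiffOn_infty_iff_deriv_of_isOpen E.isOpen_I]
    exact ⟨fun t ht => (hH t ht).1.differentiableAt.differentiableWithinAt,
      E.smooth_h.congr fun t ht => (hH t ht).1.deriv⟩
  exact (contDiffOn_const.mul h1).exp.congr fun t ht => (hH t ht).2.1

theorem contDiffOn (hT : E.IsGauge T Tt) : ContDiffOn ℝ ∞ T E.I := by
  rw [contDiffOn_infty_iff_deriv_of_isOpen E.isOpen_I]
  exact ⟨fun t ht => (hT.hasDerivAt ht).differentiableAt.differentiableWithinAt,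
    hT.contDiffOn_Tt.congr fun t ht => (hT.hasDerivAt ht).deriv⟩

end Eqn.IsGauge

theorem Eqn.hasDerivAt_h (E : Eqn) {t : ℝ} (ht : t ∈ E.I) : HasDerivAt E.h (deriv E.h t) t :=
  ((E.smooth_h.contDiffAt (E.isOpen_I.mem_nhds ht)).differentiableAt (by simp)).hasDerivAt

theorem Eqn.hasDerivAt_g (E : Eqn) {t : ℝ} (ht : t ∈ E.I) : HasDerivAt E.g (deriv E.g t) t :=
  ((E.smooth_g.contDiffAt (E.isOpen_I.mem_nhds ht)).differentiableAt (by simp)).hasDerivAt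

/-! ### The general form of a Lie symmetry -/

/-- The parameters of a Lie symmetry: `(a, k, m)` are the coefficients of the quadratic polynomial
`σ = a T ^ 2 + k T + m`, and `C` is the constant value of `σ (ln (g / T_t))_T`. -/
@[ext] structure Params where
  a : ℝ
  k : ℝ
  m : ℝ
  C : ℝ
  c : ℝ
  d : ℝ

/-- The quadratic polynomial with coefficients `a`, `k`, `m`. -/
def Params.σ (P : Params) (s : ℝ) : ℝ := P.a * s ^ 2 + P.k * s + P.m

/-- The vector field with the given parameters. -/
def field (n : ℝ) (h T Tt : ℝ → ℝ) (P : Params) : VF := vf fun t x u =>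
  (P.σ (T t) * (Tt t)⁻¹, (P.a * T t + (P.k + P.C) / 2) * x + (P.c * T t + P.d),
    (((P.C - P.k) / 2 - P.a * T t) / n - h t * (P.σ (T t) * (Tt t)⁻¹)) * u
      + (P.a * Tt t * x + P.c * Tt t))

/-- The conditions on the parameters of a Lie symmetry. -/
structure Eqn.Admits (E : Eqn) (T Tt : ℝ → ℝ) (P : Params) : Prop where
  a_eq : E.n ≠ 1 → P.a = 0
  c_eq : E.n ≠ 1 → P.c = 0
  ode : ∀ t ∈ E.I, P.σ (T t) * (deriv E.g t + E.n * E.h t * E.g t) = P.C * Tt t * E.g t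

section Symmetry

variable {E : Eqn} {T Tt : ℝ → ℝ} {Q : VF}

theorem Eqn.one_mem_U (E : Eqn) : (1 : ℝ) ∈ E.U := by
  unfold Eqn.U
  split_ifs <;> simp

theorem Eqn.isPreconnected_U (E : Eqn) : IsPreconnected E.U := by
  unfold Eqn.U
  split_ifs
  exacts [isPreconnected_univ, isPreconnected_Ioi]

theorem Eqn.pos_of_mem_U {E : Eqn} (hn : E.n ≠ 1) {u : ℝ} (hu : u ∈ E.U) : 0 < u := by
  simpa [Eqn.U, hn] using hu

theorem Eqn.rpow_n_of_mem_U {E : Eqn} {u : ℝ} (hu : u ∈ E.U) :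
    u * u ^ (E.n - 1) = u ^ E.n := by
  by_cases hn : E.n = 1
  · simp [hn]
  · have := Eqn.pos_of_mem_U hn hu
    rw [Real.rpow_sub_one this.ne']
    field_simp

theorem Eqn.eq_of_partX_partU {f : Pt → ℝ} (hf : ContDiffOn ℝ ∞ f E.domain)
    (hx : ∀ P ∈ E.domain, partX f P = 0) (hu : ∀ P ∈ E.domain, partU f P = 0) {t x v : ℝ}
    (hp : (t, x, v) ∈ E.domain) : f (t, x, v) = f (t, 0, 1) := by
  have h1 : f (t, x, v) = f (t, x, 1) :=
    eq_of_hasDerivAt_zero E.isOpen_U E.isPreconnected_U (f := fun w => f (t, x, w))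
      (fun w hw => by
        have hw' : (t, x, w) ∈ E.domain := ⟨hp.1, hw⟩
        simpa [hu _ hw'] using hasDerivAt_partU E.isOpen_domain hf hw') hp.2 E.one_mem_U
  have h2 : f (t, x, 1) = f (t, 0, 1) :=
    eq_of_hasDerivAt_zero isOpen_univ isPreconnected_univ (f := fun y => f (t, y, 1))
      (fun y _ => by
        have hw' : (t, y, (1 : ℝ)) ∈ E.domain := ⟨hp.1, E.one_mem_U⟩
        simpa [hx _ hw'] using hasDerivAt_partX E.isOpen_domain hf hw') (mem_univ _) (mem_univ _)
  rw [h1, h2]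

theorem Eqn.IsLieSymmetry.coeffT_formula (hQ : E.IsLieSymmetry Q) {t x v : ℝ}
    (hp : (t, x, v) ∈ E.domain) : coeffT Q (t, x, v) = coeffT Q (t, 0, 1) :=
  E.eq_of_partX_partU (contDiffOn_coeffT hQ.1) (fun P hP => (hQ.coeffT_eq P hP).1)
    (fun P hP => (hQ.coeffT_eq P hP).2) hp

theorem Eqn.IsLieSymmetry.partT_coeffT_formula (hQ : E.IsLieSymmetry Q) {t x v : ℝ}
    (hp : (t, x, v) ∈ E.domain) : partT (coeffT Q) (t, x, v) = partT (coeffT Q) (t, 0, 1) := by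
  have hO := E.isOpen_domain
  refine E.eq_of_partX_partU (contDiffOn_partT hO (contDiffOn_coeffT hQ.1)) (fun P hP => ?_)
    (fun P hP => ?_) hp
  · rw [partX_partT hO (contDiffOn_coeffT hQ.1) hP]
    exact partT_eq_zero hO (fun P hP => (hQ.coeffT_eq P hP).1) P hP
  · rw [partU_partT hO (contDiffOn_coeffT hQ.1) hP]
    exact partT_eq_zero hO (fun P hP => (hQ.coeffT_eq P hP).2) P hP

theorem Eqn.IsLieSymmetry.partX_coeffX_formula (hQ : E.IsLieSymmetry Q) {t x v : ℝ}
    (hp : (t, x, v) ∈ E.domain) : partX (coeffX Q) (t, x, v) = partX (coeffX Q) (t, 0, 1) := by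
  have hO := E.isOpen_domain
  refine E.eq_of_partX_partU (contDiffOn_partX hO (contDiffOn_coeffX hQ.1))
    hQ.partX_partX_coeffX (fun P hP => ?_) hp
  rw [partU_partX hO (contDiffOn_coeffX hQ.1) hP]
  exact partX_eq_zero hO (fun P hP => (hQ.coeffX_eq P hP).1) P hP

theorem Eqn.IsLieSymmetry.coeffX_formula (hQ : E.IsLieSymmetry Q) {t x v : ℝ}
    (hp : (t, x, v) ∈ E.domain) :
    coeffX Q (t, x, v) = partX (coeffX Q) (t, 0, 1) * x + coeffX Q (t, 0, 1) := by
  have hO := E.isOpen_domain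
  have h1 : coeffX Q (t, x, v) = coeffX Q (t, x, 1) :=
    eq_of_hasDerivAt_zero E.isOpen_U E.isPreconnected_U (f := fun w => coeffX Q (t, x, w))
      (fun w hw => by
        have hw' : (t, x, w) ∈ E.domain := ⟨hp.1, hw⟩
        simpa [(hQ.coeffX_eq _ hw').1] using
          hasDerivAt_partU hO (contDiffOn_coeffX hQ.1) hw') hp.2 E.one_mem_U
  have h2 := eq_of_hasDerivAt_zero isOpen_univ isPreconnected_univ
    (f := fun y => coeffX Q (t, y, 1) - partX (coeffX Q) (t, 0, 1) * y)
    (fun y _ => by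
      have hw' : (t, y, (1 : ℝ)) ∈ E.domain := ⟨hp.1, E.one_mem_U⟩
      have := (hasDerivAt_partX hO (contDiffOn_coeffX hQ.1) hw').sub
        ((hasDerivAt_id y).const_mul (partX (coeffX Q) (t, 0, 1)))
      refine this.congr_deriv ?_
      rw [hQ.partX_coeffX_formula hw']
      simp) (mem_univ x) (mem_univ 0)
  rw [h1]
  simp only [mul_zero, sub_zero] at h2
  linarith

theorem Eqn.IsLieSymmetry.partT_coeffX_formula (hQ : E.IsLieSymmetry Q) {t x v : ℝ}
    (hp : (t, x, v) ∈ E.domain) :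
    partT (coeffX Q) (t, x, v)
      = partT (partX (coeffX Q)) (t, 0, 1) * x + partT (coeffX Q) (t, 0, 1) := by
  have hO := E.isOpen_domain
  have h0 : (t, (0 : ℝ), (1 : ℝ)) ∈ E.domain := ⟨hp.1, E.one_mem_U⟩
  exact derivT_unique hO (f := coeffX Q)
    (g := fun p => partX (coeffX Q) (p.1, 0, 1) * p.2.1 + coeffX Q (p.1, 0, 1))
    (fun p hp => hQ.coeffX_formula hp) hp (hasDerivAt_partT hO (contDiffOn_coeffX hQ.1) hp)
    (((hasDerivAt_partT hO (contDiffOn_partX hO (contDiffOn_coeffX hQ.1)) h0).mul_const x).add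
      (hasDerivAt_partT hO (contDiffOn_coeffX hQ.1) h0))

theorem Eqn.IsLieSymmetry.coeffU_formula (hQ : E.IsLieSymmetry Q) :
    (∀ t x v, (t, x, v) ∈ E.domain → coeffU Q (t, x, v)
      = (partX (coeffX Q) (t, 0, 1) - partT (coeffT Q) (t, 0, 1)) / E.n * v
        + (partT (partX (coeffX Q)) (t, 0, 1) * x + partT (coeffX Q) (t, 0, 1))) ∧
    (E.n ≠ 1 → ∀ t ∈ E.I, partT (partX (coeffX Q)) (t, 0, 1) = 0 ∧
      partT (coeffX Q) (t, 0, 1) = 0) := by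
  have hO := E.isOpen_domain
  have hs := contDiffOn_coeffU hQ.1
  have hsu := contDiffOn_partU hO hs
  have hsxu := contDiffOn_partX hO hsu
  have hxuu : ∀ P ∈ E.domain, partU (partX (partU (coeffU Q))) P = 0 := fun P hP => by
    rw [partU_partX hO hsu hP]
    exact partX_eq_zero hO (fun P hP => (hQ.coeffU_eq hP).1) P hP
  have e1 : EqOn (fun P : Pt => E.n * P.2.2 ^ (E.n - 1) * coeffU Q P
        + P.2.2 ^ E.n * (partT (coeffT Q) (P.1, 0, 1) - partX (coeffX Q) (P.1, 0, 1)))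
      (fun P => partT (partX (coeffX Q)) (P.1, 0, 1) * P.2.1 + partT (coeffX Q) (P.1, 0, 1)
        + 2 * E.g P.1 * partX (partU (coeffU Q)) P) E.domain := fun P hP => by
    have := (hQ.coeffU_eq hP).2.1
    rw [hQ.partT_coeffX_formula hP, hQ.partT_coeffT_formula hP, hQ.partX_coeffX_formula hP] at this
    exact this
  by_cases hn : E.n = 1
  · refine ⟨?_, fun h => absurd hn h⟩
    have hu : EqOn (partU (coeffU Q))
        (fun P => partX (coeffX Q) (P.1, 0, 1) - partT (coeffT Q) (P.1, 0, 1)) E.domain := by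
      rintro ⟨t, x, v⟩ hp
      have e2 : EqOn (fun P : Pt => coeffU Q P
          + P.2.2 * (partT (coeffT Q) (P.1, 0, 1) - partX (coeffX Q) (P.1, 0, 1)))
          (fun P => partT (partX (coeffX Q)) (P.1, 0, 1) * P.2.1 + partT (coeffX Q) (P.1, 0, 1)
          + 2 * E.g P.1 * partX (partU (coeffU Q)) P) E.domain := fun P hP => by
        simpa [hn] using e1 hP
      have := derivU_unique hO e2 hp
        ((hasDerivAt_partU hO hs hp).add ((hasDerivAt_id v).mul_const
          (partT (coeffT Q) (t, 0, 1) - partX (coeffX Q) (t, 0, 1))))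
        (((hasDerivAt_partU hO hsxu hp).const_mul (2 * E.g t)).const_add
          (partT (partX (coeffX Q)) (t, 0, 1) * x + partT (coeffX Q) (t, 0, 1)))
      rw [hxuu _ hp] at this
      simp only
      linarith
    intro t x v hp
    have hxu : partX (partU (coeffU Q)) (t, x, v) = 0 := by
      refine derivX_unique hO hu hp (hasDerivAt_partX hO hsu hp)
        (hasDerivAt_const x (partX (coeffX Q) (t, 0, 1) - partT (coeffT Q) (t, 0, 1)))
    have h := e1 hp
    simp only [hn, hxu, sub_self, Real.rpow_zero, Real.rpow_one] at h
    rw [hn]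
    linarith
  · have hpos : ∀ {P : Pt}, P ∈ E.domain → 0 < P.2.2 := fun hP => Eqn.pos_of_mem_U hn hP.2
    have e2 : EqOn (fun P : Pt => (E.n - 1) * coeffU Q P + P.2.2 * partU (coeffU Q) P
        + P.2.2 * (partT (coeffT Q) (P.1, 0, 1) - partX (coeffX Q) (P.1, 0, 1)))
        (fun _ => 0) E.domain := by
      rintro ⟨t, x, v⟩ hp
      have hv : 0 < v := hpos hp
      have := derivU_unique hO e1 hp
        (((((hasDerivAt_id v).rpow_const (p := E.n - 1) (Or.inl hv.ne')).const_mul E.n).mul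
          (hasDerivAt_partU hO hs hp)).add
          (((hasDerivAt_id v).rpow_const (p := E.n) (Or.inl hv.ne')).mul_const
            (partT (coeffT Q) (t, 0, 1) - partX (coeffX Q) (t, 0, 1))))
        (((hasDerivAt_partU hO hsxu hp).const_mul (2 * E.g t)).const_add
          (partT (partX (coeffX Q)) (t, 0, 1) * x + partT (coeffX Q) (t, 0, 1)))
      rw [hxuu _ hp] at this
      have hv1 : v ^ (E.n - 1) = v ^ (E.n - 1 - 1) * v := by
        rw [Real.rpow_sub_one hv.ne' (E.n - 1)]
        field_simp
      simp only [id, hv1, mul_zero, one_mul] at this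
      have h0 : E.n * v ^ (E.n - 1 - 1) ≠ 0 := mul_ne_zero E.n_ne_zero (Real.rpow_pos_of_pos hv _).ne'
      refine mul_left_cancel₀ h0 ?_
      simp only
      linear_combination this
    have hu : EqOn (partU (coeffU Q))
        (fun P => (partX (coeffX Q) (P.1, 0, 1) - partT (coeffT Q) (P.1, 0, 1)) / E.n)
        E.domain := by
      rintro ⟨t, x, v⟩ hp
      have := derivU_unique hO e2 hp
        ((((hasDerivAt_partU hO hs hp).const_mul (E.n - 1)).add
          ((hasDerivAt_id v).mul (hasDerivAt_partU hO hsu hp))).add ((hasDerivAt_id v).mul_const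
          (partT (coeffT Q) (t, 0, 1) - partX (coeffX Q) (t, 0, 1))))
        (hasDerivAt_const v 0)
      rw [(hQ.coeffU_eq hp).1] at this
      simp only
      rw [eq_div_iff E.n_ne_zero]
      simp only [id] at this
      linarith
    have hη : ∀ t x v, (t, x, v) ∈ E.domain → coeffU Q (t, x, v)
        = (partX (coeffX Q) (t, 0, 1) - partT (coeffT Q) (t, 0, 1)) / E.n * v := by
      intro t x v hp
      have h2 := e2 hp
      simp only [hu hp] at h2
      have hn' : E.n - 1 ≠ 0 := sub_ne_zero.2 hn
      have hA := div_mul_cancel₀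
        (partX (coeffX Q) (t, 0, 1) - partT (coeffT Q) (t, 0, 1)) E.n_ne_zero
      refine mul_left_cancel₀ hn' ?_
      linear_combination h2 - v * hA
    have hz : ∀ t ∈ E.I, ∀ x, partT (partX (coeffX Q)) (t, 0, 1) * x
        + partT (coeffX Q) (t, 0, 1) = 0 := by
      intro t ht x
      have hp : (t, x, (1 : ℝ)) ∈ E.domain := ⟨ht, E.one_mem_U⟩
      have hxu : partX (partU (coeffU Q)) (t, x, 1) = 0 :=
        derivX_unique hO hu hp (hasDerivAt_partX hO hsu hp)
          (hasDerivAt_const x ((partX (coeffX Q) (t, 0, 1) - partT (coeffT Q) (t, 0, 1)) / E.n))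
      have h := e1 hp
      simp only [hxu, hη t x 1 hp, Real.one_rpow] at h
      have hn0 := E.n_ne_zero
      field_simp at h
      linarith
    refine ⟨fun t x v hp => ?_, fun _ t ht => ?_⟩
    · rw [hη t x v hp, hz t hp.1 x, add_zero]
    · have h0 := hz t ht 0
      have h1 := hz t ht 1
      constructor <;> linarith

end Symmetry

section Symmetry

variable {E : Eqn} {T Tt : ℝ → ℝ} {Q : VF}

theorem Eqn.eq_zero_of_affine {E : Eqn} {α β : ℝ} (h : ∀ v ∈ E.U, α * v + β = 0) :
    α = 0 ∧ β = 0 := by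
  have h1 := h 1 E.one_mem_U
  have h2 : (2 : ℝ) ∈ E.U := by
    unfold Eqn.U
    split_ifs <;> simp
  have h2 := h 2 h2
  constructor <;> linarith

/-- The ordinary differential equations for the coefficients `b`, `ξ₀`, `τ` of a Lie symmetry. -/
theorem Eqn.IsLieSymmetry.ode (hQ : E.IsLieSymmetry Q) {t : ℝ} (ht : t ∈ E.I) :
    coeffT Q (t, 0, 1) * deriv E.h t + E.h t * partT (coeffT Q) (t, 0, 1)
      + (partT (partX (coeffX Q)) (t, 0, 1) - partT (partT (coeffT Q)) (t, 0, 1)) / E.n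
      + partT (partX (coeffX Q)) (t, 0, 1) = 0 ∧
    E.h t * partT (partX (coeffX Q)) (t, 0, 1)
      + partT (partT (partX (coeffX Q))) (t, 0, 1) = 0 ∧
    E.h t * partT (coeffX Q) (t, 0, 1) + partT (partT (coeffX Q)) (t, 0, 1) = 0 := by
  have hO := E.isOpen_domain
  obtain ⟨hη, hz⟩ := hQ.coeffU_formula
  have hsT := contDiffOn_coeffT hQ.1
  have hsX := contDiffOn_coeffX hQ.1
  have hsU := contDiffOn_coeffU hQ.1
  have h0 : (t, (0 : ℝ), (1 : ℝ)) ∈ E.domain := ⟨ht, E.one_mem_U⟩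
  set b : ℝ → ℝ := fun t => partX (coeffX Q) (t, 0, 1) with hb
  set b1 : ℝ → ℝ := fun t => partT (partX (coeffX Q)) (t, 0, 1) with hb1
  set x1 : ℝ → ℝ := fun t => partT (coeffX Q) (t, 0, 1) with hx1
  set τ1 : ℝ → ℝ := fun t => partT (coeffT Q) (t, 0, 1) with hτ1
  have hη' : EqOn (coeffU Q) (fun P => (b P.1 - τ1 P.1) / E.n * P.2.2 + (b1 P.1 * P.2.1 + x1 P.1))
      E.domain := fun P hP => hη _ _ _ hP
  have hpX : EqOn (partX (coeffU Q)) (fun P => b1 P.1) E.domain := fun P hP => by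
    have := derivX_unique hO hη' hP (hasDerivAt_partX hO hsU hP)
      ((((hasDerivAt_id P.2.1).const_mul (b1 P.1)).add_const (x1 P.1)).const_add
        ((b P.1 - τ1 P.1) / E.n * P.2.2))
    simpa using this
  have hpU : EqOn (partU (coeffU Q)) (fun P => (b P.1 - τ1 P.1) / E.n) E.domain := fun P hP => by
    have := derivU_unique hO hη' hP (hasDerivAt_partU hO hsU hP)
      (((hasDerivAt_id P.2.2).const_mul ((b P.1 - τ1 P.1) / E.n)).add_const
        (b1 P.1 * P.2.1 + x1 P.1))
    simpa using this
  have hpXX : EqOn (partX (partX (coeffU Q))) (fun _ => 0) E.domain := fun P hP =>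
    derivX_unique hO hpX hP (hasDerivAt_partX hO (contDiffOn_partX hO hsU) hP)
      (hasDerivAt_const P.2.1 (b1 P.1))
  have dsX := contDiffOn_partX hO hsX
  have db := hasDerivAt_partT hO dsX h0
  have db1 := hasDerivAt_partT hO (contDiffOn_partT hO dsX) h0
  have dx1 := hasDerivAt_partT hO (contDiffOn_partT hO hsX) h0
  have dτ1 := hasDerivAt_partT hO (contDiffOn_partT hO hsT) h0
  have hpT : ∀ x v, (t, x, v) ∈ E.domain → partT (coeffU Q) (t, x, v)
      = (b1 t - partT (partT (coeffT Q)) (t, 0, 1)) / E.n * v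
        + (partT (partT (partX (coeffX Q))) (t, 0, 1) * x
          + partT (partT (coeffX Q)) (t, 0, 1)) := fun x v hp =>
    derivT_unique hO hη' hp (hasDerivAt_partT hO hsU hp)
      ((((db.sub dτ1).div_const E.n).mul_const v).add ((db1.mul_const x).add dx1))
  have key : ∀ x, ∀ v ∈ E.U,
      (coeffT Q (t, 0, 1) * deriv E.h t + E.h t * τ1 t
        + (b1 t - partT (partT (coeffT Q)) (t, 0, 1)) / E.n + b1 t) * v
      + ((E.h t * b1 t + partT (partT (partX (coeffX Q))) (t, 0, 1)) * x
        + (E.h t * x1 t + partT (partT (coeffX Q)) (t, 0, 1))) = 0 := by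
    intro x v hv
    have hp : (t, x, v) ∈ E.domain := ⟨ht, hv⟩
    have h := (hQ.coeffU_eq hp).2.2
    simp only [hpT x v hp, hpXX hp, hpX hp, hpU hp, hη' hp, hQ.coeffT_formula hp,
      hQ.partT_coeffT_formula hp] at h
    have hvb : v ^ E.n * b1 t = v * b1 t := by
      by_cases hn : E.n = 1
      · rw [hn, Real.rpow_one]
      · simp [hb1, (hz hn t ht).1]
    linear_combination h - hvb
  have k0 := E.eq_zero_of_affine (key 0)
  have k1 := E.eq_zero_of_affine (key 1)
  refine ⟨k0.1, ?_, ?_⟩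
  · linarith [k0.2, k1.2]
  · linarith [k0.2]

theorem Eqn.IsLieSymmetry.exists_params (hT : E.IsGauge T Tt) (hQ : E.IsLieSymmetry Q) :
    ∃ P, E.Admits T Tt P ∧ EqOn Q (field E.n E.h T Tt P) E.domain := by
  have hO := E.isOpen_domain
  obtain ⟨hη, hz⟩ := hQ.coeffU_formula
  have hsT := contDiffOn_coeffT hQ.1
  have hsX := contDiffOn_coeffX hQ.1
  have dsX := contDiffOn_partX hO hsX
  have h0 : ∀ {t}, t ∈ E.I → (t, (0 : ℝ), (1 : ℝ)) ∈ E.domain := fun ht => ⟨ht, E.one_mem_U⟩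
  have hn0 := E.n_ne_zero
  obtain ⟨a, ha⟩ := exists_const_of_hasDerivAt_zero E.isOpen_I E.isConnected_I
    (f := fun t => partT (partX (coeffX Q)) (t, 0, 1) / Tt t) (fun t ht => by
      have h := (hasDerivAt_partT hO (contDiffOn_partT hO dsX) (h0 ht)).div (hT.hasDerivAt_Tt ht)
        (hT.ne_zero ht)
      refine h.congr_deriv ?_
      have e := (hQ.ode ht).2.1
      have hTt := hT.ne_zero ht
      by_cases hn : E.n = 1
      · rw [div_eq_zero_iff, hn]
        left
        linear_combination Tt t * e
      · rw [(hz hn t ht).1] at e ⊢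
        have : partT (partT (partX (coeffX Q))) (t, 0, 1) = 0 := by linarith
        simp [this])
  obtain ⟨c, hc⟩ := exists_const_of_hasDerivAt_zero E.isOpen_I E.isConnected_I
    (f := fun t => partT (coeffX Q) (t, 0, 1) / Tt t) (fun t ht => by
      have h := (hasDerivAt_partT hO (contDiffOn_partT hO hsX) (h0 ht)).div (hT.hasDerivAt_Tt ht)
        (hT.ne_zero ht)
      refine h.congr_deriv ?_
      have e := (hQ.ode ht).2.2
      by_cases hn : E.n = 1
      · rw [div_eq_zero_iff, hn]
        left
        linear_combination Tt t * e
      · rw [(hz hn t ht).2] at e ⊢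
        have : partT (partT (coeffX Q)) (t, 0, 1) = 0 := by linarith
        simp [this])
  have ha' : ∀ t ∈ E.I, partT (partX (coeffX Q)) (t, 0, 1) = a * Tt t := fun t ht => by
    rw [← ha t ht, div_mul_cancel₀ _ (hT.ne_zero ht)]
  have hc' : ∀ t ∈ E.I, partT (coeffX Q) (t, 0, 1) = c * Tt t := fun t ht => by
    rw [← hc t ht, div_mul_cancel₀ _ (hT.ne_zero ht)]
  obtain ⟨t₀, ht₀⟩ := E.isConnected_I.nonempty
  have han : E.n ≠ 1 → a = 0 := fun hn => by
    rw [← ha t₀ ht₀, (hz hn t₀ ht₀).1, zero_div]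
  have hcn : E.n ≠ 1 → c = 0 := fun hn => by
    rw [← hc t₀ ht₀, (hz hn t₀ ht₀).2, zero_div]
  obtain ⟨b₀, hb⟩ := exists_const_of_hasDerivAt_zero E.isOpen_I E.isConnected_I
    (f := fun t => partX (coeffX Q) (t, 0, 1) - a * T t) (fun t ht =>
      ((hasDerivAt_partT hO dsX (h0 ht)).sub ((hT.hasDerivAt ht).const_mul a)).congr_deriv
        (by rw [ha' t ht, sub_self]))
  obtain ⟨d, hd⟩ := exists_const_of_hasDerivAt_zero E.isOpen_I E.isConnected_I
    (f := fun t => coeffX Q (t, 0, 1) - c * T t) (fun t ht =>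
      ((hasDerivAt_partT hO hsX (h0 ht)).sub ((hT.hasDerivAt ht).const_mul c)).congr_deriv
        (by rw [hc' t ht, sub_self]))
  obtain ⟨k, hk⟩ := exists_const_of_hasDerivAt_zero E.isOpen_I E.isConnected_I
    (f := fun t => partT (coeffT Q) (t, 0, 1) - E.n * (E.h t * coeffT Q (t, 0, 1)) - 2 * a * T t)
    (fun t ht => by
      have h := ((hasDerivAt_partT hO (contDiffOn_partT hO hsT) (h0 ht)).sub
        (((E.hasDerivAt_h ht).mul (hasDerivAt_partT hO hsT (h0 ht))).const_mul E.n)).sub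
        ((hT.hasDerivAt ht).const_mul (2 * a))
      refine h.congr_deriv ?_
      have e := (hQ.ode ht).1
      rw [ha' t ht] at e
      have hna : E.n * a = a := by
        by_cases hn : E.n = 1
        · rw [hn, one_mul]
        · rw [han hn, mul_zero]
      field_simp at e
      linear_combination -e + Tt t * hna)
  obtain ⟨m, hm⟩ := exists_const_of_hasDerivAt_zero E.isOpen_I E.isConnected_I
    (f := fun t => coeffT Q (t, 0, 1) * Tt t - a * T t ^ 2 - k * T t) (fun t ht => by
      have h := (((hasDerivAt_partT hO hsT (h0 ht)).mul (hT.hasDerivAt_Tt ht)).sub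
        (((hT.hasDerivAt ht).pow 2).const_mul a)).sub ((hT.hasDerivAt ht).const_mul k)
      refine h.congr_deriv ?_
      have e := hk t ht
      simp only [Nat.cast_ofNat, Nat.add_one_sub_one, pow_one]
      linear_combination Tt t * e)
  have hτ : ∀ t ∈ E.I, coeffT Q (t, 0, 1) = (a * T t ^ 2 + k * T t + m) * (Tt t)⁻¹ :=
    fun t ht => by
      rw [← div_eq_mul_inv, eq_div_iff (hT.ne_zero ht)]
      linarith [hm t ht]
  refine ⟨⟨a, k, m, 2 * b₀ - k, c, d⟩, ⟨han, hcn, fun t ht => ?_⟩, ?_⟩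
  · have e := (hQ.coeffX_eq _ (h0 ht)).2
    have e1 := hb t ht
    have e2 := hk t ht
    have e3 := hm t ht
    simp only at e
    simp only [Params.σ]
    linear_combination (-deriv E.g t - E.n * E.h t * E.g t) * e3 + 2 * E.g t * Tt t * e1
      - Tt t * e - E.g t * Tt t * e2
  · rintro ⟨t, x, v⟩ hp
    have ht : t ∈ E.I := hp.1
    have e1 := hb t ht
    have e2 := hk t ht
    have e3 := hd t ht
    simp only [field, vf, Params.σ]
    refine Prod.ext ?_ (Prod.ext ?_ ?_)
    · change coeffT Q (t, x, v) = _
      rw [hQ.coeffT_formula hp, hτ t ht]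
    · change coeffX Q (t, x, v) = _
      rw [hQ.coeffX_formula hp]
      linear_combination x * e1 + e3
    · change coeffU Q (t, x, v) = _
      rw [hη t x v hp, ha' t ht, hc' t ht, ← hτ t ht]
      field_simp
      linear_combination 2 * v * e1 - 2 * v * e2

theorem contDiffOn_field (hT : E.IsGauge T Tt) (P : Params) :
    ContDiffOn ℝ ∞ (field E.n E.h T Tt P) E.domain := by
  have hm : MapsTo (Prod.fst : Pt → ℝ) E.domain E.I := fun p hp => hp.1
  have h1 : ContDiffOn ℝ ∞ (fun p : Pt => T p.1) E.domain :=
    hT.contDiffOn.comp contDiff_fst.contDiffOn hm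
  have h2 : ContDiffOn ℝ ∞ (fun p : Pt => Tt p.1) E.domain :=
    hT.contDiffOn_Tt.comp contDiff_fst.contDiffOn hm
  have h3 : ContDiffOn ℝ ∞ (fun p : Pt => E.h p.1) E.domain :=
    E.smooth_h.comp contDiff_fst.contDiffOn hm
  have h4 : ContDiffOn ℝ ∞ (fun p : Pt => (Tt p.1)⁻¹) E.domain :=
    h2.inv fun p hp => hT.ne_zero hp.1
  have hx : ContDiffOn ℝ ∞ (fun p : Pt => p.2.1) E.domain :=
    (contDiff_fst.comp contDiff_snd).contDiffOn
  have hu : ContDiffOn ℝ ∞ (fun p : Pt => p.2.2) E.domain :=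
    (contDiff_snd.comp contDiff_snd).contDiffOn
  have hσ := (((contDiffOn_const (c := P.a)).mul (h1.pow 2)).add
    ((contDiffOn_const (c := P.k)).mul h1)).add (contDiffOn_const (c := P.m)) |>.mul h4
  have ha := (contDiffOn_const (c := P.a)).mul h1
  exact hσ.prodMk (((ha.add contDiffOn_const).mul hx |>.add
    ((contDiffOn_const.mul h1).add contDiffOn_const)).prodMk
    (((((contDiffOn_const.sub ha).div_const _).sub (h3.mul hσ)).mul hu).add
      (((contDiffOn_const.mul h2).mul hx).add (contDiffOn_const.mul h2))))

theorem Eqn.Admits.isLieSymmetry (hT : E.IsGauge T Tt) {P : Params} (hP : E.Admits T Tt P)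
    (hQ : EqOn Q (field E.n E.h T Tt P) E.domain) : E.IsLieSymmetry Q := by
  refine ⟨(contDiffOn_field hT P).congr hQ, fun u t x hl hu hE => ?_⟩
  have ht : t ∈ E.I := hl.1
  have hTt := hT.ne_zero ht
  have hn0 := E.n_ne_zero
  set τ : ℝ → ℝ := fun t => P.σ (T t) * (Tt t)⁻¹ with hτ
  set b : ℝ → ℝ := fun t => P.a * T t + (P.k + P.C) / 2 with hb
  set A : ℝ → ℝ := fun t => ((P.C - P.k) / 2 - P.a * T t) / E.n - E.h t * τ t with hA
  have dT := hT.hasDerivAt ht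
  have dτ : HasDerivAt τ (2 * P.a * T t + P.k + E.n * E.h t * τ t) t := by
    have h := ((((dT.pow 2).const_mul P.a).add (dT.const_mul P.k)).add_const P.m).mul
      ((hT.hasDerivAt_Tt ht).inv hTt)
    refine h.congr_deriv ?_
    simp only [hτ, Params.σ]
    simp
    field_simp
  have db : HasDerivAt b (P.a * Tt t) t := (dT.const_mul P.a).add_const _
  have dA : HasDerivAt A (-(P.a * Tt t) / E.n
      - (deriv E.h t * τ t + E.h t * (2 * P.a * T t + P.k + E.n * E.h t * τ t))) t :=
    ((((dT.const_mul P.a).const_sub _).div_const E.n).sub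
      ((E.hasDerivAt_h ht).mul dτ))
  have evT : ∀ᶠ s in 𝓝 t, lift u s x ∈ E.domain := by
    have hc : ContinuousAt (fun s : ℝ => (s, x)) t := by fun_prop
    exact hc.eventually (eventually_lift_mem E.isOpen_domain hu hl)
  have evX := eventually_lift_mem_x E.isOpen_domain hu hl
  have hτt : dt (fun s y => (Q (lift u s y)).1) t x = 2 * P.a * T t + P.k + E.n * E.h t * τ t := by
    refine (dτ.congr_of_eventuallyEq ?_).deriv
    filter_upwards [evT] with s hs
    rw [hQ hs]; rfl
  have hξt : dt (fun s y => (Q (lift u s y)).2.1) t x = P.a * Tt t * x + P.c * Tt t := by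
    refine (((db.mul_const x).add ((dT.const_mul P.c).add_const P.d)).congr_of_eventuallyEq
      ?_).deriv
    filter_upwards [evT] with s hs
    rw [hQ hs]; rfl
  have hηt : dt (fun s y => (Q (lift u s y)).2.2) t x = (-(P.a * Tt t) / E.n
      - (deriv E.h t * τ t + E.h t * (2 * P.a * T t + P.k + E.n * E.h t * τ t))) * u t x
      + A t * dt u t x + (P.a * -(E.n * E.h t * Tt t) * x + P.c * -(E.n * E.h t * Tt t)) := by
    refine (((dA.mul hu.hasDerivAt_dt).add ((((hT.hasDerivAt_Tt ht).const_mul P.a).mul_const x).add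
      ((hT.hasDerivAt_Tt ht).const_mul P.c))).congr_of_eventuallyEq ?_).deriv
    filter_upwards [evT] with s hs
    rw [hQ hs]; rfl
  have evx : ∀ᶠ y in 𝓝 x, dx (fun s y => (Q (lift u s y)).1) t y = 0 ∧
      dx (fun s y => (Q (lift u s y)).2.1) t y = b t ∧
      dx (fun s y => (Q (lift u s y)).2.2) t y = A t * dx u t y + P.a * Tt t := by
    filter_upwards [evX.eventually_nhds, hu.eventually_hasDerivAt_dx] with y hy hd
    refine ⟨?_, ?_, ?_⟩
    · refine ((hasDerivAt_const y (τ t)).congr_of_eventuallyEq ?_).deriv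
      filter_upwards [hy] with z hz
      rw [hQ hz]; rfl
    · refine ((((hasDerivAt_id y).const_mul (b t)).add_const (P.c * T t + P.d)).congr_deriv
        (mul_one _) |>.congr_of_eventuallyEq ?_).deriv
      filter_upwards [hy] with z hz
      rw [hQ hz]; rfl
    · refine (((hd.const_mul (A t)).add (((hasDerivAt_id y).const_mul (P.a * Tt t)).add_const
        (P.c * Tt t))).congr_deriv (by rw [mul_one]) |>.congr_of_eventuallyEq ?_).deriv
      filter_upwards [hy] with z hz
      rw [hQ hz]; rfl
  have hX : ∀ᶠ y in 𝓝 x, prolX Q u t y = A t * dx u t y + P.a * Tt t - dx u t y * b t := by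
    filter_upwards [evx] with y hy
    rw [prolX, hy.1, hy.2.1, hy.2.2]
    ring
  have hXX : dx (prolX Q u) t x = A t * dx (dx u) t x - dx (dx u) t x * b t := by
    have hd := hu.dx.hasDerivAt_dx
    exact ((((hd.const_mul (A t)).add_const (P.a * Tt t)).sub
      (hd.mul_const (b t))).congr_of_eventuallyEq hX).deriv
  have hx0 := evx.self_of_nhds
  have hode := hP.ode t ht
  have hv := Eqn.rpow_n_of_mem_U hl.2
  simp only [lift] at hv
  have hQl : Q (lift u t x) = (τ t, b t * x + (P.c * T t + P.d),
      A t * u t x + (P.a * Tt t * x + P.c * Tt t)) := hQ hl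
  have hode' : τ t * (deriv E.g t + E.n * E.h t * E.g t) = P.C * E.g t := by
    simp only [hτ]
    field_simp
    linarith
  have hE' : dt u t x = E.g t * dx (dx u) t x - u t x ^ E.n * dx u t x - E.h t * u t x := by
    unfold Eqn.HoldsAt at hE
    linarith
  rw [Eqn.prolApply, prolT, prolXX, hXX, hX.self_of_nhds, hτt, hξt, hηt, hx0.1, hx0.2.1, hQl, hE']
  simp only
  by_cases hn : E.n = 1
  · simp only [hn, sub_self, Real.rpow_zero, Real.rpow_one, hA, hb, div_one, one_mul] at hode' ⊢
    linear_combination -dx (dx u) t x * hode'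
  · rw [hP.a_eq hn, hP.c_eq hn]
    rw [← hv]
    simp only [hA, hb, hP.a_eq hn]
    field_simp
    linear_combination (-2 * E.n * dx (dx u) t x) * hode'

end Symmetry

section Span

variable {E : Eqn} {T Tt : ℝ → ℝ}

theorem Eqn.IsGauge.eq_zero_of_quadratic (hT : E.IsGauge T Tt) {t : ℝ} (ht : t ∈ E.I) {a k m : ℝ}
    (h : ∀ᶠ s in 𝓝 t, a * T s ^ 2 + k * T s + m = 0) : a = 0 ∧ k = 0 ∧ m = 0 := by
  have hI := E.isOpen_I.eventually_mem ht
  have h1 : ∀ᶠ s in 𝓝 t, 2 * a * T s + k = 0 := by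
    filter_upwards [h.eventually_nhds, hI] with s hs hsI
    have dT := hT.hasDerivAt hsI
    have d := (((dT.pow 2).const_mul a).add (dT.const_mul k)).add_const m
    have := d.unique ((hasDerivAt_const s (0 : ℝ)).congr_of_eventuallyEq hs)
    refine mul_right_cancel₀ (hT.ne_zero hsI) ?_
    simp only [Nat.cast_ofNat, Nat.add_one_sub_one, pow_one] at this
    linear_combination this
  have h2 : 2 * a * Tt t = 0 :=
    (((hT.hasDerivAt ht).const_mul (2 * a)).add_const k).unique
      ((hasDerivAt_const t (0 : ℝ)).congr_of_eventuallyEq h1)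
  have ha : a = 0 := by simpa [hT.ne_zero ht] using h2
  have hk := h1.self_of_nhds
  have hm := h.self_of_nhds
  subst ha
  have hk : k = 0 := by simpa using hk
  subst hk
  exact ⟨rfl, rfl, by simpa using hm⟩

theorem Eqn.IsGauge.params_eq_zero (hT : E.IsGauge T Tt) {P : Params}
    (h : ∀ p ∈ E.domain, field E.n E.h T Tt P p = 0) : P = ⟨0, 0, 0, 0, 0, 0⟩ := by
  obtain ⟨t₀, ht₀⟩ := E.isConnected_I.nonempty
  have hI := E.isOpen_I.eventually_mem ht₀
  have h1 : ∀ t ∈ E.I, ∀ x, P.σ (T t) = 0 ∧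
      (P.a * T t + (P.k + P.C) / 2) * x + (P.c * T t + P.d) = 0 := by
    intro t ht x
    have := h (t, x, 1) ⟨ht, E.one_mem_U⟩
    simp only [field, vf, Prod.mk_eq_zero] at this
    exact ⟨by simpa [hT.ne_zero ht] using this.1, this.2.1⟩
  have hσ := hT.eq_zero_of_quadratic ht₀ (a := P.a) (k := P.k) (m := P.m)
    (hI.mono fun t ht => (h1 t ht 0).1)
  have hc := hT.eq_zero_of_quadratic ht₀ (a := 0) (k := P.c) (m := P.d)
    (hI.mono fun t ht => by linarith [(h1 t ht 0).2])
  have hC := (h1 t₀ ht₀ 1).2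
  rw [hσ.1, hσ.2.1, hc.2.1, hc.2.2] at hC
  ext
  exacts [hσ.1, hσ.2.1, hσ.2.2, by linarith, hc.2.1, hc.2.2]

/-- A linear combination of parameters. -/
def Params.comb {ι : Type} [Fintype ι] (w : ι → ℝ) (P : ι → Params) : Params where
  a := ∑ i, w i * (P i).a
  k := ∑ i, w i * (P i).k
  m := ∑ i, w i * (P i).m
  C := ∑ i, w i * (P i).C
  c := ∑ i, w i * (P i).c
  d := ∑ i, w i * (P i).d

theorem sum_smul_field {ι : Type} [Fintype ι] (w : ι → ℝ) (P : ι → Params) (n : ℝ)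
    (h : ℝ → ℝ) (p : Pt) :
    ∑ i, w i • field n h T Tt (P i) p = field n h T Tt (Params.comb w P) p := by
  have e1 : ∀ q : ι → Pt, (∑ i, q i) = (∑ i, (q i).1, ∑ i, (q i).2.1, ∑ i, (q i).2.2) :=
    fun q => by simp [Prod.ext_iff, Prod.fst_sum, Prod.snd_sum]
  rw [e1]
  simp only [field, vf, Params.σ, Params.comb, Prod.smul_fst, Prod.smul_snd, smul_eq_mul]
  have e2 : ∀ f g : ι → ℝ, (∑ i, f i) + ∑ i, g i = ∑ i, (f i + g i) := fun f g =>
    Finset.sum_add_distrib.symm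
  have e3 : ∀ f g : ι → ℝ, (∑ i, f i) - ∑ i, g i = ∑ i, (f i - g i) := fun f g =>
    Finset.sum_sub_distrib ..|>.symm
  refine Prod.ext ?_ (Prod.ext ?_ ?_)
  all_goals
    simp only [Finset.sum_mul, Finset.mul_sum, Finset.sum_div, e2, e3]
    refine Finset.sum_congr rfl fun i _ => ?_
    ring

theorem Eqn.hasMaxAlgebra_of (hT : E.IsGauge T Tt) {B : List VF} (P : Fin B.length → Params)
    (hB : ∀ i, EqOn (B.get i) (field E.n E.h T Tt (P i)) E.domain)
    (hind : ∀ w, Params.comb w P = ⟨0, 0, 0, 0, 0, 0⟩ → ∀ i, w i = 0)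
    (hspan : ∀ R, E.Admits T Tt R ↔ ∃ w, Params.comb w P = R) : E.HasMaxAlgebra B := by
  have hsum : ∀ w : Fin B.length → ℝ, ∀ p : E.domain,
      (∑ i, w i • E.domain.domRestrict (B.get i)) p
        = field E.n E.h T Tt (Params.comb w P) p := by
    intro w p
    rw [← sum_smul_field, Finset.sum_apply]
    refine Finset.sum_congr rfl fun i _ => ?_
    rw [Pi.smul_apply]
    exact congrArg _ (hB i p.2)
  constructor
  · rw [Fintype.linearIndependent_iff]
    intro w hw
    refine hind w (hT.params_eq_zero fun p hp => ?_)
    rw [← hsum w ⟨p, hp⟩, hw]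
    rfl
  · ext V
    rw [SetLike.mem_coe, Submodule.mem_span_range_iff_exists_fun]
    constructor
    · rintro ⟨Q, hQ, rfl⟩
      obtain ⟨R, hR, hQR⟩ := hQ.exists_params hT
      obtain ⟨w, rfl⟩ := (hspan R).1 hR
      refine ⟨w, funext fun p => ?_⟩
      rw [hsum]
      exact (hQR p.2).symm
    · rintro ⟨w, rfl⟩
      refine ⟨field E.n E.h T Tt (Params.comb w P),
        ((hspan _).2 ⟨w, rfl⟩).isLieSymmetry hT fun _ _ => rfl, funext fun p => ?_⟩
      rw [hsum]
      rfl

theorem Eqn.Admits.unique (hT : E.IsGauge T Tt) {P R : Params} (hP : E.Admits T Tt P)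
    (hC : P.C ≠ 0) {t : ℝ} (ht : t ∈ E.I)
    (hR : ∀ᶠ s in 𝓝 t, R.σ (T s) * (deriv E.g s + E.n * E.h s * E.g s) = R.C * Tt s * E.g s) :
    P.C * R.a = R.C * P.a ∧ P.C * R.k = R.C * P.k ∧ P.C * R.m = R.C * P.m := by
  have h := hT.eq_zero_of_quadratic ht (a := P.C * R.a - R.C * P.a)
    (k := P.C * R.k - R.C * P.k) (m := P.C * R.m - R.C * P.m) (by
      filter_upwards [hR, E.isOpen_I.eventually_mem ht] with s hs hsI
      have h1 := hP.ode s hsI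
      have hne : P.C * Tt s * E.g s ≠ 0 :=
        mul_ne_zero (mul_ne_zero hC (hT.ne_zero hsI)) (E.g_ne_zero s hsI)
      have hD : deriv E.g s + E.n * E.h s * E.g s ≠ 0 := right_ne_zero_of_mul (h1 ▸ hne)
      refine mul_right_cancel₀ hD ?_
      simp only [Params.σ] at hs h1
      linear_combination P.C * hs - R.C * h1)
  exact ⟨sub_eq_zero.1 h.1, sub_eq_zero.1 h.2.1, sub_eq_zero.1 h.2.2⟩

theorem Eqn.Admits.C_eq_zero (hT : E.IsGauge T Tt) {P : Params} (hP : E.Admits T Tt P)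
    (h : P.a = 0 ∧ P.k = 0 ∧ P.m = 0) : P.C = 0 := by
  obtain ⟨t, ht⟩ := E.isConnected_I.nonempty
  have := hP.ode t ht
  simpa [Params.σ, h, hT.ne_zero ht, E.g_ne_zero t ht] using this

theorem Eqn.hasMaxAlgebra_generic (hT : E.IsGauge T Tt)
    (h : ∀ P, E.Admits T Tt P → P.a = 0 ∧ P.k = 0 ∧ P.m = 0) :
    E.HasMaxAlgebra (genericBasis3 E.n T Tt) := by
  unfold genericBasis3
  split_ifs with hn
  · refine E.hasMaxAlgebra_of hT ![⟨0, 0, 0, 0, 0, 1⟩, ⟨0, 0, 0, 0, 1, 0⟩] ?_ ?_ ?_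
    · intro i
      fin_cases i <;> intro p _ <;> simp [field, vf, delX, Params.σ]
    · intro w hw i
      simp [Params.comb, Fin.sum_univ_succ] at hw
      fin_cases i <;> simp_all
    · intro R
      constructor
      · intro hR
        refine ⟨![R.d, R.c], ?_⟩
        have h1 := h R hR
        have h2 := hR.C_eq_zero hT h1
        ext <;> simp [Params.comb, Fin.sum_univ_succ, h1, h2]
      · rintro ⟨w, rfl⟩
        constructor <;> simp [Params.comb, Fin.sum_univ_succ, Params.σ, hn]
  · refine E.hasMaxAlgebra_of hT ![⟨0, 0, 0, 0, 0, 1⟩] ?_ ?_ ?_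
    · intro i
      fin_cases i
      intro p _
      simp [field, vf, delX, Params.σ]
    · intro w hw i
      simp [Params.comb] at hw
      fin_cases i
      simp_all
    · intro R
      constructor
      · intro hR
        refine ⟨![R.d], ?_⟩
        have h1 := h R hR
        have h2 := hR.C_eq_zero hT h1
        ext <;> simp [Params.comb, h1, h2, hR.c_eq hn]
      · rintro ⟨w, rfl⟩
        constructor <;> simp [Params.comb, Params.σ]

theorem Eqn.hasMaxAlgebra_special_of_ne_one (hT : E.IsGauge T Tt) (hn : E.n ≠ 1) {P : Params}
    (hP : E.Admits T Tt P) (hC : P.C ≠ 0) (hcd : P.d = 0) {W : VF}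
    (hW : EqOn W (field E.n E.h T Tt P) E.domain) : E.HasMaxAlgebra [delX, W] := by
  obtain ⟨t, ht⟩ := E.isConnected_I.nonempty
  refine E.hasMaxAlgebra_of hT ![⟨0, 0, 0, 0, 0, 1⟩, P] ?_ ?_ ?_
  · intro i
    fin_cases i
    · intro p _
      simp [field, vf, delX, Params.σ]
    · exact hW
  · intro w hw i
    simp [Params.comb, Fin.sum_univ_succ, hcd, hC] at hw
    fin_cases i <;> simp_all
  · intro R
    constructor
    · intro hR
      refine ⟨![R.d, R.C / P.C], ?_⟩
      obtain ⟨h1, h2, h3⟩ := hP.unique hT hC ht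
        ((E.isOpen_I.eventually_mem ht).mono fun s hs => hR.ode s hs)
      ext <;> simp [Params.comb, Fin.sum_univ_succ, hcd, hP.c_eq hn, hR.c_eq hn] <;>
        field_simp <;> linarith
    · rintro ⟨w, rfl⟩
      constructor
      · simp [Params.comb, Fin.sum_univ_succ, hP.a_eq hn]
      · simp [Params.comb, Fin.sum_univ_succ, hP.c_eq hn]
      · intro s hs
        have := hP.ode s hs
        simp [Params.comb, Fin.sum_univ_succ, Params.σ] at this ⊢
        linear_combination w 1 * this

theorem Eqn.hasMaxAlgebra_special_of_eq_one (hT : E.IsGauge T Tt) (hn : E.n = 1) {P : Params}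
    (hP : E.Admits T Tt P) (hC : P.C ≠ 0) (hc : P.c = 0) (hd : P.d = 0) {V W : VF}
    (hV : EqOn V (vf fun t _ _ => (0, T t, Tt t)) E.domain)
    (hW : EqOn W (field E.n E.h T Tt P) E.domain) : E.HasMaxAlgebra [delX, V, W] := by
  obtain ⟨t, ht⟩ := E.isConnected_I.nonempty
  refine E.hasMaxAlgebra_of hT ![⟨0, 0, 0, 0, 0, 1⟩, ⟨0, 0, 0, 0, 1, 0⟩, P] ?_ ?_ ?_
  · intro i
    fin_cases i
    · intro p _
      simp [field, vf, delX, Params.σ]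
    · intro p hp
      refine (hV hp).trans ?_
      simp [field, vf, Params.σ]
    · exact hW
  · intro w hw i
    simp [Params.comb, Fin.sum_univ_succ, hc, hd, hC] at hw
    fin_cases i <;> simp_all
  · intro R
    constructor
    · intro hR
      refine ⟨![R.d, R.c, R.C / P.C], ?_⟩
      obtain ⟨h1, h2, h3⟩ := hP.unique hT hC ht
        ((E.isOpen_I.eventually_mem ht).mono fun s hs => hR.ode s hs)
      ext <;> simp [Params.comb, Fin.sum_univ_succ, hc, hd] <;>
        field_simp <;> linarith
    · rintro ⟨w, rfl⟩
      constructor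
      · simp [hn]
      · simp [hn]
      · intro s hs
        have := hP.ode s hs
        simp [Params.comb, Fin.sum_univ_succ, Params.σ] at this ⊢
        linear_combination w 2 * this

theorem Eqn.Admits.C_eq_zero_of_const {R : Params} (hR : E.Admits T Tt R) (hT : E.IsGauge T Tt)
    (h0 : ∀ t ∈ E.I, deriv E.g t + E.n * E.h t * E.g t = 0) : R.C = 0 := by
  obtain ⟨t, ht⟩ := E.isConnected_I.nonempty
  have := hR.ode t ht
  simpa [h0 t ht, hT.ne_zero ht, E.g_ne_zero t ht] using this

end Span

section Rows

variable {E : Eqn} {T Tt : ℝ → ℝ}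

theorem Eqn.hasMaxAlgebra_const_of_ne_one (hT : E.IsGauge T Tt) (hn : E.n ≠ 1)
    (h0 : ∀ t ∈ E.I, deriv E.g t + E.n * E.h t * E.g t = 0) {V W : VF}
    (hV : EqOn V (field E.n E.h T Tt ⟨0, 0, 1, 0, 0, 0⟩) E.domain)
    (hW : EqOn W (field E.n E.h T Tt ⟨0, 2 * E.n, 0, 0, 0, 0⟩) E.domain) :
    E.HasMaxAlgebra [delX, V, W] ∧ E.HasMaxAlgebra [V, delX, W] := by
  have hX : EqOn delX (field E.n E.h T Tt ⟨0, 0, 0, 0, 0, 1⟩) E.domain := fun p _ => by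
    simp [field, vf, delX, Params.σ]
  have hn0 := E.n_ne_zero
  constructor
  · refine E.hasMaxAlgebra_of hT
      ![⟨0, 0, 0, 0, 0, 1⟩, ⟨0, 0, 1, 0, 0, 0⟩, ⟨0, 2 * E.n, 0, 0, 0, 0⟩] ?_ ?_ ?_
    · intro i
      fin_cases i
      exacts [hX, hV, hW]
    · intro w hw i
      simp [Params.comb, Fin.sum_univ_succ, hn0] at hw
      fin_cases i <;> simp_all
    · intro R
      constructor
      · intro hR
        refine ⟨![R.d, R.m, R.k / (2 * E.n)], ?_⟩
        ext <;> simp [Params.comb, Fin.sum_univ_succ, hR.a_eq hn, hR.c_eq hn,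
          hR.C_eq_zero_of_const hT h0]
        field_simp
      · rintro ⟨w, rfl⟩
        constructor
        · simp [Params.comb, Fin.sum_univ_succ]
        · simp [Params.comb, Fin.sum_univ_succ]
        · intro t ht
          simp [Params.comb, Fin.sum_univ_succ, h0 t ht]
  · refine E.hasMaxAlgebra_of hT
      ![⟨0, 0, 1, 0, 0, 0⟩, ⟨0, 0, 0, 0, 0, 1⟩, ⟨0, 2 * E.n, 0, 0, 0, 0⟩] ?_ ?_ ?_
    · intro i
      fin_cases i
      exacts [hV, hX, hW]
    · intro w hw i
      simp [Params.comb, Fin.sum_univ_succ, hn0] at hw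
      fin_cases i <;> simp_all
    · intro R
      constructor
      · intro hR
        refine ⟨![R.m, R.d, R.k / (2 * E.n)], ?_⟩
        ext <;> simp [Params.comb, Fin.sum_univ_succ, hR.a_eq hn, hR.c_eq hn,
          hR.C_eq_zero_of_const hT h0]
        field_simp
      · rintro ⟨w, rfl⟩
        constructor
        · simp [Params.comb, Fin.sum_univ_succ]
        · simp [Params.comb, Fin.sum_univ_succ]
        · intro t ht
          simp [Params.comb, Fin.sum_univ_succ, h0 t ht]

theorem Eqn.hasMaxAlgebra_const_of_eq_one (hT : E.IsGauge T Tt) (hn : E.n = 1)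
    (h0 : ∀ t ∈ E.I, deriv E.g t + E.n * E.h t * E.g t = 0) {G S V W : VF}
    (hG : EqOn G (vf fun t _ _ => (0, T t, Tt t)) E.domain)
    (hV : EqOn V (field E.n E.h T Tt ⟨0, 0, 1, 0, 0, 0⟩) E.domain)
    (hS : EqOn S (field E.n E.h T Tt ⟨0, 2, 0, 0, 0, 0⟩) E.domain)
    (hW : EqOn W (field E.n E.h T Tt ⟨1, 0, 0, 0, 0, 0⟩) E.domain) :
    E.HasMaxAlgebra [delX, G, S, V, W] ∧ E.HasMaxAlgebra [delX, G, V, S, W] ∧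
      E.HasMaxAlgebra [V, delX, G, S, W] := by
  have hX : EqOn delX (field E.n E.h T Tt ⟨0, 0, 0, 0, 0, 1⟩) E.domain := fun p _ => by
    simp [field, vf, delX, Params.σ]
  have hG' : EqOn G (field E.n E.h T Tt ⟨0, 0, 0, 0, 1, 0⟩) E.domain := fun p hp =>
    (hG hp).trans (by simp [field, vf, Params.σ])
  refine ⟨?_, ?_, ?_⟩
  · refine E.hasMaxAlgebra_of hT ![⟨0, 0, 0, 0, 0, 1⟩, ⟨0, 0, 0, 0, 1, 0⟩, ⟨0, 2, 0, 0, 0, 0⟩,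
      ⟨0, 0, 1, 0, 0, 0⟩, ⟨1, 0, 0, 0, 0, 0⟩] ?_ ?_ ?_
    · intro i
      fin_cases i
      exacts [hX, hG', hS, hV, hW]
    · intro w hw i
      simp [Params.comb, Fin.sum_univ_succ] at hw
      fin_cases i <;> simp_all
    · intro R
      constructor
      · intro hR
        refine ⟨![R.d, R.c, R.k / 2, R.m, R.a], ?_⟩
        ext <;> simp [Params.comb, Fin.sum_univ_succ, hR.C_eq_zero_of_const hT h0]
      · rintro ⟨w, rfl⟩
        refine ⟨fun h => absurd hn h, fun h => absurd hn h, fun t ht => ?_⟩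
        simp [Params.comb, Fin.sum_univ_succ, h0 t ht]
  · refine E.hasMaxAlgebra_of hT ![⟨0, 0, 0, 0, 0, 1⟩, ⟨0, 0, 0, 0, 1, 0⟩,
      ⟨0, 0, 1, 0, 0, 0⟩, ⟨0, 2, 0, 0, 0, 0⟩, ⟨1, 0, 0, 0, 0, 0⟩] ?_ ?_ ?_
    · intro i
      fin_cases i
      exacts [hX, hG', hV, hS, hW]
    · intro w hw i
      simp [Params.comb, Fin.sum_univ_succ] at hw
      fin_cases i <;> simp_all
    · intro R
      constructor
      · intro hR
        refine ⟨![R.d, R.c, R.m, R.k / 2, R.a], ?_⟩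
        ext <;> simp [Params.comb, Fin.sum_univ_succ, hR.C_eq_zero_of_const hT h0]
      · rintro ⟨w, rfl⟩
        refine ⟨fun h => absurd hn h, fun h => absurd hn h, fun t ht => ?_⟩
        simp [Params.comb, Fin.sum_univ_succ, h0 t ht]
  · refine E.hasMaxAlgebra_of hT ![⟨0, 0, 1, 0, 0, 0⟩, ⟨0, 0, 0, 0, 0, 1⟩, ⟨0, 0, 0, 0, 1, 0⟩,
      ⟨0, 2, 0, 0, 0, 0⟩, ⟨1, 0, 0, 0, 0, 0⟩] ?_ ?_ ?_
    · intro i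
      fin_cases i
      exacts [hV, hX, hG', hS, hW]
    · intro w hw i
      simp [Params.comb, Fin.sum_univ_succ] at hw
      fin_cases i <;> simp_all
    · intro R
      constructor
      · intro hR
        refine ⟨![R.m, R.d, R.c, R.k / 2, R.a], ?_⟩
        ext <;> simp [Params.comb, Fin.sum_univ_succ, hR.C_eq_zero_of_const hT h0]
      · rintro ⟨w, rfl⟩
        refine ⟨fun h => absurd hn h, fun h => absurd hn h, fun t ht => ?_⟩
        simp [Params.comb, Fin.sum_univ_succ, h0 t ht]

/-- The parameters of the last operator in a row, or zero in the rows with constant `g / T_t`. -/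
def Row.params (n : ℝ) : Row → Params
  | case2 _ α β ρ => ⟨0, 2 * n * α, 2 * n * β, 2 * n * α * ρ, 0, 0⟩
  | case3 _ α => ⟨0, 0, 2 * n, 2 * n * α, 0, 0⟩
  | case6 _ α β γ δ ρ => ⟨α * γ, α * δ + β * γ, β * δ, ρ * (α * δ - β * γ), 0, 0⟩
  | case7 _ α β γ δ => ⟨γ ^ 2, 2 * γ * δ, δ ^ 2, α * δ - β * γ, 0, 0⟩
  | case8 _ α β ρ => ⟨α ^ 2, 2 * α * β, β ^ 2 + 1, 2 * ρ * α, 0, 0⟩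
  | _ => ⟨0, 0, 0, 0, 0, 0⟩

/-- The rows with constant `g / T_t`. -/
def Row.IsConst : Row → Prop
  | case4 _ => True
  | case9 _ => True
  | _ => False

theorem Row.g3_eq (r : Row) (t : ℝ) : r.g3 T Tt t = Tt t * r.g2 (T t) := by
  cases r <;> simp only [Row.g3, Row.g2] <;> ring

theorem Row.Valid.g2_deriv {n : ℝ} (hn : n ≠ 0) {I : Set ℝ} {r : Row} (hr : r.Valid n I T)
    (hc : ¬ r.IsConst) {t : ℝ} (ht : t ∈ I) :
    (r.params n).σ (T t) ≠ 0 ∧ (r.params n).C ≠ 0 ∧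
      HasDerivAt r.g2 ((r.params n).C / (r.params n).σ (T t) * r.g2 (T t)) (T t) := by
  have hid := hasDerivAt_id (T t)
  cases r with
  | case2 lam α β ρ =>
    obtain ⟨hn1, hl, hρ, hα, h⟩ := hr
    have hα0 : α ≠ 0 := by rcases hα with rfl | rfl <;> norm_num
    have hp := h t ht
    have hσ : (Row.params n (case2 lam α β ρ)).σ (T t) = 2 * n * (α * T t + β) := by
      simp only [Row.params, Params.σ]; ring
    refine ⟨?_, ?_, ?_⟩
    · rw [hσ]; positivity
    · simp [Row.params, hn, hα0, hρ]
    · rw [hσ]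
      refine ((((hid.const_mul α).add_const β).rpow_const (p := ρ) (Or.inl hp.ne')).const_mul
        lam).congr_deriv ?_
      simp only [Row.params, Row.g2, id, Real.rpow_sub_one hp.ne']
      field_simp
  | case3 lam α =>
    obtain ⟨hn1, hl, hα⟩ := hr
    have hσ : (Row.params n (case3 lam α)).σ (T t) = 2 * n := by
      simp only [Row.params, Params.σ]; ring
    refine ⟨?_, ?_, ?_⟩
    · rw [hσ]; positivity
    · simp [Row.params, hn, hα]
    · rw [hσ]
      refine ((hid.const_mul α).exp.const_mul lam).congr_deriv ?_
      simp only [Row.params, Row.g2, id]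
      field_simp
  | case6 lam α β γ δ ρ =>
    obtain ⟨hn1, hl, hρ, hΔ, h⟩ := hr
    obtain ⟨hγ, hp⟩ := h t ht
    have hα : α * T t + β ≠ 0 := fun h0 => by simp [h0] at hp
    have hσ : (Row.params n (case6 lam α β γ δ ρ)).σ (T t)
        = (α * T t + β) * (γ * T t + δ) := by
      simp only [Row.params, Params.σ]; ring
    refine ⟨?_, ?_, ?_⟩
    · rw [hσ]; exact mul_ne_zero hα hγ
    · exact mul_ne_zero hρ hΔ
    · rw [hσ]
      refine (((((hid.const_mul α).add_const β).div ((hid.const_mul γ).add_const δ)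
        hγ).rpow_const (p := ρ) (Or.inl hp.ne')).const_mul lam).congr_deriv ?_
      simp only [Row.params, Row.g2, id, Pi.div_apply, Real.rpow_sub_one hp.ne']
      field_simp
      ring
  | case7 lam α β γ δ =>
    obtain ⟨hn1, hl, hΔ, h⟩ := hr
    have hγ := h t ht
    have hσ : (Row.params n (case7 lam α β γ δ)).σ (T t) = (γ * T t + δ) ^ 2 := by
      simp only [Row.params, Params.σ]; ring
    refine ⟨?_, hΔ, ?_⟩
    · rw [hσ]; exact pow_ne_zero 2 hγ
    · rw [hσ]
      refine (((((hid.const_mul α).add_const β).div ((hid.const_mul γ).add_const δ)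
        hγ).exp).const_mul lam).congr_deriv ?_
      simp only [Row.params, Row.g2, id, Pi.div_apply]
      field_simp
      ring
  | case8 lam α β ρ =>
    obtain ⟨hn1, hl, hρ, hα⟩ := hr
    have hσ : (Row.params n (case8 lam α β ρ)).σ (T t) = (α * T t + β) ^ 2 + 1 := by
      simp only [Row.params, Params.σ]; ring
    refine ⟨?_, ?_, ?_⟩
    · rw [hσ]; positivity
    · simp [Row.params, hρ, hα]
    · rw [hσ]
      refine (((((hid.const_mul α).add_const β).arctan).const_mul (2 * ρ)).exp.const_mul
        lam).congr_deriv ?_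
      simp only [Row.params, Row.g2, id]
      field_simp
      ring
  | case4 lam => exact absurd trivial hc
  | case9 lam => exact absurd trivial hc

theorem Eqn.IsGauge.deriv_of_form (hT : E.IsGauge T Tt) {F : ℝ → ℝ} {F' t : ℝ} (ht : t ∈ E.I)
    (hg : ∀ s ∈ E.I, E.g s = Tt s * F (T s)) (hF : HasDerivAt F F' (T t)) :
    deriv E.g t + E.n * E.h t * E.g t = Tt t ^ 2 * F' := by
  have h := (hT.hasDerivAt_Tt ht).mul (hF.comp t (hT.hasDerivAt ht))
  have h2 := (h.congr_of_eventuallyEq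
    (eventually_of_mem (E.isOpen_I.mem_nhds ht) fun s hs => hg s hs)).deriv
  rw [h2, hg t ht]
  simp only [Function.comp]
  ring

theorem Eqn.IsGauge.form_of_admits (hT : E.IsGauge T Tt) {P : Params} {F F' : ℝ → ℝ}
    (hP : E.Admits T Tt P) (hσ : ∀ t ∈ E.I, P.σ (T t) ≠ 0)
    (hF : ∀ t ∈ E.I, HasDerivAt F (F' (T t)) (T t)) (hF0 : ∀ t ∈ E.I, F (T t) ≠ 0)
    (h : ∀ t ∈ E.I, P.σ (T t) * F' (T t) = P.C * F (T t)) :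
    ∃ lam, lam ≠ 0 ∧ ∀ t ∈ E.I, E.g t = lam * Tt t * F (T t) := by
  have hne : ∀ t ∈ E.I, Tt t * F (T t) ≠ 0 := fun t ht =>
    mul_ne_zero (hT.ne_zero ht) (hF0 t ht)
  obtain ⟨lam, hlam⟩ := exists_const_of_hasDerivAt_zero E.isOpen_I E.isConnected_I
    (f := fun t => E.g t / (Tt t * F (T t))) (fun t ht => by
      have d := (E.hasDerivAt_g ht).div
        ((hT.hasDerivAt_Tt ht).mul ((hF t ht).comp t (hT.hasDerivAt ht))) (hne t ht)
      refine d.congr_deriv ?_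
      rw [div_eq_zero_iff]
      left
      refine mul_left_cancel₀ (hσ t ht) ?_
      simp only [Function.comp, Pi.mul_apply]
      linear_combination Tt t * F (T t) * hP.ode t ht - E.g t * Tt t ^ 2 * h t ht)
  have hg : ∀ t ∈ E.I, E.g t = lam * Tt t * F (T t) := fun t ht => by
    rw [mul_assoc, ← hlam t ht, div_mul_cancel₀ _ (hne t ht)]
  refine ⟨lam, ?_, hg⟩
  rintro rfl
  obtain ⟨t, ht⟩ := E.isConnected_I.nonempty
  exact E.g_ne_zero t ht (by rw [hg t ht]; simp)

theorem Eqn.IsRow3.admits (hT : E.IsGauge T Tt) {r : Row} (hr : E.IsRow3 T Tt r)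
    (hc : ¬ r.IsConst) : E.Admits T Tt (r.params E.n) := by
  have hn0 := E.n_ne_zero
  have hg : ∀ t ∈ E.I, E.g t = Tt t * r.g2 (T t) := fun t ht => by rw [hr.2 t ht, r.g3_eq]
  refine ⟨fun hn => ?_, fun hn => ?_, fun t ht => ?_⟩
  · obtain ⟨hv, -⟩ := hr
    cases r <;> simp_all [Row.Valid, Row.params]
  · cases r <;> simp [Row.params]
  · obtain ⟨h1, h2, h3⟩ := hr.1.g2_deriv hn0 hc ht
    rw [hT.deriv_of_form ht hg h3, hg t ht]
    field_simp

theorem Eqn.IsRow3.const (hT : E.IsGauge T Tt) {r : Row} (hr : E.IsRow3 T Tt r)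
    (hc : r.IsConst) : ∀ t ∈ E.I, deriv E.g t + E.n * E.h t * E.g t = 0 := by
  intro t ht
  have hg : ∀ t ∈ E.I, E.g t = Tt t * r.g2 (T t) := fun t ht => by rw [hr.2 t ht, r.g3_eq]
  have : HasDerivAt r.g2 0 (T t) := by
    cases r with
    | case4 lam => exact hasDerivAt_const _ lam
    | case9 lam => exact hasDerivAt_const _ lam
    | _ => exact absurd hc id
  rw [hT.deriv_of_form ht hg this, mul_zero]

theorem Eqn.IsRow3.hasMaxAlgebra (hT : E.IsGauge T Tt) {r : Row} (hr : E.IsRow3 T Tt r) :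
    E.HasMaxAlgebra (r.basis3 E.n E.h T Tt) := by
  obtain ⟨t, ht⟩ := E.isConnected_I.nonempty
  have hn0 := E.n_ne_zero
  by_cases hc : r.IsConst
  · have h0 := hr.const hT hc
    cases r with
    | case4 lam =>
      refine (E.hasMaxAlgebra_const_of_ne_one hT hr.1.1 h0 ?_ ?_).1
      · intro p _
        simp [field, vf, Params.σ]
      · intro p _
        simp only [field, vf, Params.σ, Prod.mk.injEq]
        refine ⟨by ring, by ring, ?_⟩
        field_simp
        ring
    | case9 lam =>
      have hn : E.n = 1 := hr.1.1
      refine (E.hasMaxAlgebra_const_of_eq_one hT hn h0 (fun _ _ => rfl) ?_ ?_ ?_).1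
      · intro p _
        simp [field, vf, Params.σ]
      · intro p _
        simp only [field, vf, Params.σ, Prod.mk.injEq, hn]
        refine ⟨by ring, by ring, by ring⟩
      · intro p _
        simp only [field, vf, Params.σ, Prod.mk.injEq, hn]
        refine ⟨by ring, by ring, by ring⟩
    | _ => exact absurd hc id
  · have hP := hr.admits hT hc
    have hC := (hr.1.g2_deriv hn0 hc ht).2.1
    cases r with
    | case2 lam α β ρ =>
      refine E.hasMaxAlgebra_special_of_ne_one hT hr.1.1 hP hC rfl fun p _ => ?_
      simp only [field, vf, Params.σ, Row.params, Prod.mk.injEq]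
      refine ⟨by ring, by ring, ?_⟩
      field_simp
      ring
    | case3 lam α =>
      refine E.hasMaxAlgebra_special_of_ne_one hT hr.1.1 hP hC rfl fun p _ => ?_
      simp only [field, vf, Params.σ, Row.params, Prod.mk.injEq]
      refine ⟨by ring, by ring, ?_⟩
      field_simp
      ring
    | case6 lam α β γ δ ρ =>
      have hn : E.n = 1 := hr.1.1
      refine E.hasMaxAlgebra_special_of_eq_one hT hn hP hC rfl rfl (fun _ _ => rfl) fun p _ => ?_
      simp only [field, vf, Params.σ, Row.params, Prod.mk.injEq, hn]
      refine ⟨by ring, by ring, by ring⟩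
    | case7 lam α β γ δ =>
      have hn : E.n = 1 := hr.1.1
      refine E.hasMaxAlgebra_special_of_eq_one hT hn hP hC rfl rfl (fun _ _ => rfl) fun p _ => ?_
      simp only [field, vf, Params.σ, Row.params, Prod.mk.injEq, hn]
      refine ⟨by ring, by ring, by ring⟩
    | case8 lam α β ρ =>
      have hn : E.n = 1 := hr.1.1
      refine E.hasMaxAlgebra_special_of_eq_one hT hn hP hC rfl rfl (fun _ _ => rfl) fun p _ => ?_
      simp only [field, vf, Params.σ, Row.params, Prod.mk.injEq, hn]
      refine ⟨by ring, by ring, by ring⟩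
    | _ => exact absurd trivial hc

end Rows

section Classification

variable {E : Eqn} {T Tt : ℝ → ℝ}

theorem pos_or_neg_of_ne_zero {s : Set ℝ} (hs : IsPreconnected s) {f : ℝ → ℝ}
    (hf : ContinuousOn f s) (h0 : ∀ x ∈ s, f x ≠ 0) :
    (∀ x ∈ s, 0 < f x) ∨ (∀ x ∈ s, f x < 0) := by
  by_contra! hcon
  obtain ⟨⟨x, hx, hx'⟩, y, hy, hy'⟩ := hcon
  obtain ⟨z, hz, hz'⟩ := hs.intermediate_value hx hy hf ⟨hx', hy'⟩
  exact h0 z hz hz'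

/-- The parameters with the opposite signs. -/
def Params.neg (P : Params) : Params := ⟨-P.a, -P.k, -P.m, -P.C, -P.c, -P.d⟩

theorem Params.neg_σ (P : Params) (s : ℝ) : P.neg.σ s = -P.σ s := by
  simp only [Params.neg, Params.σ]
  ring

theorem Eqn.Admits.neg {P : Params} (hP : E.Admits T Tt P) : E.Admits T Tt P.neg := by
  refine ⟨fun hn => by simp [Params.neg, hP.a_eq hn], fun hn => by simp [Params.neg, hP.c_eq hn],
    fun t ht => ?_⟩
  rw [P.neg_σ]
  simp only [Params.neg]
  linear_combination -hP.ode t ht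

theorem Eqn.Admits.const (hT : E.IsGauge T Tt) {P : Params} (hP : E.Admits T Tt P)
    (h : ¬ (P.a = 0 ∧ P.k = 0 ∧ P.m = 0)) (hC : P.C = 0) :
    ∀ t ∈ E.I, deriv E.g t + E.n * E.h t * E.g t = 0 := by
  intro t ht
  by_contra hD
  have hcont : ContinuousAt (fun s => deriv E.g s + E.n * E.h s * E.g s) t := by
    have h1 := (((contDiffOn_infty_iff_deriv_of_isOpen E.isOpen_I).1 E.smooth_g).2.contDiffAt
      (E.isOpen_I.mem_nhds ht)).continuousAt
    exact h1.add ((continuousAt_const.mul (E.hasDerivAt_h ht).continuousAt).mul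
      (E.hasDerivAt_g ht).continuousAt)
  refine h (hT.eq_zero_of_quadratic ht ?_)
  filter_upwards [hcont.eventually_ne hD, E.isOpen_I.eventually_mem ht] with s hs hsI
  have := hP.ode s hsI
  rw [hC, zero_mul, zero_mul] at this
  exact (mul_eq_zero.1 this).resolve_right hs

theorem Eqn.Admits.σ_ne_zero (hT : E.IsGauge T Tt) {P : Params} (hP : E.Admits T Tt P)
    (hC : P.C ≠ 0) {t : ℝ} (ht : t ∈ E.I) : P.σ (T t) ≠ 0 := by
  have hne : P.C * Tt t * E.g t ≠ 0 :=
    mul_ne_zero (mul_ne_zero hC (hT.ne_zero ht)) (E.g_ne_zero t ht)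
  exact left_ne_zero_of_mul (hP.ode t ht ▸ hne)

/-- If the parameters are proportional to those of a valid row, the equation is in that row up to
a constant factor of `g`. -/
theorem Eqn.Admits.exists_lam (hT : E.IsGauge T Tt) {P : Params} (hP : E.Admits T Tt P)
    {r : Row} (hr : r.Valid E.n E.I T) (hc : ¬ r.IsConst) {μ : ℝ} (hμ : μ ≠ 0)
    (hσ : ∀ s, (r.params E.n).σ s = μ * P.σ s) (hC : (r.params E.n).C = μ * P.C)
    (h0 : ∀ t ∈ E.I, r.g2 (T t) ≠ 0) :
    ∃ lam, lam ≠ 0 ∧ ∀ t ∈ E.I, E.g t = lam * Tt t * r.g2 (T t) := by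
  have hn0 := E.n_ne_zero
  refine hT.form_of_admits hP (F := r.g2)
    (F' := fun s => (r.params E.n).C / (r.params E.n).σ s * r.g2 s) (fun t ht => ?_)
    (fun t ht => (hr.g2_deriv hn0 hc ht).2.2) h0 (fun t ht => ?_)
  · have := (hr.g2_deriv hn0 hc ht).1
    rw [hσ] at this
    exact right_ne_zero_of_mul this
  · have := (hr.g2_deriv hn0 hc ht).1
    rw [hσ] at this
    have h2 : P.σ (T t) ≠ 0 := right_ne_zero_of_mul this
    rw [hσ, hC]
    field_simp

theorem Eqn.Admits.exists_row (hT : E.IsGauge T Tt) {P : Params} (hP : E.Admits T Tt P)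
    (h : ¬ (P.a = 0 ∧ P.k = 0 ∧ P.m = 0)) : ∃ r, E.IsRow3 T Tt r := by
  by_cases hC : P.C = 0
  · have h0 := hP.const hT h hC
    obtain ⟨lam, hl, hg⟩ := hT.form_of_admits (P := ⟨0, 0, 1, 0, 0, 0⟩) (F := fun _ => 1)
      (F' := fun _ => 0) ⟨fun _ => rfl, fun _ => rfl, fun t ht => by simp [h0 t ht]⟩
      (fun t ht => by simp [Params.σ]) (fun t ht => hasDerivAt_const _ _)
      (fun t ht => one_ne_zero) (fun t ht => by simp)
    by_cases hn : E.n = 1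
    · exact ⟨.case9 lam, ⟨hn, hl⟩, fun t ht => by simp [hg t ht, Row.g3]⟩
    · exact ⟨.case4 lam, ⟨hn, hl⟩, fun t ht => by simp [hg t ht, Row.g3]⟩
  wlog hpos : ∀ t ∈ E.I, 0 < P.σ (T t) generalizing P
  · have hcT : ContinuousOn T E.I := hT.contDiffOn.continuousOn
    have hcont : ContinuousOn (fun t => P.σ (T t)) E.I := by
      unfold Params.σ
      fun_prop
    have hneg := (pos_or_neg_of_ne_zero E.isConnected_I.isPreconnected hcont
      fun t ht => hP.σ_ne_zero hT hC ht).resolve_left hpos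
    refine this hP.neg ?_ (by simpa [Params.neg] using hC) fun t ht => ?_
    · simpa [Params.neg] using h
    · rw [P.neg_σ]
      linarith [hneg t ht]
  by_cases hn : E.n = 1
  · by_cases ha : P.a = 0
    · by_cases hk : P.k = 0
      · have hm : P.m ≠ 0 := fun hm => h ⟨ha, hk, hm⟩
        have hv : Row.Valid E.n E.I T (.case7 1 (P.C / P.m) 0 0 1) :=
          ⟨hn, one_ne_zero, by simp [hC, hm], by simp⟩
        obtain ⟨lam, hl, hg⟩ := hP.exists_lam hT hv id (μ := 1 / P.m) (by simp [hm])
          (fun s => by simp [Row.params, Params.σ, ha, hk, hm])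
          (by simp [Row.params]; ring) (fun t ht => by simp [Row.g2])
        exact ⟨.case7 lam (P.C / P.m) 0 0 1, ⟨hn, hl, hv.2.2⟩,
            fun t ht => by rw [hg t ht]; simp [Row.g2, Row.g3]⟩
      · have hpos' : ∀ t ∈ E.I, 0 < P.k * T t + P.m := fun t ht => by
          simpa [Params.σ, ha] using hpos t ht
        have hv : Row.Valid E.n E.I T (.case6 1 P.k P.m 0 1 (P.C / P.k)) :=
          ⟨hn, one_ne_zero, by simp [hC, hk], by simp [hk], fun t ht => by
            simpa using hpos' t ht⟩
        obtain ⟨lam, hl, hg⟩ := hP.exists_lam hT hv id (μ := 1) one_ne_zero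
          (fun s => by simp [Row.params, Params.σ, ha])
          (by simp [Row.params]; field_simp) (fun t ht => by
            simpa [Row.g2] using (Real.rpow_pos_of_pos (hpos' t ht) _).ne')
        exact ⟨.case6 lam P.k P.m 0 1 (P.C / P.k), ⟨hn, hl, hv.2.2⟩,
            fun t ht => by rw [hg t ht]; simp [Row.g2, Row.g3]⟩
    · rcases lt_trichotomy (P.k ^ 2 - 4 * P.a * P.m) 0 with hd | hd | hd
      · obtain ⟨w, hw, hw2⟩ : ∃ w : ℝ, 0 < w ∧ w ^ 2 = -(P.k ^ 2 - 4 * P.a * P.m) :=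
          ⟨_, Real.sqrt_pos.2 (neg_pos.2 hd), Real.sq_sqrt (neg_pos.2 hd).le⟩
        have hv : Row.Valid E.n E.I T (.case8 1 (2 * P.a / w) (P.k / w) (P.C / w)) :=
          ⟨hn, one_ne_zero, by simp [hC, hw.ne'], by simp [ha, hw.ne']⟩
        obtain ⟨lam, hl, hg⟩ := hP.exists_lam hT hv id (μ := 4 * P.a / w ^ 2)
          (by simp [ha, hw.ne']) (fun s => by
            simp only [Row.params, Params.σ]
            field_simp
            linear_combination hw2)
          (by simp only [Row.params]; field_simp; ring) (fun t ht => by simp [Row.g2])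
        exact ⟨.case8 lam (2 * P.a / w) (P.k / w) (P.C / w), ⟨hn, hl, hv.2.2⟩,
            fun t ht => by rw [hg t ht]; simp [Row.g2, Row.g3]⟩
      · have hv : Row.Valid E.n E.I T (.case7 1 0 (-P.C / P.a) 1 (P.k / (2 * P.a))) := by
          refine ⟨hn, one_ne_zero, by simp [hC, ha], fun t ht h0 => ?_⟩
          refine hP.σ_ne_zero hT hC ht ?_
          simp only [Params.σ]
          field_simp at h0
          refine mul_left_cancel₀ (mul_ne_zero four_ne_zero ha) ?_
          linear_combination (2 * P.a * T t + P.k) * h0 - hd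
        obtain ⟨lam, hl, hg⟩ := hP.exists_lam hT hv id (μ := 1 / P.a) (by simp [ha])
          (fun s => by
            simp only [Row.params, Params.σ]
            field_simp
            linear_combination hd)
          (by simp [Row.params]; field_simp) (fun t ht => by simp [Row.g2])
        exact ⟨.case7 lam 0 (-P.C / P.a) 1 (P.k / (2 * P.a)), ⟨hn, hl, hv.2.2⟩,
            fun t ht => by rw [hg t ht]; simp [Row.g2, Row.g3]⟩
      · obtain ⟨w, hw, hw2⟩ : ∃ w : ℝ, 0 < w ∧ w ^ 2 = P.k ^ 2 - 4 * P.a * P.m :=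
          ⟨_, Real.sqrt_pos.2 hd, Real.sq_sqrt hd.le⟩
        have hprod : ∀ s, (2 * P.a * s + (P.k - w)) * (2 * P.a * P.a * s + (P.k + w) * P.a)
            = 4 * P.a ^ 2 * P.σ s := fun s => by
          simp only [Params.σ]
          linear_combination -P.a * hw2
        have hprod' : ∀ t ∈ E.I, 0 < (2 * P.a * T t + (P.k - w)) *
            (2 * P.a * P.a * T t + (P.k + w) * P.a) := fun t ht => by
          rw [hprod]
          have := hpos t ht
          positivity
        have hv : Row.Valid E.n E.I T
            (.case6 1 (2 * P.a) (P.k - w) (2 * P.a * P.a) ((P.k + w) * P.a) (P.C / w)) := by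
          refine ⟨hn, one_ne_zero, by simp [hC, hw.ne'], ?_, fun t ht => ⟨?_, ?_⟩⟩
          · have : 2 * P.a * ((P.k + w) * P.a) - (P.k - w) * (2 * P.a * P.a)
              = 4 * P.a ^ 2 * w := by ring
            rw [this]
            positivity
          · exact right_ne_zero_of_mul (hprod' t ht).ne'
          · rcases pos_and_pos_or_neg_and_neg_of_mul_pos (hprod' t ht) with h' | h'
            · exact div_pos h'.1 h'.2
            · exact div_pos_of_neg_of_neg h'.1 h'.2
        obtain ⟨lam, hl, hg⟩ := hP.exists_lam hT hv id (μ := 4 * P.a ^ 2) (by simp [ha])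
          (fun s => by
            rw [← hprod]
            simp only [Row.params, Params.σ]
            ring)
          (by simp only [Row.params]; field_simp; ring) (fun t ht => by
            simpa [Row.g2] using (Real.rpow_pos_of_pos (hv.2.2.2.2 t ht).2 _).ne')
        exact ⟨.case6 lam (2 * P.a) (P.k - w) (2 * P.a * P.a) ((P.k + w) * P.a) (P.C / w), ⟨hn, hl, hv.2.2⟩,
            fun t ht => by rw [hg t ht]; simp [Row.g2, Row.g3]⟩
  · have ha := hP.a_eq hn
    have hn0 := E.n_ne_zero
    by_cases hk : P.k = 0
    · have hm : P.m ≠ 0 := fun hm => h ⟨ha, hk, hm⟩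
      have hv : Row.Valid E.n E.I T (.case3 1 (P.C / P.m)) :=
        ⟨hn, one_ne_zero, by simp [hC, hm]⟩
      obtain ⟨lam, hl, hg⟩ := hP.exists_lam hT hv id (μ := 2 * E.n / P.m) (by simp [hm, hn0])
        (fun s => by simp [Row.params, Params.σ, ha, hk, hm])
        (by simp [Row.params]; ring) (fun t ht => by simp [Row.g2])
      exact ⟨.case3 lam (P.C / P.m), ⟨hn, hl, hv.2.2⟩,
            fun t ht => by rw [hg t ht]; simp [Row.g2, Row.g3]⟩
    · have hk' : 0 < |P.k| := abs_pos.2 hk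
      have hpos' : ∀ t ∈ E.I, 0 < P.k / |P.k| * T t + P.m / |P.k| := fun t ht => by
        have := hpos t ht
        simp only [Params.σ, ha, zero_mul, zero_add] at this
        have e : P.k / |P.k| * T t + P.m / |P.k| = (P.k * T t + P.m) / |P.k| := by ring
        rw [e]
        positivity
      have hs : P.k / |P.k| = 1 ∨ P.k / |P.k| = -1 := by
        rcases lt_or_gt_of_ne hk with h' | h'
        · right
          rw [abs_of_neg h']
          field_simp
        · left
          rw [abs_of_pos h']
          field_simp
      have hv : Row.Valid E.n E.I T (.case2 1 (P.k / |P.k|) (P.m / |P.k|) (P.C / P.k)) :=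
        ⟨hn, one_ne_zero, by simp [hC, hk], hs, hpos'⟩
      obtain ⟨lam, hl, hg⟩ := hP.exists_lam hT hv id (μ := 2 * E.n / |P.k|) (by simp [hk, hn0])
        (fun s => by simp [Row.params, Params.σ, ha]; ring)
        (by simp [Row.params]; field_simp) (fun t ht => by
            simpa [Row.g2] using (Real.rpow_pos_of_pos (hpos' t ht) _).ne')
      exact ⟨.case2 lam (P.k / |P.k|) (P.m / |P.k|) (P.C / P.k), ⟨hn, hl, hv.2.2⟩,
            fun t ht => by rw [hg t ht]; simp [Row.g2, Row.g3]⟩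

theorem Eqn.IsGauge.hasMaxAlgebra_of_no_row (hT : E.IsGauge T Tt)
    (h : ∀ r, ¬ E.IsRow3 T Tt r) : E.HasMaxAlgebra (genericBasis3 E.n T Tt) :=
  E.hasMaxAlgebra_generic hT fun _ hP => by_contra fun h0 =>
    let ⟨r, hr⟩ := hP.exists_row hT h0
    h r hr

theorem Eqn.IsGauge.congr (hT : E.IsGauge T Tt) {E' : Eqn} (hn : E'.n = E.n) (hI : E'.I = E.I)
    (hh : E'.h = E.h) : E'.IsGauge T Tt := by
  simpa only [Eqn.IsGauge, hn, hI, hh] using hT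

theorem Eqn.IsGauge.exists_generic (hT : E.IsGauge T Tt) : ∃ E' : Eqn, E'.n = E.n ∧ E'.I = E.I ∧
    E'.h = E.h ∧ E'.HasMaxAlgebra (genericBasis3 E.n T Tt) := by
  let E' : Eqn :=
    { E with
      g := fun t => Tt t * Real.exp (Real.exp (T t))
      smooth_g := hT.contDiffOn_Tt.mul hT.contDiffOn.exp.exp
      g_ne_zero := fun t ht => mul_ne_zero (hT.ne_zero ht) (Real.exp_ne_zero _) }
  have hT' : E'.IsGauge T Tt := hT.congr rfl rfl rfl
  refine ⟨E', rfl, rfl, rfl, E'.hasMaxAlgebra_generic hT' fun P hP => ?_⟩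
  have key : ∀ t ∈ E.I, P.σ (T t) * Real.exp (T t) = P.C := fun t ht => by
    have h1 := hP.ode t ht
    have h2 := hT'.deriv_of_form (F := fun s => Real.exp (Real.exp s)) ht (fun s _ => rfl)
      (Real.hasDerivAt_exp (T t)).exp
    rw [h2] at h1
    have e : E'.g t = Tt t * Real.exp (Real.exp (T t)) := rfl
    have h0 : Tt t ^ 2 * Real.exp (Real.exp (T t)) ≠ 0 :=
      mul_ne_zero (pow_ne_zero 2 (hT.ne_zero ht)) (Real.exp_ne_zero _)
    refine mul_right_cancel₀ h0 ?_
    rw [e] at h1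
    linear_combination h1
  obtain ⟨t, ht⟩ := E.isConnected_I.nonempty
  have h := hT.eq_zero_of_quadratic ht (a := P.a) (k := P.k + 2 * P.a) (m := P.m + P.k) (by
    filter_upwards [E.isOpen_I.eventually_mem ht] with s hs
    have dT := hT.hasDerivAt hs
    have d := ((((dT.pow 2).const_mul P.a).add (dT.const_mul P.k)).add_const P.m).mul dT.exp
    have := d.unique ((hasDerivAt_const s P.C).congr_of_eventuallyEq
      (eventually_of_mem (E.isOpen_I.mem_nhds hs) key))
    refine mul_right_cancel₀ (mul_ne_zero (hT.ne_zero hs) (Real.exp_ne_zero (T s))) ?_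
    simp only [Nat.cast_ofNat, Nat.add_one_sub_one, pow_one, Pi.add_apply, Pi.pow_apply] at this
    linear_combination this)
  refine ⟨h.1, ?_, ?_⟩
  · linarith [h.1, h.2.1]
  · linarith [h.1, h.2.1, h.2.2]

theorem Eqn.IsRow3.normalize_case7 {lam α β γ δ : ℝ} (h : E.IsRow3 T Tt (.case7 lam α β γ δ)) :
    (∃ lam' α' : ℝ, E.IsRow3 T Tt (.case7 lam' α' 0 0 1)) ∨
      (∃ lam' β' δ' : ℝ, E.IsRow3 T Tt (.case7 lam' 0 β' 1 δ')) := by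
  obtain ⟨⟨hn, hl, hΔ, hv⟩, hg⟩ := h
  by_cases hγ : γ = 0
  · subst hγ
    have hδ : δ ≠ 0 := fun h0 => hΔ (by rw [h0]; ring)
    have hα : α ≠ 0 := fun h0 => hΔ (by rw [h0]; ring)
    refine Or.inl ⟨lam * Real.exp (β / δ), α / δ,
      ⟨hn, mul_ne_zero hl (Real.exp_ne_zero _), by simp [hα, hδ], by simp⟩, fun t ht => ?_⟩
    rw [hg t ht]
    have e : (α * T t + β) / (0 * T t + δ)
        = β / δ + (α / δ * T t + 0) / (0 * T t + 1) := by
      simp only [zero_mul, zero_add, add_zero, div_one]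
      ring
    simp only [Row.g3]
    rw [e, Real.exp_add]
    ring
  · refine Or.inr ⟨lam * Real.exp (α / γ), (β - α * δ / γ) / γ, δ / γ,
      ⟨hn, mul_ne_zero hl (Real.exp_ne_zero _), ?_, fun t ht h0 => hv t ht ?_⟩, fun t ht => ?_⟩
    · intro h0
      apply hΔ
      field_simp at h0
      linarith
    · field_simp at h0
      linarith
    · rw [hg t ht]
      have h1 := hv t ht
      have h2 : T t + δ / γ ≠ 0 := fun h0 => h1 (by field_simp at h0; linarith)
      have e : (α * T t + β) / (γ * T t + δ)
          = α / γ + (0 * T t + (β - α * δ / γ) / γ) / (1 * T t + δ / γ) := by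
        have e1 : γ * T t + δ = γ * (T t + δ / γ) := by field_simp
        have e2 : α * T t + β = α * (T t + δ / γ) + (β - α * δ / γ) := by ring
        rw [e1, e2, zero_mul, zero_add, one_mul]
        generalize T t + δ / γ = z at h2 ⊢
        generalize β - α * δ / γ = w
        field_simp
      simp only [Row.g3]
      rw [e, Real.exp_add]
      ring

/-! ### Equations with `h = 0` -/

theorem Eqn.isGauge_id (h0 : ∀ t ∈ E.I, E.h t = 0) : E.IsGauge (fun t => t) fun _ => 1 :=
  ⟨fun _ => 0, fun t ht => ⟨by rw [h0 t ht]; exact hasDerivAt_const t 0, by simp,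
    hasDerivAt_id t⟩⟩

theorem Row.g3_id (r : Row) (t : ℝ) : r.g3 (fun t => t) (fun _ => 1) t = r.g2 t := by
  rw [Row.g3_eq, one_mul]

theorem Eqn.isRow2_iff (h0 : ∀ t ∈ E.I, E.h t = 0) {r : Row} :
    E.IsRow2 r ↔ E.IsRow3 (fun t => t) (fun _ => 1) r := by
  refine and_congr_right fun _ => forall₂_congr fun t ht => ?_
  rw [r.g3_id]
  simp [h0 t ht]

theorem genericBasis3_id (n : ℝ) : genericBasis3 n (fun t => t) (fun _ => 1) = genericBasis n := rfl

theorem hasMaxAlgebra_congr {B B' : List VF}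
    (h : List.Forall₂ (fun V W => EqOn V W E.domain) B B') :
    E.HasMaxAlgebra B → E.HasMaxAlgebra B' := by
  have hl := h.length_eq
  have e : (fun i : Fin B'.length => E.domain.domRestrict (B'.get i))
      = fun i : Fin B'.length => E.domain.domRestrict (B.get (i.cast hl.symm)) := by
    funext i p
    exact (List.forall₂_iff_get.1 h).2 i (i.2.trans_eq hl.symm) i.2 p.2 |>.symm
  rintro ⟨h1, h2⟩
  unfold Eqn.HasMaxAlgebra
  rw [e]
  refine ⟨h1.comp _ (Fin.cast_injective _), ?_⟩
  rw [h2]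
  congr 2
  exact ((finCongr hl.symm).surjective.range_comp
    fun i : Fin B.length => E.domain.domRestrict (B.get i)).symm

theorem Eqn.IsRow2.hasMaxAlgebra (h0 : ∀ t ∈ E.I, E.h t = 0) {r : Row} (hr : E.IsRow2 r) :
    E.HasMaxAlgebra (r.basis2 E.n) := by
  have hT := E.isGauge_id h0
  have hr3 := (E.isRow2_iff h0).1 hr
  have hmain := hr3.hasMaxAlgebra hT
  have hn0 := E.n_ne_zero
  cases r with
  | case4 lam =>
    refine (E.hasMaxAlgebra_const_of_ne_one hT hr.1.1 (hr3.const hT trivial) ?_ ?_).2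
    · intro p hp
      simp [field, vf, Params.σ, h0 p.1 hp.1]
    · intro p hp
      simp only [field, vf, Params.σ, Prod.mk.injEq, h0 p.1 hp.1]
      refine ⟨by ring, by ring, ?_⟩
      field_simp
      ring
  | case9 lam =>
    have hn : E.n = 1 := hr.1.1
    refine (E.hasMaxAlgebra_const_of_eq_one hT hn (hr3.const hT trivial) (fun _ _ => rfl)
      ?_ ?_ ?_).2.2
    · intro p hp
      simp [field, vf, Params.σ, h0 p.1 hp.1]
    · intro p hp
      simp only [field, vf, Params.σ, Prod.mk.injEq, hn, h0 p.1 hp.1]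
      refine ⟨by ring, by ring, by ring⟩
    · intro p hp
      simp only [field, vf, Params.σ, Prod.mk.injEq, hn, h0 p.1 hp.1]
      refine ⟨by ring, by ring, by ring⟩
  | _ =>
    refine hasMaxAlgebra_congr ?_ hmain
    simp only [Row.basis3, Row.basis2, List.forall₂_cons, List.Forall₂.nil, and_true]
    refine ⟨fun _ _ => rfl, ?_⟩
    try refine ⟨fun _ _ => rfl, ?_⟩
    intro p hp
    simp only [vf, h0 p.1 hp.1, Prod.mk.injEq]
    refine ⟨?_, ?_, ?_⟩ <;> first | exact trivial | ring

/-- The row of Table 2 that contains a row of Table 1. -/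
def Row1.toRow : Row1 → Row
  | case2 ε ρ => .case2 ε 1 0 ρ
  | case3 ε => .case3 ε 1
  | case4 => .case4 1
  | case6 ε ρ => .case6 ε 1 0 0 1 ρ
  | case7 ε => .case7 ε 1 0 0 1
  | case8 ε ρ => .case8 ε 1 0 ρ
  | case9 => .case9 1

theorem Row1.toRow_g2 (r : Row1) (t : ℝ) : r.toRow.g2 t = r.g t := by
  cases r <;> simp [Row1.toRow, Row.g2, Row1.g]

theorem ne_zero_of_eq_one_or {ε : ℝ} (h : ε = 1 ∨ ε = -1) : ε ≠ 0 := by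
  rcases h with rfl | rfl <;> norm_num

theorem Eqn.IsRow1.isRow2 {r : Row1} (hr : E.IsRow1 r) : E.IsRow2 r.toRow := by
  obtain ⟨hv, hI, hg⟩ := hr
  refine ⟨?_, fun t ht => ⟨(hg t ht).1, by rw [r.toRow_g2, (hg t ht).2]⟩⟩
  cases r with
  | case2 ε ρ =>
    exact ⟨hv.1, ne_zero_of_eq_one_or hv.2.1, hv.2.2, Or.inl rfl, fun t ht => by
      have h : 0 < t := hI ht
      simpa using h⟩
  | case3 ε => exact ⟨hv.1, ne_zero_of_eq_one_or hv.2, one_ne_zero⟩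
  | case4 => exact ⟨hv, one_ne_zero⟩
  | case6 ε ρ =>
    exact ⟨hv.1, ne_zero_of_eq_one_or hv.2.1, hv.2.2, by norm_num, fun t ht => by
      have h : 0 < t := hI ht
      simpa using h⟩
  | case7 ε => exact ⟨hv.1, ne_zero_of_eq_one_or hv.2, by norm_num, by simp⟩
  | case8 ε ρ => exact ⟨hv.1, ne_zero_of_eq_one_or hv.2.1, hv.2.2, one_ne_zero⟩
  | case9 => exact ⟨hv, one_ne_zero⟩

theorem Eqn.IsRow1.h_eq_zero {r : Row1} (hr : E.IsRow1 r) : ∀ t ∈ E.I, E.h t = 0 :=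
  fun t ht => (hr.2.2 t ht).1

theorem Eqn.IsRow1.isRow3 {r : Row1} (hr : E.IsRow1 r) :
    E.IsRow3 (fun t => t) (fun _ => 1) r.toRow := (E.isRow2_iff hr.h_eq_zero).1 hr.isRow2

/-- The parameters of the last operator in a row of Table 1, or zero in Cases 4 and 9. -/
def Row1.params (n : ℝ) : Row1 → Params
  | case2 _ ρ => ⟨0, 2 * n, 0, 2 * n * ρ, 0, 0⟩
  | case3 _ => ⟨0, 0, 2 * n, 2 * n, 0, 0⟩
  | case6 _ ρ => ⟨0, 2, 0, 2 * ρ, 0, 0⟩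
  | case7 _ => ⟨0, 0, 2, 2, 0, 0⟩
  | case8 _ ρ => ⟨1, 0, 1, 2 * ρ, 0, 0⟩
  | _ => ⟨0, 0, 0, 0, 0, 0⟩

/-- The rows with constant `g`. -/
def Row1.IsConst : Row1 → Prop
  | case4 => True
  | case9 => True
  | _ => False

theorem Row1.isConst_toRow {r : Row1} : r.toRow.IsConst ↔ r.IsConst := by
  cases r <;> exact Iff.rfl

theorem Eqn.IsRow1.admits {r : Row1} (hr : E.IsRow1 r) (hc : ¬ r.IsConst) :
    E.Admits (fun t => t) (fun _ => 1) (r.params E.n) := by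
  have h := hr.isRow3.admits (E.isGauge_id hr.h_eq_zero) (r.isConst_toRow.not.2 hc)
  refine ⟨fun hn => ?_, fun hn => ?_, fun t ht => ?_⟩
  · obtain ⟨hv, -⟩ := hr
    cases r <;> simp_all [Row1.Valid, Row1.params]
  · cases r <;> simp [Row1.params]
  · have := h.ode t ht
    cases r <;> simp only [Row1.params, Row1.toRow, Row.params, Params.σ] at this ⊢ <;>
      first | exact absurd trivial hc | linear_combination this | linear_combination 2 * this

theorem Row1.Valid.params_C {n : ℝ} (hn : n ≠ 0) {r : Row1} (hr : r.Valid n) (hc : ¬ r.IsConst) :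
    (r.params n).C ≠ 0 := by
  cases r <;> simp_all [Row1.Valid, Row1.params, Row1.IsConst]

theorem Eqn.IsRow1.hasMaxAlgebra {r : Row1} (hr : E.IsRow1 r) :
    E.HasMaxAlgebra (r.basis E.n) := by
  have hT := E.isGauge_id hr.h_eq_zero
  have h0 := hr.h_eq_zero
  have hn0 := E.n_ne_zero
  by_cases hc : r.IsConst
  · have hk := hr.isRow3.const hT (r.isConst_toRow.2 hc)
    cases r with
    | case4 =>
      refine (E.hasMaxAlgebra_const_of_ne_one hT hr.1 hk ?_ ?_).1
      · intro p hp
        simp [field, vf, Params.σ, h0 p.1 hp.1]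
      · intro p hp
        simp only [field, vf, Params.σ, Prod.mk.injEq, h0 p.1 hp.1]
        refine ⟨by ring, by ring, ?_⟩
        field_simp
        ring
    | case9 =>
      have hn : E.n = 1 := hr.1
      refine (E.hasMaxAlgebra_const_of_eq_one hT hn hk (fun _ _ => rfl) ?_ ?_ ?_).2.1
      · intro p hp
        simp [field, vf, Params.σ, h0 p.1 hp.1]
      · intro p hp
        simp only [field, vf, Params.σ, Prod.mk.injEq, hn, h0 p.1 hp.1]
        refine ⟨by ring, by ring, by ring⟩
      · intro p hp
        simp only [field, vf, Params.σ, Prod.mk.injEq, hn, h0 p.1 hp.1]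
        refine ⟨by ring, by ring, by ring⟩
    | _ => exact absurd hc id
  · have hP := hr.admits hc
    have hC := hr.1.params_C hn0 hc
    obtain ⟨hv, -⟩ := hr
    cases r with
    | case2 ε ρ =>
      refine E.hasMaxAlgebra_special_of_ne_one hT hv.1 hP hC rfl fun p hp => ?_
      simp only [field, vf, Params.σ, Row1.params, Prod.mk.injEq, h0 p.1 hp.1]
      refine ⟨by ring, by ring, ?_⟩
      field_simp
      ring
    | case3 ε =>
      refine E.hasMaxAlgebra_special_of_ne_one hT hv.1 hP hC rfl fun p hp => ?_
      simp only [field, vf, Params.σ, Row1.params, Prod.mk.injEq, h0 p.1 hp.1]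
      refine ⟨by ring, by ring, ?_⟩
      field_simp
      ring
    | case6 ε ρ =>
      have hn : E.n = 1 := hv.1
      refine E.hasMaxAlgebra_special_of_eq_one hT hn hP hC rfl rfl (fun _ _ => rfl)
        fun p hp => ?_
      simp only [field, vf, Params.σ, Row1.params, Prod.mk.injEq, hn, h0 p.1 hp.1]
      refine ⟨by ring, by ring, by ring⟩
    | case7 ε =>
      have hn : E.n = 1 := hv.1
      refine E.hasMaxAlgebra_special_of_eq_one hT hn hP hC rfl rfl (fun _ _ => rfl)
        fun p hp => ?_
      simp only [field, vf, Params.σ, Row1.params, Prod.mk.injEq, hn, h0 p.1 hp.1]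
      refine ⟨by ring, by ring, by ring⟩
    | case8 ε ρ =>
      have hn : E.n = 1 := hv.1
      refine E.hasMaxAlgebra_special_of_eq_one hT hn hP hC rfl rfl (fun _ _ => rfl)
        fun p hp => ?_
      simp only [field, vf, Params.σ, Row1.params, Prod.mk.injEq, hn, h0 p.1 hp.1]
      refine ⟨by ring, by ring, by ring⟩
    | _ => exact absurd trivial hc

end Classification

theorem exists_local_inverse {F G : Type} [NormedAddCommGroup F] [NormedSpace ℝ F]
    [CompleteSpace F] [NormedAddCommGroup G] [NormedSpace ℝ G] {f : F → G} {a : F}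
    (hf : ContDiffAt ℝ ∞ f a) (f' : F ≃L[ℝ] G) (hf' : HasFDerivAt f (f' : F →L[ℝ] G) a) :
    ∃ S : G → F, ContDiffAt ℝ ∞ S (f a) ∧ S (f a) = a ∧ (∀ᶠ x in 𝓝 a, S (f x) = x) ∧
      ∀ᶠ y in 𝓝 (f a), f (S y) = y := by
  have hn : (∞ : WithTop ℕ∞) ≠ 0 := by simp
  have hs := hf.hasStrictFDerivAt' hf' hn
  exact ⟨hf.localInverse hf' hn, hf.to_localInverse hf' hn, hf.localInverse_apply_image hf' hn,
    hs.eventually_left_inverse, hs.eventually_right_inverse⟩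

theorem exists_inverse_on {I : Set ℝ} (hI : IsOpen I) {θ θ1 : ℝ → ℝ} (hθ : ContDiffOn ℝ ∞ θ I)
    (hd : ∀ t ∈ I, HasDerivAt θ (θ1 t) t) (h0 : ∀ t ∈ I, θ1 t ≠ 0) (hinj : InjOn θ I) :
    IsOpen (θ '' I) ∧ ∃ S : ℝ → ℝ, ContDiffOn ℝ ∞ S (θ '' I) ∧ (∀ t ∈ I, S (θ t) = t) := by
  have hloc : ∀ t ∈ I, ∃ S : ℝ → ℝ, ContDiffAt ℝ ∞ S (θ t) ∧ S (θ t) = t ∧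
      ∀ᶠ y in 𝓝 (θ t), θ (S y) = y := by
    intro t ht
    obtain ⟨S, h1, h2, -, h3⟩ := exists_local_inverse (hθ.contDiffAt (hI.mem_nhds ht)) _
      ((hd t ht).hasFDerivAt_equiv (h0 t ht))
    exact ⟨S, h1, h2, h3⟩
  have hmem : ∀ t ∈ I, ∀ S : ℝ → ℝ, ContDiffAt ℝ ∞ S (θ t) → S (θ t) = t →
      (∀ᶠ y in 𝓝 (θ t), S y ∈ I) := by
    intro t ht S h1 h2
    refine h1.continuousAt.eventually_mem ?_
    rw [h2]
    exact hI.mem_nhds ht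
  refine ⟨isOpen_iff_mem_nhds.2 ?_, Function.invFunOn θ I, ?_, hinj.leftInvOn_invFunOn⟩
  · rintro _ ⟨t, ht, rfl⟩
    obtain ⟨S, h1, h2, h3⟩ := hloc t ht
    filter_upwards [h3, hmem t ht S h1 h2] with y hy hyI using ⟨S y, hyI, hy⟩
  · rintro _ ⟨t, ht, rfl⟩
    obtain ⟨S, h1, h2, h3⟩ := hloc t ht
    refine (h1.congr_of_eventuallyEq ?_).contDiffWithinAt
    filter_upwards [h3, hmem t ht S h1 h2] with y hy hyI
    have := hinj.leftInvOn_invFunOn hyI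
    rwa [hy] at this

section Link

variable {E E' : Eqn} {J : Set ℝ} {θ θ1 X Y : ℝ → ℝ} {Z : ℝ}

/-- The functions `θ`, `X`, `Y` and the constant `Z` determine a point transformation
`(t, x, u) ↦ (θ, X x, Y u + Z x)` from `E` to the equation `E'` with `h = 0`; `θ1` is the derivative
of `θ`. -/
structure Link (E E' : Eqn) (J : Set ℝ) (θ θ1 X Y : ℝ → ℝ) (Z : ℝ) : Prop where
  n_eq : E'.n = E.n
  mem : ∀ t ∈ J, θ t ∈ E'.I
  hasDerivAt_θ : ∀ t ∈ J, HasDerivAt θ (θ1 t) t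
  θ1_ne_zero : ∀ t ∈ J, θ1 t ≠ 0
  hasDerivAt_X : ∀ t ∈ J, HasDerivAt X (θ1 t * Z) t
  X_ne_zero : ∀ t ∈ J, X t ≠ 0
  hasDerivAt_Y : ∀ t ∈ J, HasDerivAt Y (E.h t * Y t - Z) t
  Y_rpow : ∀ t ∈ J, θ1 t * Y t ^ E.n = X t
  g_eq : ∀ t ∈ J, E'.g (θ t) * θ1 t = E.g t * X t ^ 2
  Z_eq : E.n ≠ 1 → Z = 0
  Y_pos : E.n ≠ 1 → ∀ t ∈ J, 0 < Y t

theorem Link.Y_ne_zero (hL : Link E E' J θ θ1 X Y Z) {t : ℝ} (ht : t ∈ J) : Y t ≠ 0 := by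
  by_cases hn : E.n = 1
  · intro h0
    have := hL.Y_rpow t ht
    rw [h0, hn, Real.rpow_one, mul_zero] at this
    exact hL.X_ne_zero t ht this.symm
  · exact (hL.Y_pos hn t ht).ne'

/-- The point transformation of a link. -/
def linkMap (θ X Y : ℝ → ℝ) (Z : ℝ) : Pt → Pt := fun p =>
  (θ p.1, X p.1 * p.2.1, Y p.1 * p.2.2 + Z * p.2.1)

theorem Link.holdsAt_iff (hL : Link E E' J θ θ1 X Y Z) (h0 : ∀ t ∈ E'.I, E'.h t = 0)
    {u v : ℝ → ℝ → ℝ} {t x : ℝ} (ht : t ∈ J) (hl : lift u t x ∈ E.domain) (hu : SmoothAt u t x)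
    (hv : SmoothAt v (θ t) (X t * x))
    (hev : ∀ᶠ q : ℝ × ℝ in 𝓝 (t, x), Y q.1 * u q.1 q.2 + Z * q.2 = v (θ q.1) (X q.1 * q.2)) :
    E.HoldsAt u t x ↔ E'.HoldsAt v (θ t) (X t * x) := by
  have hval : Y t * u t x + Z * x = v (θ t) (X t * x) := hev.self_of_nhds
  have hevT : ∀ᶠ s in 𝓝 t, Y s * u s x + Z * x = v (θ s) (X s * x) := by
    have hc : ContinuousAt (fun s : ℝ => (s, x)) t := by fun_prop
    exact hc.eventually hev
  have hevX : ∀ᶠ y in 𝓝 x, Y t * u t y + Z * y = v (θ t) (X t * y) := by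
    have hc : ContinuousAt (fun y : ℝ => (t, y)) x := by fun_prop
    exact hc.eventually hev
  have hT : (E.h t * Y t - Z) * u t x + Y t * dt u t x
      = dt v (θ t) (X t * x) * θ1 t + dx v (θ t) (X t * x) * (θ1 t * Z * x) := by
    have d1 := ((hL.hasDerivAt_Y t ht).mul hu.hasDerivAt_dt).add_const (Z * x)
    have d2 := hasDerivAt_comp_plane_curve (u := v) (a := θ) (b := fun s => X s * x)
      hv.differentiableAt (hL.hasDerivAt_θ t ht) ((hL.hasDerivAt_X t ht).mul_const x)
    exact d1.unique (d2.congr_of_eventuallyEq hevT)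
  have hXe : ∀ᶠ y in 𝓝 x, Y t * dx u t y + Z = dx v (θ t) (X t * y) * X t := by
    have hc : ContinuousAt (fun y : ℝ => (θ t, X t * y)) x := by fun_prop
    filter_upwards [hevX.eventually_nhds, hu.eventually_hasDerivAt_dx,
      hc.eventually hv.eventually_differentiableAt] with y hy hd hvd
    have d1 := (hd.const_mul (Y t)).add ((hasDerivAt_id y).const_mul Z)
    have d2 := hasDerivAt_comp_plane_curve (u := v) (a := fun _ => θ t) (b := fun y => X t * y)
      hvd (hasDerivAt_const y (θ t)) ((hasDerivAt_id y).const_mul (X t))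
    have := d1.unique (d2.congr_of_eventuallyEq hy)
    simpa using this
  have hX := hXe.self_of_nhds
  have hXX : Y t * dx (dx u) t x = dx (dx v) (θ t) (X t * x) * X t * X t := by
    have d1 := (hu.dx.hasDerivAt_dx.const_mul (Y t)).add_const Z
    have d2 := (hasDerivAt_comp_plane_curve (u := dx v) (a := fun _ => θ t)
      (b := fun y => X t * y) (s := x) hv.dx.differentiableAt (hasDerivAt_const x (θ t))
      ((hasDerivAt_id x).const_mul (X t))).mul_const (X t)
    have := d1.unique (d2.congr_of_eventuallyEq hXe)
    simpa using this
  have hY0 := hL.Y_ne_zero ht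
  have hX0 := hL.X_ne_zero t ht
  have hg := hL.g_eq t ht
  have hYn := hL.Y_rpow t ht
  have hθ := hL.θ1_ne_zero t ht
  unfold Eqn.HoldsAt
  rw [h0 _ (hL.mem t ht), zero_mul, add_zero, hL.n_eq, ← hval]
  have key : θ1 t * (dt v (θ t) (X t * x) + (Y t * u t x + Z * x) ^ E.n * dx v (θ t) (X t * x)
      - E'.g (θ t) * dx (dx v) (θ t) (X t * x))
      = Y t * (dt u t x + u t x ^ E.n * dx u t x + E.h t * u t x - E.g t * dx (dx u) t x) := by
    by_cases hn : E.n = 1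
    · rw [hn, Real.rpow_one] at hYn
      rw [hn, Real.rpow_one, Real.rpow_one]
      linear_combination (-dx (dx v) (θ t) (X t * x)) * hg - E.g t * (-hXX) - hT
        - u t x * hX + u t x * dx v (θ t) (X t * x) * hYn
    · have hZ := hL.Z_eq hn
      subst hZ
      have hup : 0 < u t x := Eqn.pos_of_mem_U hn hl.2
      have hYp := hL.Y_pos hn t ht
      rw [zero_mul, add_zero, Real.mul_rpow hYp.le hup.le]
      linear_combination (-dx (dx v) (θ t) (X t * x)) * hg - E.g t * (-hXX) - hT
        - u t x ^ E.n * hX + u t x ^ E.n * dx v (θ t) (X t * x) * hYn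
  constructor
  · intro h
    rw [sub_eq_zero.2 h, mul_zero] at key
    exact sub_eq_zero.1 ((mul_eq_zero.1 key).resolve_left hθ)
  · intro h
    rw [sub_eq_zero.2 h, mul_zero] at key
    exact sub_eq_zero.1 ((mul_eq_zero.1 key.symm).resolve_left hY0)

theorem Link.pointEquiv (hL : Link E E' E.I θ θ1 X Y Z) (h0 : ∀ t ∈ E'.I, E'.h t = 0)
    (hθ : ContDiffOn ℝ ∞ θ E.I) (hX : ContDiffOn ℝ ∞ X E.I) (hY : ContDiffOn ℝ ∞ Y E.I)
    (hbij : BijOn θ E.I E'.I) : E.PointEquiv E' := by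
  have hm : MapsTo (Prod.fst : Pt → ℝ) E.domain E.I := fun p hp => hp.1
  have hU : E'.U = E.U := by simp only [Eqn.U, hL.n_eq]
  have hmem : ∀ t ∈ E.I, ∀ x u, Y t * u + Z * x ∈ E.U ↔ u ∈ E.U := by
    intro t ht x u
    by_cases hn : E.n = 1
    · simp [Eqn.U, hn]
    · have hZ := hL.Z_eq hn
      subst hZ
      simp [Eqn.U, hn, mul_pos_iff_of_pos_left (hL.Y_pos hn t ht)]
  have hmaps : MapsTo (linkMap θ X Y Z) E.domain E'.domain := by
    rintro ⟨t, x, u⟩ ⟨ht, hu⟩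
    exact ⟨hL.mem t ht, hU ▸ (hmem t ht x u).2 hu⟩
  have hx : ContDiffOn ℝ ∞ (fun p : Pt => p.2.1) E.domain :=
    (contDiff_fst.comp contDiff_snd).contDiffOn
  have hu : ContDiffOn ℝ ∞ (fun p : Pt => p.2.2) E.domain :=
    (contDiff_snd.comp contDiff_snd).contDiffOn
  have hsm : ContDiffOn ℝ ∞ (linkMap θ X Y Z) E.domain :=
    (hθ.comp contDiff_fst.contDiffOn hm).prodMk
      (((hX.comp contDiff_fst.contDiffOn hm).mul hx).prodMk
        (((hY.comp contDiff_fst.contDiffOn hm).mul hu).add (contDiffOn_const.mul hx)))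
  refine ⟨linkMap θ X Y Z, ⟨E.isOpen_domain, Subset.rfl, hmaps, hsm, ?_, ?_⟩, hmaps, ?_, ?_⟩
  · rintro ⟨t, x, u⟩ hp
    have ht : t ∈ E.I := hp.1
    refine IsUnit.ne_zero ((LinearMap.isUnit_iff_isUnit_det _).1
      ((LinearMap.isUnit_iff_ker_eq_bot _).2 ((LinearMap.ker_eq_bot').2 ?_)))
    rintro ⟨a, b, c⟩ hw
    have hd : HasFDerivAt (linkMap θ X Y Z) (fderiv ℝ (linkMap θ X Y Z) (t, x, u)) (t, x, u) :=
      ((hsm.contDiffAt (E.isOpen_domain.mem_nhds hp)).differentiableAt (by simp)).hasFDerivAt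
    have e1 : HasDerivAt (fun s => t + s * a) a 0 := by
      simpa using ((hasDerivAt_id (0 : ℝ)).mul_const a).const_add t
    have e2 : HasDerivAt (fun s => x + s * b) b 0 := by
      simpa using ((hasDerivAt_id (0 : ℝ)).mul_const b).const_add x
    have e3 : HasDerivAt (fun s => u + s * c) c 0 := by
      simpa using ((hasDerivAt_id (0 : ℝ)).mul_const c).const_add u
    have t0 : t + 0 * a = t := by ring
    have d1 : HasDerivAt (fun s => linkMap θ X Y Z (t + s * a, x + s * b, u + s * c)) 0 0 := by
      have hd' : HasFDerivAt (linkMap θ X Y Z) (fderiv ℝ (linkMap θ X Y Z) (t, x, u))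
          (t + 0 * a, x + 0 * b, u + 0 * c) := by simpa using hd
      have := hd'.comp_hasDerivAt 0 (e1.prodMk (e2.prodMk e3))
      have hw' : fderiv ℝ (linkMap θ X Y Z) (t, x, u) (a, b, c) = 0 := hw
      rwa [hw'] at this
    have hθ' : HasDerivAt θ (θ1 t) (t + 0 * a) := by rw [t0]; exact hL.hasDerivAt_θ t ht
    have hX' : HasDerivAt X (θ1 t * Z) (t + 0 * a) := by rw [t0]; exact hL.hasDerivAt_X t ht
    have hY' : HasDerivAt Y (E.h t * Y t - Z) (t + 0 * a) := by
      rw [t0]; exact hL.hasDerivAt_Y t ht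
    have d2 := (hθ'.comp 0 e1).prodMk (((hX'.comp 0 e1).mul e2).prodMk
      (((hY'.comp 0 e1).mul e3).add (e2.const_mul Z)))
    have h := d1.unique d2
    simp only [Prod.zero_eq_mk, Prod.mk.injEq, Function.comp] at h
    obtain ⟨h1, h2, h3⟩ := h
    have ha : a = 0 := by simpa [hL.θ1_ne_zero t ht] using h1.symm
    subst ha
    have hb : b = 0 := by simpa [hL.X_ne_zero t ht] using h2.symm
    subst hb
    have hc : c = 0 := by simpa [hL.Y_ne_zero ht] using h3.symm
    subst hc
    rfl
  · intro u v t x hl hu hv hev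
    exact hL.holdsAt_iff h0 hl.1 hl hu hv hev
  · rintro ⟨t, x, u⟩ hp ⟨t', x', u'⟩ hp' heq
    simp only [linkMap, Prod.mk.injEq] at heq
    obtain ⟨h1, h2, h3⟩ := heq
    obtain rfl : t = t' := hbij.injOn hp.1 hp'.1 h1
    obtain rfl : x = x' := mul_left_cancel₀ (hL.X_ne_zero t hp.1) h2
    obtain rfl : u = u' := mul_left_cancel₀ (hL.Y_ne_zero hp.1) (by linarith)
    rfl
  · rintro ⟨s, y, w⟩ ⟨hs, hw⟩
    obtain ⟨t, ht, rfl⟩ := hbij.surjOn hs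
    have hX0 := hL.X_ne_zero t ht
    have hY0 := hL.Y_ne_zero ht
    have e : Y t * ((w - Z * (y / X t)) / Y t) + Z * (y / X t) = w := by field_simp; ring
    refine ⟨(t, y / X t, (w - Z * (y / X t)) / Y t), ⟨ht, ?_⟩, ?_⟩
    · refine (hmem t ht (y / X t) _).1 ?_
      rw [e]
      exact hU ▸ hw
    · simp only [linkMap, e, Prod.mk.injEq, and_true, true_and]
      field_simp

theorem Eqn.exists_target (E : Eqn) (hθ : ContDiffOn ℝ ∞ θ E.I) (hX : ContDiffOn ℝ ∞ X E.I)
    (hY : ContDiffOn ℝ ∞ Y E.I) (hθ1 : ContDiffOn ℝ ∞ θ1 E.I)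
    (dθ : ∀ t ∈ E.I, HasDerivAt θ (θ1 t) t) (θ0 : ∀ t ∈ E.I, θ1 t ≠ 0)
    (dX : ∀ t ∈ E.I, HasDerivAt X (θ1 t * Z) t) (X0 : ∀ t ∈ E.I, X t ≠ 0)
    (dY : ∀ t ∈ E.I, HasDerivAt Y (E.h t * Y t - Z) t)
    (hYX : ∀ t ∈ E.I, θ1 t * Y t ^ E.n = X t) (hZ : E.n ≠ 1 → Z = 0)
    (hYp : E.n ≠ 1 → ∀ t ∈ E.I, 0 < Y t) (hinj : InjOn θ E.I) :
    ∃ E' : Eqn, Link E E' E.I θ θ1 X Y Z ∧ E'.I = θ '' E.I ∧ (∀ t ∈ E'.I, E'.h t = 0) ∧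
      E.PointEquiv E' := by
  obtain ⟨hopen, S, hS, hSθ⟩ := exists_inverse_on E.isOpen_I hθ dθ θ0 hinj
  have hSm : MapsTo S (θ '' E.I) E.I := by
    rintro _ ⟨t, ht, rfl⟩
    rwa [hSθ t ht]
  let E' : Eqn :=
    { n := E.n
      I := θ '' E.I
      h := fun _ => 0
      g := (fun t => E.g t * X t ^ 2 / θ1 t) ∘ S
      n_ne_zero := E.n_ne_zero
      isOpen_I := hopen
      isConnected_I := E.isConnected_I.image θ hθ.continuousOn
      smooth_h := contDiffOn_const
      smooth_g := ((E.smooth_g.mul (hX.pow 2)).div hθ1 θ0).comp hS hSm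
      g_ne_zero := fun s hs => div_ne_zero (mul_ne_zero (E.g_ne_zero _ (hSm hs))
        (pow_ne_zero 2 (X0 _ (hSm hs)))) (θ0 _ (hSm hs)) }
  have hL : Link E E' E.I θ θ1 X Y Z := by
    refine ⟨rfl, fun t ht => mem_image_of_mem θ ht, dθ, θ0, dX, X0, dY, hYX, fun t ht => ?_, hZ,
      hYp⟩
    change E.g (S (θ t)) * X (S (θ t)) ^ 2 / θ1 (S (θ t)) * θ1 t = _
    rw [hSθ t ht, div_mul_cancel₀ _ (θ0 t ht)]
  exact ⟨E', hL, rfl, fun _ _ => rfl, hL.pointEquiv (fun _ _ => rfl) hθ hX hY hinj.bijOn_image⟩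

end Link

theorem Eqn.exists_isGauge (E : Eqn) : ∃ T Tt, E.IsGauge T Tt := by
  have hprim : ∀ f : ℝ → ℝ, ContinuousOn f E.I → ∃ F : ℝ → ℝ, ∀ t ∈ E.I, HasDerivAt F (f t) t := by
    intro f hf
    obtain ⟨t₀, ht₀⟩ := E.isConnected_I.nonempty
    refine ⟨fun t => ∫ s in t₀..t, f s, fun t ht => ?_⟩
    have hsub : uIcc t₀ t ⊆ E.I :=
      E.isConnected_I.isPreconnected.ordConnected.uIcc_subset ht₀ ht
    exact intervalIntegral.integral_hasDerivAt_right (hf.mono hsub).intervalIntegrable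
      (hf.stronglyMeasurableAtFilter E.isOpen_I t ht) (hf.continuousAt (E.isOpen_I.mem_nhds ht))
  obtain ⟨H, hH⟩ := hprim E.h E.smooth_h.continuousOn
  have hc : ContinuousOn (fun t => Real.exp (-E.n * H t)) E.I := fun t ht =>
    ((hH t ht).continuousAt.const_mul (-E.n)).rexp.continuousWithinAt
  obtain ⟨T, hT⟩ := hprim _ hc
  exact ⟨T, fun t => Real.exp (-E.n * H t), H, fun t ht => ⟨hH t ht, rfl, hT t ht⟩⟩

theorem Eqn.IsGauge.injOn {E : Eqn} {T Tt : ℝ → ℝ} (hT : E.IsGauge T Tt) : InjOn T E.I := by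
  have hconv : Convex ℝ E.I := E.isConnected_I.isPreconnected.ordConnected.convex
  refine (strictMonoOn_of_deriv_pos hconv hT.contDiffOn.continuousOn fun t ht => ?_).injOn
  have ht' := interior_subset ht
  rw [(hT.hasDerivAt ht').deriv]
  exact hT.pos ht'

section Reduction

variable {E : Eqn} {T Tt : ℝ → ℝ}

theorem Eqn.IsGauge.hasDerivAt_moebius (hT : E.IsGauge T Tt) {α β γ δ t : ℝ} (ht : t ∈ E.I)
    (hP : γ * T t + δ ≠ 0) :
    HasDerivAt (fun t => (α * T t + β) / (γ * T t + δ))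
      ((α * δ - β * γ) * Tt t / (γ * T t + δ) ^ 2) t := by
  have dT := hT.hasDerivAt ht
  refine (((dT.const_mul α).add_const β).div ((dT.const_mul γ).add_const δ) hP).congr_deriv ?_
  congr 1
  ring

/-- A fractional linear change of `T`, supplemented to a point transformation to an equation
with `h = 0`. -/
theorem Eqn.IsGauge.exists_moebius_target (hT : E.IsGauge T Tt) {α β γ δ κ : ℝ}
    (hΔ : α * δ - β * γ ≠ 0) (hP : ∀ t ∈ E.I, γ * T t + δ ≠ 0) (hκ : κ ≠ 0)
    (hn : E.n ≠ 1 → γ = 0 ∧ δ = 1 ∧ 0 < κ / α) :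
    ∃ E' : Eqn, E'.n = E.n ∧ E'.I = (fun t => (α * T t + β) / (γ * T t + δ)) '' E.I ∧
      (∀ t ∈ E'.I, E'.h t = 0) ∧
      (∀ t ∈ E.I, E'.g ((α * T t + β) / (γ * T t + δ))
        = κ ^ 2 / (α * δ - β * γ) * (E.g t / Tt t)) ∧ E.PointEquiv E' := by
  set θ : ℝ → ℝ := fun t => (α * T t + β) / (γ * T t + δ) with hθ
  set θ1 : ℝ → ℝ := fun t => (α * δ - β * γ) * Tt t / (γ * T t + δ) ^ 2 with hθ1
  set X : ℝ → ℝ := fun t => κ / (γ * T t + δ) with hX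
  have sT := hT.contDiffOn
  have sTt := hT.contDiffOn_Tt
  have sP : ContDiffOn ℝ ∞ (fun t => γ * T t + δ) E.I := (contDiffOn_const.mul sT).add
    contDiffOn_const
  have sP2 : ContDiffOn ℝ ∞ (fun t => (γ * T t + δ) ^ 2) E.I := sP.pow 2
  have sθ : ContDiffOn ℝ ∞ θ E.I := ((contDiffOn_const.mul sT).add contDiffOn_const).div sP hP
  have sθ1 : ContDiffOn ℝ ∞ θ1 E.I := (contDiffOn_const.mul sTt).div sP2
    fun t ht => pow_ne_zero 2 (hP t ht)
  have sX : ContDiffOn ℝ ∞ X E.I := contDiffOn_const.div sP hP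
  have dθ : ∀ t ∈ E.I, HasDerivAt θ (θ1 t) t := fun t ht => hT.hasDerivAt_moebius ht (hP t ht)
  have θ0 : ∀ t ∈ E.I, θ1 t ≠ 0 := fun t ht =>
    div_ne_zero (mul_ne_zero hΔ (hT.ne_zero ht)) (pow_ne_zero 2 (hP t ht))
  have dX : ∀ t ∈ E.I, HasDerivAt X (θ1 t * (-(κ * γ) / (α * δ - β * γ))) t := fun t ht => by
    have h0 := hP t ht
    refine ((hasDerivAt_const t κ).div (((hT.hasDerivAt ht).const_mul γ).add_const δ)
      h0).congr_deriv ?_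
    simp only [hθ1]
    generalize α * δ - β * γ = Δ at hΔ ⊢
    field_simp
    ring
  have X0 : ∀ t ∈ E.I, X t ≠ 0 := fun t ht => div_ne_zero hκ (hP t ht)
  have hinj : InjOn θ E.I := by
    intro s hs t ht hst
    refine hT.injOn hs ht ?_
    have h1 := hP s hs
    have h2 := hP t ht
    simp only [hθ] at hst
    rw [div_eq_div_iff h1 h2] at hst
    refine mul_left_cancel₀ hΔ ?_
    linear_combination hst
  obtain ⟨Y, sY, dY, hYX, hYp⟩ : ∃ Y : ℝ → ℝ, ContDiffOn ℝ ∞ Y E.I ∧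
      (∀ t ∈ E.I, HasDerivAt Y (E.h t * Y t - -(κ * γ) / (α * δ - β * γ)) t) ∧
      (∀ t ∈ E.I, θ1 t * Y t ^ E.n = X t) ∧ (E.n ≠ 1 → ∀ t ∈ E.I, 0 < Y t) := by
    by_cases h1 : E.n = 1
    · refine ⟨fun t => κ / (α * δ - β * γ) * ((γ * T t + δ) / Tt t),
        contDiffOn_const.mul (sP.div sTt fun t ht => hT.ne_zero ht), fun t ht => ?_,
        fun t ht => ?_, fun h => absurd h1 h⟩
      · have h0 := hT.ne_zero ht
        refine (((((hT.hasDerivAt ht).const_mul γ).add_const δ).div (hT.hasDerivAt_Tt ht)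
          h0).const_mul (κ / (α * δ - β * γ))).congr_deriv ?_
        rw [h1]
        field_simp
        ring
      · have h0 := hT.ne_zero ht
        have h2 := hP t ht
        simp only [h1, Real.rpow_one, hθ1, hX]
        field_simp
    · obtain ⟨rfl, rfl, hpos⟩ := hn h1
      have hn0 := E.n_ne_zero
      have hp : ∀ t ∈ E.I, 0 < κ / α / Tt t := fun t ht => div_pos hpos (hT.pos ht)
      have hα : α ≠ 0 := by rintro rfl; simp at hpos
      refine ⟨fun t => (κ / α / Tt t) ^ (1 / E.n), ?_, fun t ht => ?_, fun t ht => ?_,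
        fun _ t ht => Real.rpow_pos_of_pos (hp t ht) _⟩
      · exact (contDiffOn_const.div sTt fun t ht => hT.ne_zero ht).rpow_const_of_ne
          fun t ht => (hp t ht).ne'
      · have h0 := hT.ne_zero ht
        refine (((hasDerivAt_const t (κ / α)).div (hT.hasDerivAt_Tt ht) h0).rpow_const
          (p := 1 / E.n) (Or.inl (hp t ht).ne')).congr_deriv ?_
        simp only [Pi.div_apply]
        rw [Real.rpow_sub_one (hp t ht).ne']
        field_simp
        ring
      · have h0 := hT.ne_zero ht
        simp only [hθ1, hX]
        rw [← Real.rpow_mul (hp t ht).le, one_div_mul_cancel hn0, Real.rpow_one]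
        field_simp
        ring
  obtain ⟨E', hL, hI, hh, hE⟩ := E.exists_target sθ sX sY sθ1 dθ θ0 dX X0 dY hYX
    (fun h => by rw [(hn h).1]; simp) hYp hinj
  refine ⟨E', hL.n_eq, hI, hh, fun t ht => ?_, hE⟩
  have hg := hL.g_eq t ht
  refine mul_right_cancel₀ (θ0 t ht) ?_
  have h0 := hT.ne_zero ht
  have h2 := hP t ht
  change E'.g (θ t) * θ1 t = _
  rw [hg]
  simp only [hθ1, hX]
  generalize α * δ - β * γ = Δ at hΔ ⊢
  field_simp

theorem exists_scale {c α : ℝ} (hc : c ≠ 0) (hα : α ≠ 0) :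
    ∃ κ, κ ≠ 0 ∧ 0 < κ / α ∧ (κ ^ 2 * c = 1 ∨ κ ^ 2 * c = -1) := by
  have h : 0 < Real.sqrt |c| := Real.sqrt_pos.2 (abs_pos.2 hc)
  have hsq : Real.sqrt |c| ^ 2 = |c| := Real.sq_sqrt (abs_nonneg c)
  have hα' : 0 < |α| := abs_pos.2 hα
  refine ⟨α / |α| / Real.sqrt |c|, by positivity, ?_, ?_⟩
  · have : α / |α| / Real.sqrt |c| / α = 1 / (|α| * Real.sqrt |c|) := by field_simp
    rw [this]
    positivity
  · have : (α / |α| / Real.sqrt |c|) ^ 2 * c = c / |c| := by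
      rw [div_pow, div_pow, sq_abs, hsq]
      field_simp
    rw [this]
    rcases lt_or_gt_of_ne hc with h' | h'
    · right
      rw [abs_of_neg h']
      field_simp
    · left
      rw [abs_of_pos h']
      field_simp

theorem Eqn.IsGauge.exists_row1_of_moebius (hT : E.IsGauge T Tt) {α β γ δ κ : ℝ} (r : Row1)
    (hΔ : α * δ - β * γ ≠ 0) (hP : ∀ t ∈ E.I, γ * T t + δ ≠ 0) (hκ : κ ≠ 0)
    (hn : E.n ≠ 1 → γ = 0 ∧ δ = 1 ∧ 0 < κ / α) (hr : r.Valid E.n)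
    (hdom : ∀ t ∈ E.I, (α * T t + β) / (γ * T t + δ) ∈ r.tDomain)
    (hg : ∀ t ∈ E.I, κ ^ 2 / (α * δ - β * γ) * (E.g t / Tt t)
      = r.g ((α * T t + β) / (γ * T t + δ))) :
    ∃ E' : Eqn, E'.n = E.n ∧ E'.IsRow1 r ∧ E.PointEquiv E' := by
  obtain ⟨E', h1, h2, h3, h4, h5⟩ := hT.exists_moebius_target hΔ hP hκ hn
  refine ⟨E', h1, ⟨h1 ▸ hr, ?_, fun s hs => ⟨h3 s hs, ?_⟩⟩, h5⟩
  · rw [h2]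
    rintro _ ⟨t, ht, rfl⟩
    exact hdom t ht
  · rw [h2] at hs
    obtain ⟨t, ht, rfl⟩ := hs
    exact (h4 t ht).trans (hg t ht)

theorem Eqn.IsRow3.exists_row1 (hT : E.IsGauge T Tt) {r : Row} (hr : E.IsRow3 T Tt r) :
    ∃ (r' : Row1) (E' : Eqn), E'.n = E.n ∧ E'.IsRow1 r' ∧ E.PointEquiv E' := by
  have hG : ∀ t ∈ E.I, E.g t / Tt t = r.g2 (T t) := fun t ht => by
    rw [hr.2 t ht, r.g3_eq, mul_div_cancel_left₀ _ (hT.ne_zero ht)]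
  obtain ⟨hv, -⟩ := hr
  cases r with
  | case2 lam α β ρ =>
    obtain ⟨hn, hl, hρ, hα, hpos⟩ := hv
    have hα0 := ne_zero_of_eq_one_or hα
    obtain ⟨κ, hκ, hκα, hε⟩ := exists_scale (div_ne_zero hl hα0) hα0
    refine ⟨.case2 (κ ^ 2 * (lam / α)) ρ, hT.exists_row1_of_moebius (α := α) (β := β) (γ := 0)
      (δ := 1) (κ := κ) _ (by simpa using hα0) (fun t _ => by simp) hκ (fun _ => ⟨rfl, rfl, hκα⟩)
      ⟨hn, hε, hρ⟩ (fun t ht => ?_) fun t ht => ?_⟩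
    · simpa [Row1.tDomain] using hpos t ht
    · rw [hG t ht]
      simp [Row.g2, Row1.g]
      ring
  | case3 lam α =>
    obtain ⟨hn, hl, hα⟩ := hv
    obtain ⟨κ, hκ, hκα, hε⟩ := exists_scale (div_ne_zero hl hα) hα
    refine ⟨.case3 (κ ^ 2 * (lam / α)), hT.exists_row1_of_moebius (α := α) (β := 0) (γ := 0)
      (δ := 1) (κ := κ) _ (by simpa using hα) (fun t _ => by simp) hκ (fun _ => ⟨rfl, rfl, hκα⟩)
      ⟨hn, hε⟩ (fun t ht => mem_univ _) fun t ht => ?_⟩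
    rw [hG t ht]
    simp [Row.g2, Row1.g]
    ring
  | case4 lam =>
    obtain ⟨hn, hl⟩ := hv
    have hl' : 0 < |lam| := abs_pos.2 hl
    refine ⟨.case4, hT.exists_row1_of_moebius (α := lam) (β := 0) (γ := 0)
      (δ := 1) (κ := lam / |lam|) _ (by simpa using hl) (fun t _ => by simp) (by positivity)
      (fun _ => ⟨rfl, rfl, ?_⟩) hn (fun t ht => mem_univ _) fun t ht => ?_⟩
    · have : lam / |lam| / lam = 1 / |lam| := by field_simp
      rw [this]
      positivity
    · rw [hG t ht]
      simp only [Row.g2, Row1.g, div_pow, sq_abs, mul_one, mul_zero, sub_zero]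
      field_simp
  | case6 lam α β γ δ ρ =>
    obtain ⟨hn, hl, hρ, hΔ, hpos⟩ := hv
    obtain ⟨κ, hκ, -, hε⟩ := exists_scale (div_ne_zero hl hΔ) hΔ
    refine ⟨.case6 (κ ^ 2 * (lam / (α * δ - β * γ))) ρ, hT.exists_row1_of_moebius (κ := κ) _ hΔ
      (fun t ht => (hpos t ht).1) hκ (fun h => absurd hn h) ⟨hn, hε, hρ⟩
      (fun t ht => (hpos t ht).2) fun t ht => ?_⟩
    rw [hG t ht]
    simp only [Row.g2, Row1.g]
    ring
  | case7 lam α β γ δ =>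
    obtain ⟨hn, hl, hΔ, hP⟩ := hv
    obtain ⟨κ, hκ, -, hε⟩ := exists_scale (div_ne_zero hl hΔ) hΔ
    refine ⟨.case7 (κ ^ 2 * (lam / (α * δ - β * γ))), hT.exists_row1_of_moebius (κ := κ) _ hΔ
      hP hκ (fun h => absurd hn h) ⟨hn, hε⟩ (fun t ht => mem_univ _) fun t ht => ?_⟩
    rw [hG t ht]
    simp only [Row.g2, Row1.g]
    ring
  | case8 lam α β ρ =>
    obtain ⟨hn, hl, hρ, hα⟩ := hv
    obtain ⟨κ, hκ, -, hε⟩ := exists_scale (div_ne_zero hl hα) hα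
    refine ⟨.case8 (κ ^ 2 * (lam / α)) ρ, hT.exists_row1_of_moebius (α := α) (β := β) (γ := 0)
      (δ := 1) (κ := κ) _ (by simpa using hα) (fun t _ => by simp) hκ (fun h => absurd hn h)
      ⟨hn, hε, hρ⟩ (fun t ht => mem_univ _) fun t ht => ?_⟩
    rw [hG t ht]
    simp [Row.g2, Row1.g]
    ring
  | case9 lam =>
    obtain ⟨hn, hl⟩ := hv
    refine ⟨.case9, hT.exists_row1_of_moebius (α := lam) (β := 0) (γ := 0)
      (δ := 1) (κ := 1) _ (by simpa using hl) (fun t _ => by simp) one_ne_zero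
      (fun h => absurd hn h) hn (fun t ht => mem_univ _) fun t ht => ?_⟩
    rw [hG t ht]
    simp [Row.g2, Row1.g, hl]

theorem Eqn.IsRow1.exists_flip {r : Row1} (hr : E.IsRow1 r) :
    ∃ E' : Eqn, E'.n = E.n ∧ E'.IsRow1 r.flip ∧ E.PointEquiv E' := by
  have hT := E.isGauge_id hr.h_eq_zero
  obtain ⟨hv, hI, hg⟩ := hr
  have hid : r.flip = r → ∃ E' : Eqn, E'.n = E.n ∧ E'.IsRow1 r.flip ∧ E.PointEquiv E' := by
    intro h
    refine hT.exists_row1_of_moebius (α := 1) (β := 0) (γ := 0) (δ := 1) (κ := 1) _ (by simp)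
      (fun t _ => by simp) one_ne_zero (fun _ => ⟨rfl, rfl, by simp⟩) (by rw [h]; exact hv)
      (fun t ht => ?_) fun t ht => ?_
    · rw [h]
      simpa using hI ht
    · rw [h]
      simp [(hg t ht).2]
  cases r with
  | case6 ε ρ =>
    have hpos : ∀ t ∈ E.I, 0 < t := fun t ht => hI ht
    refine hT.exists_row1_of_moebius (α := 0) (β := 1) (γ := 1) (δ := 0) (κ := 1) _ (by simp)
      (fun t ht => by simpa using (hpos t ht).ne') one_ne_zero (fun h => absurd hv.1 h)
      ⟨hv.1, ?_, neg_ne_zero.2 hv.2.2⟩ (fun t ht => ?_) fun t ht => ?_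
    · rcases hv.2.1 with h | h <;> simp [h]
    · simpa [Row1.flip, Row1.tDomain] using hpos t ht
    · rw [(hg t ht).2]
      simp [Row1.g, Row1.flip, Real.inv_rpow (hpos t ht).le, Real.rpow_neg (hpos t ht).le]
  | case8 ε ρ =>
    refine hT.exists_row1_of_moebius (α := -1) (β := 0) (γ := 0) (δ := 1) (κ := 1) _ (by simp)
      (fun t ht => by simp) one_ne_zero (fun h => absurd hv.1 h)
      ⟨hv.1, ?_, neg_ne_zero.2 hv.2.2⟩ (fun t ht => mem_univ _) fun t ht => ?_
    · rcases hv.2.1 with h | h <;> simp [h]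
    · rw [(hg t ht).2]
      simp [Row1.g, Row1.flip, Real.arctan_neg]
  | _ => exact hid rfl

end Reduction

/-! ### Point transformations -/

/-- The derivative of `f` along `(a, b, c)`. -/
def along (f : Pt → ℝ) (P : Pt) (a b c : ℝ) : ℝ := partT f P * a + partX f P * b + partU f P * c

/-- The second derivative of `f` along `(a, b, c)`. -/
def hess (f : Pt → ℝ) (P : Pt) (a b c : ℝ) : ℝ :=
  along (partT f) P a b c * a + along (partX f) P a b c * b + along (partU f) P a b c * c

section SecondOrder

variable {Ω : Set Pt} {f : Pt → ℝ}

/-- A parabola in the space of the variables `(t, x, u)`. -/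
def parabola (t x v a b c k : ℝ) (ρ : ℝ) : Pt :=
  (t + ρ * a, x + ρ * b, v + ρ * c + ρ ^ 2 * k)

theorem parabola_zero (t x v a b c k : ℝ) : parabola t x v a b c k 0 = (t, x, v) := by
  simp [parabola]

theorem hasDerivAt_comp_parabola (hΩ : IsOpen Ω) (hf : ContDiffOn ℝ ∞ f Ω) {t x v a b c k ρ : ℝ}
    (hp : parabola t x v a b c k ρ ∈ Ω) :
    HasDerivAt (fun ρ => f (parabola t x v a b c k ρ))
      (along f (parabola t x v a b c k ρ) a b (c + 2 * ρ * k)) ρ := by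
  have e1 : HasDerivAt (fun ρ => t + ρ * a) a ρ := by
    simpa using ((hasDerivAt_id ρ).mul_const a).const_add t
  have e2 : HasDerivAt (fun ρ => x + ρ * b) b ρ := by
    simpa using ((hasDerivAt_id ρ).mul_const b).const_add x
  have e3 : HasDerivAt (fun ρ => v + ρ * c + ρ ^ 2 * k) (c + 2 * ρ * k) ρ := by
    have := (((hasDerivAt_id ρ).mul_const c).const_add v).add
      (((hasDerivAt_id ρ).pow 2).mul_const k)
    exact this.congr_deriv (by simp)
  exact hasDerivAt_comp_curve hΩ hf hp e1 e2 e3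

theorem continuous_parabola (t x v a b c k : ℝ) : Continuous (parabola t x v a b c k) := by
  unfold parabola
  fun_prop

theorem eventually_parabola_mem (hΩ : IsOpen Ω) {t x v : ℝ} (hp : (t, x, v) ∈ Ω) (a b c k : ℝ) :
    ∀ᶠ ρ in 𝓝 (0 : ℝ), parabola t x v a b c k ρ ∈ Ω := by
  refine (continuous_parabola t x v a b c k).continuousAt.eventually_mem ?_
  rw [parabola_zero]
  exact hΩ.mem_nhds hp

theorem hasDerivAt_along_parabola (hΩ : IsOpen Ω) (hf : ContDiffOn ℝ ∞ f Ω) {t x v a b c k : ℝ}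
    (hp : (t, x, v) ∈ Ω) :
    HasDerivAt (fun ρ => along f (parabola t x v a b c k ρ) a b (c + 2 * ρ * k))
      (hess f (t, x, v) a b c + 2 * k * partU f (t, x, v)) 0 := by
  have hp' : parabola t x v a b c k 0 ∈ Ω := by rwa [parabola_zero]
  have e3 : HasDerivAt (fun ρ => c + 2 * ρ * k) (2 * k) 0 := by
    simpa using (((hasDerivAt_id (0 : ℝ)).const_mul 2).mul_const k).const_add c
  have h := (((hasDerivAt_comp_parabola hΩ (contDiffOn_partT hΩ hf) hp').mul_const a).add
    ((hasDerivAt_comp_parabola hΩ (contDiffOn_partX hΩ hf) hp').mul_const b)).add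
    ((hasDerivAt_comp_parabola hΩ (contDiffOn_partU hΩ hf) hp').mul e3)
  refine h.congr_deriv ?_
  simp only [parabola_zero, hess]
  ring_nf

theorem parabola_eq_lift_jet (t x v p q r e a b ρ : ℝ) :
    parabola t x v a b (p * a + q * b) (r / 2 * b ^ 2 + e * a ^ 2) ρ
      = lift (jet t x v p q r 0 e) (t + ρ * a) (x + ρ * b) := by
  simp only [parabola, lift, jet, Prod.mk.injEq, true_and]
  ring

end SecondOrder

section Transformation

variable {E E' : Eqn} {Ω : Set Pt} {Φ : Pt → Pt}

theorem Eqn.IsPointTransformation.mono (hΦ : E.IsPointTransformation E' Ω Φ) {Ω' : Set Pt}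
    (h : Ω' ⊆ Ω) (ho : IsOpen Ω') : E.IsPointTransformation E' Ω' Φ :=
  ⟨ho, h.trans hΦ.subset, hΦ.mapsTo.mono_left h, hΦ.smooth.mono h,
    fun p hp => hΦ.jacobian_ne_zero p (h hp),
    fun u v t x hl => hΦ.holdsAt_iff u v t x (h hl)⟩

/-- The rows of the Jacobian matrix are linearly independent. -/
theorem Eqn.IsPointTransformation.row_independent (hΦ : E.IsPointTransformation E' Ω Φ) {P : Pt}
    (hP : P ∈ Ω) {a b c : ℝ}
    (hT : a * partT (coeffT Φ) P + b * partT (coeffX Φ) P + c * partT (coeffU Φ) P = 0)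
    (hX : a * partX (coeffT Φ) P + b * partX (coeffX Φ) P + c * partX (coeffU Φ) P = 0)
    (hU : a * partU (coeffT Φ) P + b * partU (coeffX Φ) P + c * partU (coeffU Φ) P = 0) :
    a = 0 ∧ b = 0 ∧ c = 0 := by
  have hd : HasFDerivAt Φ (fderiv ℝ Φ P) P :=
    ((hΦ.smooth.contDiffAt (hΦ.isOpen.mem_nhds hP)).differentiableAt (by simp)).hasFDerivAt
  have hsurj : Function.Surjective (fderiv ℝ Φ P) := by
    have h1 := (LinearMap.isUnit_iff_isUnit_det _).2 (isUnit_iff_ne_zero.2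
      (hΦ.jacobian_ne_zero P hP))
    exact LinearMap.range_eq_top.1 ((LinearMap.isUnit_iff_range_eq_top _).1 h1)
  have hc1 : ∀ w, fderiv ℝ (coeffT Φ) P w = (fderiv ℝ Φ P w).1 := fun w => by
    rw [show fderiv ℝ (coeffT Φ) P = _ from hd.fst.fderiv]; rfl
  have hc2 : ∀ w, fderiv ℝ (coeffX Φ) P w = (fderiv ℝ Φ P w).2.1 := fun w => by
    rw [show fderiv ℝ (coeffX Φ) P = _ from hd.snd.fst.fderiv]; rfl
  have hc3 : ∀ w, fderiv ℝ (coeffU Φ) P w = (fderiv ℝ Φ P w).2.2 := fun w => by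
    rw [show fderiv ℝ (coeffU Φ) P = _ from hd.snd.snd.fderiv]; rfl
  have key : ∀ z : Pt, a * z.1 + b * z.2.1 + c * z.2.2 = 0 := by
    intro z
    obtain ⟨⟨w1, w2, w3⟩, rfl⟩ := hsurj z
    rw [← hc1, ← hc2, ← hc3, fderiv_apply_eq, fderiv_apply_eq, fderiv_apply_eq]
    linear_combination w1 * hT + w2 * hX + w3 * hU
  exact ⟨by simpa using key (1, 0, 0), by simpa using key (0, 1, 0), by simpa using key (0, 0, 1)⟩

/-- The prolongation of a point transformation to second-order jets, for jets that satisfy the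
equation: `vt`, `vx`, `vxx` are derivatives of the transformed function. -/
theorem Eqn.IsPointTransformation.jet_identity (hΦ : E.IsPointTransformation E' Ω Φ)
    {t x v p q r : ℝ} (hp : (t, x, v) ∈ Ω) (e : ℝ)
    (heq : p + v ^ E.n * q + E.h t * v = E.g t * r) {Θt Θx Ξt Ξx : ℝ}
    (hΘt : Θt = along (coeffT Φ) (t, x, v) 1 0 p) (hΘx : Θx = along (coeffT Φ) (t, x, v) 0 1 q)
    (hΞt : Ξt = along (coeffX Φ) (t, x, v) 1 0 p) (hΞx : Ξx = along (coeffX Φ) (t, x, v) 0 1 q)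
    (hdet : Θt * Ξx - Θx * Ξt ≠ 0) :
    ∃ vt vx vxx : ℝ,
      along (coeffU Φ) (t, x, v) 1 0 p = vt * Θt + vx * Ξt ∧
      along (coeffU Φ) (t, x, v) 0 1 q = vt * Θx + vx * Ξx ∧
      vt + coeffU Φ (t, x, v) ^ E'.n * vx + E'.h (coeffT Φ (t, x, v)) * coeffU Φ (t, x, v)
        = E'.g (coeffT Φ (t, x, v)) * vxx ∧
      hess (coeffU Φ) (t, x, v) (-Θx) Θt (p * (-Θx) + q * Θt)
          + 2 * (r / 2 * Θt ^ 2 + e * (-Θx) ^ 2) * partU (coeffU Φ) (t, x, v)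
        = vxx * (Θt * Ξx - Θx * Ξt) ^ 2
          + vt * (hess (coeffT Φ) (t, x, v) (-Θx) Θt (p * (-Θx) + q * Θt)
            + 2 * (r / 2 * Θt ^ 2 + e * (-Θx) ^ 2) * partU (coeffT Φ) (t, x, v))
          + vx * (hess (coeffX Φ) (t, x, v) (-Θx) Θt (p * (-Θx) + q * Θt)
            + 2 * (r / 2 * Θt ^ 2 + e * (-Θx) ^ 2) * partU (coeffX Φ) (t, x, v)) := by
  have hΩ := hΦ.isOpen
  have sT := contDiffOn_coeffT hΦ.smooth
  have sX := contDiffOn_coeffX hΦ.smooth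
  have sU := contDiffOn_coeffU hΦ.smooth
  set u := jet t x v p q r 0 e with hu_def
  have hu : SmoothAt u t x := smoothAt_jet t x v p q r 0 e t x
  have hl : lift u t x = (t, x, v) := lift_jet_base ..
  have hlm : lift u t x ∈ Ω := by rwa [hl]
  have sl : ContDiffAt ℝ ∞ (fun z : ℝ × ℝ => lift u z.1 z.2) (t, x) :=
    contDiffAt_fst.prodMk (contDiffAt_snd.prodMk hu)
  have hcomp : ∀ f : Pt → ℝ, ContDiffOn ℝ ∞ f Ω →
      ContDiffAt ℝ ∞ (fun z : ℝ × ℝ => f (lift u z.1 z.2)) (t, x) := fun f hf =>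
    ContDiffAt.comp (g := f) (t, x) (hf.contDiffAt (hΩ.mem_nhds hlm)) sl
  have sF : ContDiffAt ℝ ∞ (fun z : ℝ × ℝ =>
      (coeffT Φ (lift u z.1 z.2), coeffX Φ (lift u z.1 z.2))) (t, x) :=
    (hcomp _ sT).prodMk (hcomp _ sX)
  set F : ℝ × ℝ → ℝ × ℝ := fun z => (coeffT Φ (lift u z.1 z.2), coeffX Φ (lift u z.1 z.2))
    with hF
  have hFd : HasFDerivAt F (fderiv ℝ F (t, x)) (t, x) :=
    (sF.differentiableAt (by simp)).hasFDerivAt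
  have tT : ∀ f : Pt → ℝ, totalT f u t x = along f (t, x, v) 1 0 p := fun f => by
    simp [totalT, along, hu_def]
  have tX : ∀ f : Pt → ℝ, totalX f u t x = along f (t, x, v) 0 1 q := fun f => by
    simp [totalX, along, hu_def]
  have hF1 : fderiv ℝ F (t, x) (1, 0) = (Θt, Ξt) := by
    have d1 := hFd.comp_hasDerivAt (f := fun s : ℝ => (s, x)) t
      ((hasDerivAt_id t).prodMk (hasDerivAt_const t x))
    have d2 := (hasDerivAt_totalT hΩ sT hu hlm).prodMk (hasDerivAt_totalT hΩ sX hu hlm)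
    rw [tT, tT, ← hΘt, ← hΞt] at d2
    exact d1.unique d2
  have hF2 : fderiv ℝ F (t, x) (0, 1) = (Θx, Ξx) := by
    have d1 := hFd.comp_hasDerivAt (f := fun y : ℝ => (t, y)) x
      ((hasDerivAt_const x t).prodMk (hasDerivAt_id x))
    have d2 := (hasDerivAt_totalX hΩ sT hu hlm).prodMk (hasDerivAt_totalX hΩ sX hu hlm)
    rw [tX, tX, ← hΘx, ← hΞx] at d2
    exact d1.unique d2
  have hF' : ∀ a b, fderiv ℝ F (t, x) (a, b) = (a * Θt + b * Θx, a * Ξt + b * Ξx) := by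
    intro a b
    have : ((a, b) : ℝ × ℝ) = a • (1, 0) + b • (0, 1) := by simp
    rw [this, map_add, map_smul, map_smul, hF1, hF2]
    simp
  have hinj : Function.Injective (fderiv ℝ F (t, x) : ℝ × ℝ →ₗ[ℝ] ℝ × ℝ) := by
    refine (injective_iff_map_eq_zero _).2 ?_
    rintro ⟨a, b⟩ hab
    have hab' : fderiv ℝ F (t, x) (a, b) = 0 := hab
    rw [hF'] at hab'
    simp only [Prod.mk_eq_zero] at hab'
    obtain ⟨h1, h2⟩ := hab'
    have ha : a = 0 := (mul_eq_zero.1 (show a * (Θt * Ξx - Θx * Ξt) = 0 by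
      linear_combination Ξx * h1 - Θx * h2)).resolve_right hdet
    have hb : b = 0 := (mul_eq_zero.1 (show b * (Θt * Ξx - Θx * Ξt) = 0 by
      linear_combination Θt * h2 - Ξt * h1)).resolve_right hdet
    rw [ha, hb]
    rfl
  have hequiv : ((LinearEquiv.ofInjectiveEndo _ hinj).toContinuousLinearEquiv
      : ℝ × ℝ →L[ℝ] ℝ × ℝ) = fderiv ℝ F (t, x) := ContinuousLinearMap.ext fun _ => rfl
  obtain ⟨S, hS, hSa, hS1, -⟩ := exists_local_inverse sF
    (LinearEquiv.ofInjectiveEndo _ hinj).toContinuousLinearEquiv (by rw [hequiv]; exact hFd)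
  have hFtx : F (t, x) = (coeffT Φ (t, x, v), coeffX Φ (t, x, v)) := by
    simp only [hF, hl]
  set w : ℝ → ℝ → ℝ := fun s y => coeffU Φ (lift u (S (s, y)).1 (S (s, y)).2) with hw
  have sw : SmoothAt w (coeffT Φ (t, x, v)) (coeffX Φ (t, x, v)) := by
    have h1 : ContDiffAt ℝ ∞ (fun z : ℝ × ℝ => coeffU Φ (lift u z.1 z.2)) (S (F (t, x))) := by
      rw [hSa]
      exact hcomp _ sU
    have h2 := h1.comp (F (t, x)) hS
    rw [hFtx] at h2
    exact h2
  have hev : ∀ᶠ z : ℝ × ℝ in 𝓝 (t, x), coeffU Φ (lift u z.1 z.2)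
      = w (coeffT Φ (lift u z.1 z.2)) (coeffX Φ (lift u z.1 z.2)) := by
    filter_upwards [hS1] with z hz
    change _ = coeffU Φ (lift u (S (F z)).1 (S (F z)).2)
    rw [hz]
  have hE : E'.HoldsAt w (coeffT Φ (t, x, v)) (coeffX Φ (t, x, v)) := by
    have := (hΦ.holdsAt_iff u w t x hlm hu (by rw [hl]; exact sw) hev).1 ((holdsAt_jet ..).2 heq)
    rwa [hl] at this
  have hw0 : w (coeffT Φ (t, x, v)) (coeffX Φ (t, x, v)) = coeffU Φ (t, x, v) := by
    have := hev.self_of_nhds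
    simp only [hl] at this
    exact this.symm
  refine ⟨dt w (coeffT Φ (t, x, v)) (coeffX Φ (t, x, v)),
    dx w (coeffT Φ (t, x, v)) (coeffX Φ (t, x, v)),
    dx (dx w) (coeffT Φ (t, x, v)) (coeffX Φ (t, x, v)), ?_, ?_, ?_, ?_⟩
  · have hc : ContinuousAt (fun s : ℝ => (s, x)) t := by fun_prop
    have d1 := hasDerivAt_totalT hΩ sU hu hlm
    have d2 := hasDerivAt_comp_plane_curve (u := w) (a := fun s => coeffT Φ (lift u s x))
      (b := fun s => coeffX Φ (lift u s x)) (s := t) (by rw [hl]; exact sw.differentiableAt)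
      (hasDerivAt_totalT hΩ sT hu hlm) (hasDerivAt_totalT hΩ sX hu hlm)
    have := d1.unique (d2.congr_of_eventuallyEq (hc.eventually hev))
    rwa [tT, tT, tT, ← hΘt, ← hΞt, hl] at this
  · have hc : ContinuousAt (fun y : ℝ => (t, y)) x := by fun_prop
    have d1 := hasDerivAt_totalX hΩ sU hu hlm
    have d2 := hasDerivAt_comp_plane_curve (u := w) (a := fun y => coeffT Φ (lift u t y))
      (b := fun y => coeffX Φ (lift u t y)) (s := x) (by rw [hl]; exact sw.differentiableAt)
      (hasDerivAt_totalX hΩ sT hu hlm) (hasDerivAt_totalX hΩ sX hu hlm)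
    have := d1.unique (d2.congr_of_eventuallyEq (hc.eventually hev))
    rwa [tX, tX, tX, ← hΘx, ← hΞx, hl] at this
  · have := hE
    unfold Eqn.HoldsAt at this
    rwa [hw0] at this
  · set c : ℝ → Pt := parabola t x v (-Θx) Θt (p * (-Θx) + q * Θt)
      (r / 2 * Θt ^ 2 + e * (-Θx) ^ 2) with hc_def
    have hc0 : c 0 = (t, x, v) := parabola_zero ..
    have hcl : ∀ ρ, c ρ = lift u (t + ρ * (-Θx)) (x + ρ * Θt) := fun ρ =>
      parabola_eq_lift_jet ..
    have hcc : Continuous c := continuous_parabola ..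
    have hcm := eventually_parabola_mem hΩ hp (-Θx) Θt (p * (-Θx) + q * Θt)
      (r / 2 * Θt ^ 2 + e * (-Θx) ^ 2)
    have hcev : ∀ᶠ ρ in 𝓝 (0 : ℝ), coeffU Φ (c ρ) = w (coeffT Φ (c ρ)) (coeffX Φ (c ρ)) := by
      have hcont : ContinuousAt (fun ρ : ℝ => (t + ρ * (-Θx), x + ρ * Θt)) 0 := by fun_prop
      have hev' : ∀ᶠ z : ℝ × ℝ in 𝓝 (t + 0 * (-Θx), x + 0 * Θt), coeffU Φ (lift u z.1 z.2)
          = w (coeffT Φ (lift u z.1 z.2)) (coeffX Φ (lift u z.1 z.2)) := by simpa using hev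
      filter_upwards [hcont.eventually hev'] with ρ hρ
      rw [hcl]
      exact hρ
    have hdiff : ∀ᶠ ρ in 𝓝 (0 : ℝ), DifferentiableAt ℝ (fun z : ℝ × ℝ => w z.1 z.2)
        (coeffT Φ (c ρ), coeffX Φ (c ρ)) := by
      have hcont : ContinuousAt (fun ρ => (coeffT Φ (c ρ), coeffX Φ (c ρ))) 0 := by
        have hm : c 0 ∈ Ω := by rwa [hc0]
        exact (hasDerivAt_comp_parabola hΩ sT hm).continuousAt.prodMk
          (hasDerivAt_comp_parabola hΩ sX hm).continuousAt
      refine hcont.eventually (p := fun z => DifferentiableAt ℝ (fun z : ℝ × ℝ => w z.1 z.2) z) ?_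
      simp only [hc0]
      exact sw.eventually_differentiableAt
    have hev1 : ∀ᶠ ρ in 𝓝 (0 : ℝ),
        along (coeffU Φ) (c ρ) (-Θx) Θt (p * (-Θx) + q * Θt
          + 2 * ρ * (r / 2 * Θt ^ 2 + e * (-Θx) ^ 2))
        = dt w (coeffT Φ (c ρ)) (coeffX Φ (c ρ)) * along (coeffT Φ) (c ρ) (-Θx) Θt
            (p * (-Θx) + q * Θt + 2 * ρ * (r / 2 * Θt ^ 2 + e * (-Θx) ^ 2))
          + dx w (coeffT Φ (c ρ)) (coeffX Φ (c ρ)) * along (coeffX Φ) (c ρ) (-Θx) Θt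
            (p * (-Θx) + q * Θt + 2 * ρ * (r / 2 * Θt ^ 2 + e * (-Θx) ^ 2)) := by
      filter_upwards [hcev.eventually_nhds, hcm, hdiff] with ρ h1 h2 h3
      have d2 := hasDerivAt_comp_plane_curve (u := w) (a := fun ρ => coeffT Φ (c ρ))
        (b := fun ρ => coeffX Φ (c ρ)) (s := ρ) h3
        (hasDerivAt_comp_parabola hΩ sT h2) (hasDerivAt_comp_parabola hΩ sX h2)
      exact (hasDerivAt_comp_parabola hΩ sU h2).unique (d2.congr_of_eventuallyEq h1)
    have hm : c 0 ∈ Ω := by rwa [hc0]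
    have a1 : along (coeffT Φ) (t, x, v) (-Θx) Θt (p * (-Θx) + q * Θt + 2 * 0 *
        (r / 2 * Θt ^ 2 + e * (-Θx) ^ 2)) = 0 := by
      rw [hΘt, hΘx]
      simp only [along]
      ring
    have a2 : along (coeffX Φ) (t, x, v) (-Θx) Θt (p * (-Θx) + q * Θt + 2 * 0 *
        (r / 2 * Θt ^ 2 + e * (-Θx) ^ 2)) = Θt * Ξx - Θx * Ξt := by
      rw [hΞt, hΞx]
      simp only [along]
      ring
    have dT := hasDerivAt_comp_parabola hΩ sT hm
    have dX := hasDerivAt_comp_parabola hΩ sX hm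
    rw [show parabola t x v (-Θx) Θt (p * (-Θx) + q * Θt) (r / 2 * Θt ^ 2 + e * (-Θx) ^ 2) 0
      = (t, x, v) from hc0] at dT dX
    rw [a1] at dT
    rw [a2] at dX
    have d3 := hasDerivAt_comp_plane_curve (u := dt w) (a := fun ρ => coeffT Φ (c ρ))
      (b := fun ρ => coeffX Φ (c ρ)) (s := 0) (by rw [hc0]; exact sw.dt.differentiableAt) dT dX
    have d4 := hasDerivAt_comp_plane_curve (u := dx w) (a := fun ρ => coeffT Φ (c ρ))
      (b := fun ρ => coeffX Φ (c ρ)) (s := 0) (by rw [hc0]; exact sw.dx.differentiableAt) dT dX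
    have d5 := (d3.mul (hasDerivAt_along_parabola hΩ sT (a := -Θx) (b := Θt)
      (c := p * (-Θx) + q * Θt) (k := r / 2 * Θt ^ 2 + e * (-Θx) ^ 2) hp)).add
      (d4.mul (hasDerivAt_along_parabola hΩ sX (a := -Θx) (b := Θt)
      (c := p * (-Θx) + q * Θt) (k := r / 2 * Θt ^ 2 + e * (-Θx) ^ 2) hp))
    have := (hasDerivAt_along_parabola hΩ sU (a := -Θx) (b := Θt)
      (c := p * (-Θx) + q * Θt) (k := r / 2 * Θt ^ 2 + e * (-Θx) ^ 2) hp).unique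
      (d5.congr_of_eventuallyEq hev1)
    rw [this]
    simp only [parabola_zero, hc0, a1, a2]
    ring

end Transformation

theorem eq_zero_of_affine_mul {A B C a b : ℝ} (h : ∀ p q : ℝ, A + q * B + p * C ≠ 0 → a + q * b = 0)
    (h0 : ¬(A = 0 ∧ B = 0 ∧ C = 0)) : a = 0 ∧ b = 0 := by
  have h' : ∀ p q : ℝ, (A + q * B + p * C) * (a + q * b) = 0 := fun p q => by
    by_cases hz : A + q * B + p * C = 0
    · rw [hz, zero_mul]
    · rw [h p q hz, mul_zero]
  have e0 := h' 0 0
  have e1 := h' 0 1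
  have e2 := h' 0 (-1)
  have e3 := h' 1 0
  have e4 := h' 1 1
  by_cases hC : C = 0
  · subst hC
    have f1 : A * a = 0 := by linarith
    have f2 : B * b = 0 := by linarith
    have f3 : A * b + B * a = 0 := by linarith
    by_cases hA : A = 0
    · subst hA
      have hB : B ≠ 0 := fun hB => h0 ⟨rfl, hB, rfl⟩
      exact ⟨by simpa [hB] using f3, by simpa [hB] using f2⟩
    · have ha : a = 0 := by simpa [hA] using f1
      subst ha
      exact ⟨rfl, by simpa [hA] using f3⟩
  · have f1 : C * a = 0 := by linarith
    have f2 : C * (a + b) = 0 := by linarith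
    have ha : a = 0 := by simpa [hC] using f1
    subst ha
    exact ⟨rfl, by simpa [hC] using f2⟩

/-- A linear function whose square is the same wherever it is not zero is constant. -/
theorem eq_zero_of_sq_eq {X V c : ℝ} (h : ∀ q : ℝ, X + q * V ≠ 0 → (X + q * V) ^ 2 = c) :
    V = 0 := by
  by_contra hV
  have e : ∀ y : ℝ, X + (y - X) / V * V = y := fun y => by field_simp; ring
  have h1 := h ((1 - X) / V) (by rw [e]; norm_num)
  have h2 := h ((2 - X) / V) (by rw [e]; norm_num)
  rw [e] at h1 h2
  linarith

section Transformation

variable {E E' : Eqn} {Ω : Set Pt} {Φ : Pt → Pt}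

theorem Eqn.IsPointTransformation.g_ne_zero (hΦ : E.IsPointTransformation E' Ω Φ) {P : Pt}
    (hP : P ∈ Ω) : E.g P.1 ≠ 0 := E.g_ne_zero _ (hΦ.subset hP).1

theorem Eqn.IsPointTransformation.g_target_ne_zero (hΦ : E.IsPointTransformation E' Ω Φ) {P : Pt}
    (hP : P ∈ Ω) : E'.g (coeffT Φ P) ≠ 0 := E'.g_ne_zero _ (hΦ.mapsTo hP).1

theorem Eqn.IsPointTransformation.partXU_coeffT (hΦ : E.IsPointTransformation E' Ω Φ) {P : Pt}
    (hP : P ∈ Ω) : partX (coeffT Φ) P = 0 ∧ partU (coeffT Φ) P = 0 := by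
  obtain ⟨t, x, v⟩ := P
  have hg : E.g t ≠ 0 := hΦ.g_ne_zero hP
  have hg' := hΦ.g_target_ne_zero hP
  have hrow := @Eqn.IsPointTransformation.row_independent _ _ _ _ hΦ _ hP
  have hjet := @Eqn.IsPointTransformation.jet_identity _ _ _ _ hΦ t x v
  simp only [along, mul_one, mul_zero, add_zero, zero_add] at hjet
  generalize partT (coeffT Φ) (t, x, v) = Θt at *
  generalize partX (coeffT Φ) (t, x, v) = Θx at *
  generalize partU (coeffT Φ) (t, x, v) = Θu at *
  generalize partT (coeffX Φ) (t, x, v) = Ξt at *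
  generalize partX (coeffX Φ) (t, x, v) = Ξx at *
  generalize partU (coeffX Φ) (t, x, v) = Ξu at *
  generalize partT (coeffU Φ) (t, x, v) = Yt at *
  generalize partX (coeffU Φ) (t, x, v) = Yx at *
  generalize partU (coeffU Φ) (t, x, v) = Yu at *
  refine eq_zero_of_affine_mul (A := Θt * Ξx - Θx * Ξt) (B := Θt * Ξu - Θu * Ξt)
    (C := Θu * Ξx - Θx * Ξu) (fun p q hne => ?_) ?_
  · have heq : p + v ^ E.n * q + E.h t * v = E.g t * ((p + v ^ E.n * q + E.h t * v) / E.g t) := by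
      field_simp
    have hdet : (Θt + Θu * p) * (Ξx + Ξu * q) - (Θx + Θu * q) * (Ξt + Ξu * p) ≠ 0 := by
      convert hne using 1
      ring
    obtain ⟨a, b, c, h1, h2, h3, h4⟩ := hjet hP 0 heq rfl rfl rfl rfl hdet
    obtain ⟨a', b', c', h1', h2', h3', h4'⟩ := hjet hP 1 heq rfl rfl rfl rfl hdet
    have ea : a' = a := by
      refine mul_right_cancel₀ hdet ?_
      linear_combination (Ξx + Ξu * q) * (h1 - h1') - (Ξt + Ξu * p) * (h2 - h2')
    subst ea
    have eb : b' = b := by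
      refine mul_right_cancel₀ hdet ?_
      linear_combination (Θt + Θu * p) * (h2 - h2') - (Θx + Θu * q) * (h1 - h1')
    subst eb
    have ec : c' = c := mul_left_cancel₀ hg' (h3'.symm.trans h3)
    subst ec
    by_contra hΘ
    have hκ : Yu - a' * Θu - b' * Ξu = 0 := by
      refine (mul_eq_zero.1 (show (Θx + q * Θu) ^ 2 * (Yu - a' * Θu - b' * Ξu) = 0 by
        linear_combination (h4' - h4) / 2)).resolve_left (pow_ne_zero 2 hΘ)
    have := (hrow (a := a') (b := b') (c := -1) (by linear_combination p * hκ - h1)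
      (by linear_combination q * hκ - h2) (by linear_combination -hκ)).2.2
    norm_num at this
  · rintro ⟨hA, hB, hC⟩
    obtain ⟨f1, f2, -⟩ := hrow (a := Ξx) (b := -Θx) (c := 0) (by linear_combination hA) (by ring)
      (by linear_combination hC)
    obtain ⟨f3, f4, -⟩ := hrow (a := Ξt) (b := -Θt) (c := 0) (by ring) (by linear_combination -hA)
      (by linear_combination -hB)
    obtain ⟨f5, f6, -⟩ := hrow (a := Ξu) (b := -Θu) (c := 0) (by linear_combination hB)
      (by linear_combination -hC) (by ring)
    have := (hrow (a := 1) (b := 0) (c := 0) (by linear_combination -f4) (by linear_combination -f2)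
      (by linear_combination -f6)).1
    norm_num at this

theorem Eqn.IsPointTransformation.partT_coeffT_ne_zero (hΦ : E.IsPointTransformation E' Ω Φ)
    {P : Pt} (hP : P ∈ Ω) : partT (coeffT Φ) P ≠ 0 := by
  intro h
  obtain ⟨h1, h2⟩ := hΦ.partXU_coeffT hP
  have := (hΦ.row_independent hP (a := 1) (b := 0) (c := 0) (by simp [h]) (by simp [h1])
    (by simp [h2])).1
  norm_num at this

/-- The form of `jet_identity` with the knowledge that the `t`-component depends on `t` only. -/
theorem Eqn.IsPointTransformation.reduced_identity (hΦ : E.IsPointTransformation E' Ω Φ)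
    {t x v q r : ℝ} (hP : (t, x, v) ∈ Ω)
    (hne : partX (coeffX Φ) (t, x, v) + partU (coeffX Φ) (t, x, v) * q ≠ 0) :
    ∃ b : ℝ, partX (coeffU Φ) (t, x, v) + partU (coeffU Φ) (t, x, v) * q
        = b * (partX (coeffX Φ) (t, x, v) + partU (coeffX Φ) (t, x, v) * q) ∧
      partU (coeffU Φ) (t, x, v) - b * partU (coeffX Φ) (t, x, v) ≠ 0 ∧
      E'.g (coeffT Φ (t, x, v)) * partT (coeffT Φ) (t, x, v) *
        (hess (coeffU Φ) (t, x, v) 0 1 q + r * partU (coeffU Φ) (t, x, v)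
          - b * (hess (coeffX Φ) (t, x, v) 0 1 q + r * partU (coeffX Φ) (t, x, v)))
      = (partX (coeffX Φ) (t, x, v) + partU (coeffX Φ) (t, x, v) * q) ^ 2 *
        (partT (coeffU Φ) (t, x, v)
          + partU (coeffU Φ) (t, x, v) * (E.g t * r - v ^ E.n * q - E.h t * v)
          - b * (partT (coeffX Φ) (t, x, v)
            + partU (coeffX Φ) (t, x, v) * (E.g t * r - v ^ E.n * q - E.h t * v))
          + partT (coeffT Φ) (t, x, v) * (coeffU Φ (t, x, v) ^ E'.n * b
            + E'.h (coeffT Φ (t, x, v)) * coeffU Φ (t, x, v))) := by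
  have hrow := @Eqn.IsPointTransformation.row_independent _ _ _ _ hΦ _ hP
  have hjet := @Eqn.IsPointTransformation.jet_identity _ _ _ _ hΦ t x v
    (E.g t * r - v ^ E.n * q - E.h t * v) q r hP 0 (by ring) _ _ _ _ rfl rfl rfl rfl
  have hΩ := hΦ.isOpen
  have hxx := partX_eq_zero hΩ (fun P hP => (hΦ.partXU_coeffT hP).1) _ hP
  have hux := partU_eq_zero hΩ (fun P hP => (hΦ.partXU_coeffT hP).1) _ hP
  have hxu := partX_eq_zero hΩ (fun P hP => (hΦ.partXU_coeffT hP).2) _ hP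
  have huu := partU_eq_zero hΩ (fun P hP => (hΦ.partXU_coeffT hP).2) _ hP
  obtain ⟨hx, hu⟩ := hΦ.partXU_coeffT hP
  have ht := hΦ.partT_coeffT_ne_zero hP
  simp only [along, hess, mul_one, mul_zero, add_zero, zero_add, zero_mul, neg_zero, hx, hu, hxx,
    hux, hxu, huu, sub_zero] at hjet hrow ⊢
  obtain ⟨a, b, c, h1, h2, h3, h4⟩ := hjet (mul_ne_zero ht hne)
  refine ⟨b, h2, fun hκ => ?_, ?_⟩
  · have := (hrow (a := a) (b := b) (c := -1)
      (by linear_combination (E.g t * r - v ^ E.n * q - E.h t * v) * hκ - h1)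
      (by linear_combination q * hκ - h2) (by linear_combination -hκ)).2.2
    norm_num at this
  · refine mul_left_cancel₀ (pow_ne_zero 2 ht) ?_
    linear_combination E'.g (coeffT Φ (t, x, v)) * partT (coeffT Φ) (t, x, v) * h4
      - partT (coeffT Φ) (t, x, v) ^ 3
        * (partX (coeffX Φ) (t, x, v) + partU (coeffX Φ) (t, x, v) * q) ^ 2 * h3
      - partT (coeffT Φ) (t, x, v) ^ 2
        * (partX (coeffX Φ) (t, x, v) + partU (coeffX Φ) (t, x, v) * q) ^ 2 * h1

theorem Eqn.IsPointTransformation.sq_eq (hΦ : E.IsPointTransformation E' Ω Φ)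
    {t x v q : ℝ} (hP : (t, x, v) ∈ Ω)
    (hne : partX (coeffX Φ) (t, x, v) + q * partU (coeffX Φ) (t, x, v) ≠ 0) :
    (partX (coeffX Φ) (t, x, v) + q * partU (coeffX Φ) (t, x, v)) ^ 2
      = E'.g (coeffT Φ (t, x, v)) * partT (coeffT Φ) (t, x, v) / E.g t := by
  rw [mul_comm q] at hne ⊢
  obtain ⟨b, h1, h2, h3⟩ := hΦ.reduced_identity (r := 0) hP hne
  obtain ⟨b', h1', h2', h3'⟩ := hΦ.reduced_identity (r := 1) hP hne
  obtain rfl : b' = b := mul_right_cancel₀ hne (h1'.symm.trans h1)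
  rw [eq_div_iff (hΦ.g_ne_zero hP)]
  refine mul_right_cancel₀ h2 ?_
  linear_combination h3 - h3'

theorem Eqn.IsPointTransformation.partU_coeffX (hΦ : E.IsPointTransformation E' Ω Φ) {P : Pt}
    (hP : P ∈ Ω) : partU (coeffX Φ) P = 0 := by
  obtain ⟨t, x, v⟩ := P
  exact eq_zero_of_sq_eq fun q hne => hΦ.sq_eq hP hne

theorem Eqn.IsPointTransformation.partX_coeffX_ne_zero (hΦ : E.IsPointTransformation E' Ω Φ)
    {P : Pt} (hP : P ∈ Ω) : partX (coeffX Φ) P ≠ 0 := by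
  intro h
  obtain ⟨h1, h2⟩ := hΦ.partXU_coeffT hP
  have h3 := hΦ.partU_coeffX hP
  have := (hΦ.row_independent hP (a := partT (coeffX Φ) P) (b := -partT (coeffT Φ) P) (c := 0)
    (by ring) (by simp [h, h1]) (by simp [h2, h3])).2.1
  exact hΦ.partT_coeffT_ne_zero hP (neg_eq_zero.1 this)

theorem Eqn.IsPointTransformation.g_eq (hΦ : E.IsPointTransformation E' Ω Φ) {t x v : ℝ}
    (hP : (t, x, v) ∈ Ω) : E'.g (coeffT Φ (t, x, v)) * partT (coeffT Φ) (t, x, v)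
      = E.g t * partX (coeffX Φ) (t, x, v) ^ 2 := by
  have hg : E.g t ≠ 0 := hΦ.g_ne_zero hP
  have := hΦ.sq_eq (q := 0) hP (by simpa using hΦ.partX_coeffX_ne_zero hP)
  rw [zero_mul, add_zero] at this
  rw [this]
  field_simp


end Transformation

theorem hasDerivAt_rpow_sub_one {f : ℝ → ℝ} {f' x p : ℝ} (hf : HasDerivAt f f' x)
    (h : f x ≠ 0 ∨ p = 1) :
    HasDerivAt (fun y => f y ^ (p - 1)) ((p - 1) * f x ^ (p - 2) * f') x := by
  rcases h with h | rfl
  · refine (hf.rpow_const (p := p - 1) (Or.inl h)).congr_deriv ?_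
    rw [show p - 1 - 1 = p - 2 by ring]
    ring
  · simpa using hasDerivAt_const x (1 : ℝ)

theorem Eqn.ne_zero_or_of_mem_U {E : Eqn} {u : ℝ} (hu : u ∈ E.U) : u ≠ 0 ∨ E.n = 1 := by
  by_cases h : E.n = 1
  · exact Or.inr h
  · exact Or.inl (Eqn.pos_of_mem_U h hu).ne'

theorem hasDerivAt_rpow_of_mem_U {E : Eqn} {f : ℝ → ℝ} {f' x : ℝ} (hf : HasDerivAt f f' x)
    (h : f x ∈ E.U) :
    HasDerivAt (fun y => f y ^ E.n) (E.n * f x ^ (E.n - 1) * f') x := by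
  refine (hf.rpow_const (p := E.n) ?_).congr_deriv (by ring)
  exact (Eqn.ne_zero_or_of_mem_U h).imp_right fun h => h.ge

section Transformation

variable {E E' : Eqn} {Ω : Set Pt} {Φ : Pt → Pt}

theorem Eqn.IsPointTransformation.partU_coeffU_ne_zero (hΦ : E.IsPointTransformation E' Ω Φ)
    {P : Pt} (hP : P ∈ Ω) : partU (coeffU Φ) P ≠ 0 := by
  obtain ⟨t, x, v⟩ := P
  obtain ⟨b, -, h, -⟩ := hΦ.reduced_identity (q := 0) (r := 0) hP
    (by simpa using hΦ.partX_coeffX_ne_zero hP)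
  rwa [hΦ.partU_coeffX hP, mul_zero, sub_zero] at h

theorem Eqn.IsPointTransformation.partX_partX_coeffX (hΦ : E.IsPointTransformation E' Ω Φ)
    {P : Pt} (hP : P ∈ Ω) : partX (partX (coeffX Φ)) P = 0 := by
  obtain ⟨t, x, v⟩ := P
  have hΩ := hΦ.isOpen
  have sT := contDiffOn_coeffT hΦ.smooth
  have sX := contDiffOn_coeffX hΦ.smooth
  have hg : E.g t ≠ 0 := hΦ.g_ne_zero hP
  have d1 := ((E'.hasDerivAt_g (hΦ.mapsTo hP).1).comp x (hasDerivAt_partX hΩ sT hP)).mul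
    (hasDerivAt_partX hΩ (contDiffOn_partT hΩ sT) hP)
  have d2 := ((hasDerivAt_partX hΩ (contDiffOn_partX hΩ sX) hP).pow 2).const_mul (E.g t)
  have h := derivX_unique hΩ (f := fun P => E'.g (coeffT Φ P) * partT (coeffT Φ) P)
    (g := fun P => E.g P.1 * partX (coeffX Φ) P ^ 2) (fun P hP => hΦ.g_eq hP) hP d1 d2
  rw [partX_partT hΩ sT hP, partT_eq_zero hΩ (fun P hP => (hΦ.partXU_coeffT hP).1) _ hP,
    (hΦ.partXU_coeffT hP).1] at h
  simpa [hg, hΦ.partX_coeffX_ne_zero hP] using h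

/-- The determining equations for the `u`-component, in the case of a target with `h = 0`. -/
theorem Eqn.IsPointTransformation.determining (hΦ : E.IsPointTransformation E' Ω Φ)
    (h0 : ∀ t ∈ E'.I, E'.h t = 0) {t x v : ℝ} (hP : (t, x, v) ∈ Ω) :
    partU (partU (coeffU Φ)) (t, x, v) = 0 ∧
    2 * E.g t * partX (partU (coeffU Φ)) (t, x, v) * partX (coeffX Φ) (t, x, v)
      = partU (coeffU Φ) (t, x, v) * (partT (coeffT Φ) (t, x, v) * coeffU Φ (t, x, v) ^ E'.n
        - partT (coeffX Φ) (t, x, v) - v ^ E.n * partX (coeffX Φ) (t, x, v)) ∧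
    E.g t * partX (partX (coeffU Φ)) (t, x, v) * partX (coeffX Φ) (t, x, v)
      = partX (coeffX Φ) (t, x, v)
          * (partT (coeffU Φ) (t, x, v) - E.h t * v * partU (coeffU Φ) (t, x, v))
        + partX (coeffU Φ) (t, x, v) * (partT (coeffT Φ) (t, x, v) * coeffU Φ (t, x, v) ^ E'.n
        - partT (coeffX Φ) (t, x, v)) := by
  have hΩ := hΦ.isOpen
  have sX := contDiffOn_coeffX hΦ.smooth
  have sU := contDiffOn_coeffU hΦ.smooth
  have hX := hΦ.partX_coeffX_ne_zero hP
  have hg : E.g t ≠ 0 := hΦ.g_ne_zero hP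
  have key : ∀ q : ℝ, E.g t * (partX (partX (coeffU Φ)) (t, x, v)
        + 2 * q * partX (partU (coeffU Φ)) (t, x, v)
        + q ^ 2 * partU (partU (coeffU Φ)) (t, x, v)) * partX (coeffX Φ) (t, x, v)
      = partX (coeffX Φ) (t, x, v) * (partT (coeffU Φ) (t, x, v)
        - partU (coeffU Φ) (t, x, v) * (v ^ E.n * q + E.h t * v))
        + (partX (coeffU Φ) (t, x, v) + partU (coeffU Φ) (t, x, v) * q)
          * (partT (coeffT Φ) (t, x, v) * coeffU Φ (t, x, v) ^ E'.n
        - partT (coeffX Φ) (t, x, v)) := by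
    intro q
    obtain ⟨b, h1, -, h2⟩ := hΦ.reduced_identity (q := q) (r := 0) hP
      (by simpa [hΦ.partU_coeffX hP] using hX)
    simp only [hess, along, hΦ.partX_partX_coeffX hP, hΦ.partU_coeffX hP, partU_partX hΩ sX hP,
      partU_partX hΩ sU hP, partX_eq_zero hΩ (fun P hP => hΦ.partU_coeffX hP) _ hP,
      partU_eq_zero hΩ (fun P hP => hΦ.partU_coeffX hP) _ hP,
      zero_mul, mul_zero, add_zero, zero_add, sub_zero, mul_one] at h1 h2
    rw [hΦ.g_eq hP, h0 _ (show coeffT Φ (t, x, v) ∈ E'.I from (hΦ.mapsTo hP).1)] at h2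
    refine mul_left_cancel₀ hX ?_
    linear_combination h2 - partX (coeffX Φ) (t, x, v)
      * (partT (coeffT Φ) (t, x, v) * coeffU Φ (t, x, v) ^ E'.n
        - partT (coeffX Φ) (t, x, v)) * h1
  have k0 := key 0
  have k1 := key 1
  have k2 := key (-1)
  refine ⟨?_, by linear_combination (k1 - k2) / 2, by linear_combination k0⟩
  have : E.g t * partX (coeffX Φ) (t, x, v) * partU (partU (coeffU Φ)) (t, x, v) = 0 := by
    linear_combination (k1 + k2) / 2 - k0
  exact (mul_eq_zero.1 this).resolve_left (mul_ne_zero hg hX)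

theorem Eqn.IsPointTransformation.partU_partX_partU (hΦ : E.IsPointTransformation E' Ω Φ)
    (h0 : ∀ t ∈ E'.I, E'.h t = 0) {P : Pt} (hP : P ∈ Ω) :
    partU (partX (partU (coeffU Φ))) P = 0 := by
  have hΩ := hΦ.isOpen
  rw [partU_partX hΩ (contDiffOn_partU hΩ (contDiffOn_coeffU hΦ.smooth)) hP]
  exact partX_eq_zero hΩ (fun P hP => (hΦ.determining h0 (show (P.1, P.2.1, P.2.2) ∈ Ω from hP)).1)
    _ hP

theorem Eqn.IsPointTransformation.hasDerivAt_u (hΦ : E.IsPointTransformation E' Ω Φ)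
    {t x v : ℝ} (hP : (t, x, v) ∈ Ω) :
    HasDerivAt (fun w => partT (coeffT Φ) (t, x, w)) 0 v ∧
    HasDerivAt (fun w => partT (coeffX Φ) (t, x, w)) 0 v ∧
    HasDerivAt (fun w => partX (coeffX Φ) (t, x, w)) 0 v := by
  have hΩ := hΦ.isOpen
  have sT := contDiffOn_coeffT hΦ.smooth
  have sX := contDiffOn_coeffX hΦ.smooth
  refine ⟨?_, ?_, ?_⟩
  · have := hasDerivAt_partU hΩ (contDiffOn_partT hΩ sT) hP
    rwa [partU_partT hΩ sT hP, partT_eq_zero hΩ (fun P hP => (hΦ.partXU_coeffT hP).2) _ hP] at this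
  · have := hasDerivAt_partU hΩ (contDiffOn_partT hΩ sX) hP
    rwa [partU_partT hΩ sX hP, partT_eq_zero hΩ (fun P hP => hΦ.partU_coeffX hP) _ hP] at this
  · have := hasDerivAt_partU hΩ (contDiffOn_partX hΩ sX) hP
    rwa [partU_partX hΩ sX hP, partX_eq_zero hΩ (fun P hP => hΦ.partU_coeffX hP) _ hP] at this

theorem Eqn.IsPointTransformation.first_u_derivative (hΦ : E.IsPointTransformation E' Ω Φ)
    (h0 : ∀ t ∈ E'.I, E'.h t = 0) {t x v : ℝ} (hP : (t, x, v) ∈ Ω) :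
    partT (coeffT Φ) (t, x, v) * (E'.n * coeffU Φ (t, x, v) ^ (E'.n - 1)
        * partU (coeffU Φ) (t, x, v))
      = E.n * v ^ (E.n - 1) * partX (coeffX Φ) (t, x, v) := by
  have hΩ := hΦ.isOpen
  have sU := contDiffOn_coeffU hΦ.smooth
  obtain ⟨dT, dXt, dXx⟩ := hΦ.hasDerivAt_u hP
  have dUU := hasDerivAt_partU hΩ (contDiffOn_partU hΩ sU) hP
  rw [(hΦ.determining h0 hP).1] at dUU
  have dXU := hasDerivAt_partU hΩ (contDiffOn_partX hΩ (contDiffOn_partU hΩ sU)) hP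
  rw [hΦ.partU_partX_partU h0 hP] at dXU
  have dU := hasDerivAt_partU hΩ sU hP
  have dUn := hasDerivAt_rpow_of_mem_U (E := E') dU (hΦ.mapsTo hP).2
  have dvn := hasDerivAt_rpow_of_mem_U (E := E) (hasDerivAt_id v) (hΦ.subset hP).2
  have h := derivU_unique hΩ
    (f := fun P => 2 * E.g P.1 * partX (partU (coeffU Φ)) P * partX (coeffX Φ) P)
    (g := fun P => partU (coeffU Φ) P * (partT (coeffT Φ) P * coeffU Φ P ^ E'.n
        - partT (coeffX Φ) P - P.2.2 ^ E.n * partX (coeffX Φ) P))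
    (fun P hP => (hΦ.determining h0 (show (P.1, P.2.1, P.2.2) ∈ Ω from hP)).2.1) hP
    ((dXU.const_mul (2 * E.g t)).mul dXx) (dUU.mul (((dT.mul dUn).sub dXt).sub (dvn.mul dXx)))
  refine mul_left_cancel₀ (hΦ.partU_coeffU_ne_zero hP) ?_
  simp only [mul_zero, zero_mul, zero_add, add_zero, sub_zero, mul_one, id] at h
  linear_combination -h

theorem Eqn.IsPointTransformation.second_u_derivative (hΦ : E.IsPointTransformation E' Ω Φ)
    (h0 : ∀ t ∈ E'.I, E'.h t = 0) {t x v : ℝ} (hP : (t, x, v) ∈ Ω) :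
    partT (coeffT Φ) (t, x, v) * (E'.n * ((E'.n - 1) * coeffU Φ (t, x, v) ^ (E'.n - 2)
        * partU (coeffU Φ) (t, x, v)) * partU (coeffU Φ) (t, x, v))
      = E.n * ((E.n - 1) * v ^ (E.n - 2)) * partX (coeffX Φ) (t, x, v) := by
  have hΩ := hΦ.isOpen
  have sU := contDiffOn_coeffU hΦ.smooth
  obtain ⟨dT, dXt, dXx⟩ := hΦ.hasDerivAt_u hP
  have dUU := hasDerivAt_partU hΩ (contDiffOn_partU hΩ sU) hP
  rw [(hΦ.determining h0 hP).1] at dUU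
  have dU := hasDerivAt_partU hΩ sU hP
  have dUn := hasDerivAt_rpow_sub_one (p := E'.n) dU (Eqn.ne_zero_or_of_mem_U (hΦ.mapsTo hP).2)
  have dvn := hasDerivAt_rpow_sub_one (p := E.n) (hasDerivAt_id v)
    (Eqn.ne_zero_or_of_mem_U (hΦ.subset hP).2)
  have h := derivU_unique hΩ
    (f := fun P => partT (coeffT Φ) P * (E'.n * coeffU Φ P ^ (E'.n - 1) * partU (coeffU Φ) P))
    (g := fun P => E.n * P.2.2 ^ (E.n - 1) * partX (coeffX Φ) P)
    (fun P hP => hΦ.first_u_derivative h0 (show (P.1, P.2.1, P.2.2) ∈ Ω from hP)) hP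
    (dT.mul ((dUn.const_mul E'.n).mul dUU)) ((dvn.const_mul E.n).mul dXx)
  simp only [mul_zero, zero_mul, zero_add, add_zero, mul_one, id] at h
  linear_combination h

theorem Eqn.IsPointTransformation.n_eq (hΦ : E.IsPointTransformation E' Ω Φ)
    (h0 : ∀ t ∈ E'.I, E'.h t = 0) (hne : Ω.Nonempty) :
    E'.n = E.n ∧ (E.n ≠ 1 → ∀ P ∈ Ω, coeffU Φ P = P.2.2 * partU (coeffU Φ) P) := by
  have hΩ := hΦ.isOpen
  have sU := contDiffOn_coeffU hΦ.smooth
  have hn := E.n_ne_zero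
  have hn' := E'.n_ne_zero
  by_cases h1 : E.n = 1
  · refine ⟨?_, fun h => absurd h1 h⟩
    obtain ⟨⟨t, x, v⟩, hP⟩ := hne
    have h := hΦ.second_u_derivative h0 hP
    rw [h1, sub_self, zero_mul, mul_zero, zero_mul] at h
    rw [h1]
    by_contra h2
    have hY : 0 < coeffU Φ (t, x, v) := Eqn.pos_of_mem_U h2 (hΦ.mapsTo hP).2
    simp [hΦ.partT_coeffT_ne_zero hP, hn', sub_eq_zero, h2, hΦ.partU_coeffU_ne_zero hP,
      (Real.rpow_pos_of_pos hY _).ne'] at h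
  have h2 : E'.n ≠ 1 := by
    intro h2
    obtain ⟨⟨t, x, v⟩, hP⟩ := hne
    have h := hΦ.second_u_derivative h0 hP
    have hv : 0 < v := Eqn.pos_of_mem_U h1 (hΦ.subset hP).2
    rw [h2] at h
    simp [hΦ.partX_coeffX_ne_zero hP, hn, sub_eq_zero, h1,
      (Real.rpow_pos_of_pos hv _).ne'] at h
  have key : ∀ P ∈ Ω, (E'.n - 1) * (P.2.2 * partU (coeffU Φ) P) = (E.n - 1) * coeffU Φ P := by
    rintro ⟨t, x, v⟩ hP
    have e1 := hΦ.first_u_derivative h0 hP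
    have e2 := hΦ.second_u_derivative h0 hP
    have hv : 0 < v := Eqn.pos_of_mem_U h1 (hΦ.subset hP).2
    have hY : 0 < coeffU Φ (t, x, v) := Eqn.pos_of_mem_U h2 (hΦ.mapsTo hP).2
    have r1 : v ^ (E.n - 1) = v * v ^ (E.n - 2) := by
      rw [show E.n - 1 = 1 + (E.n - 2) by ring, Real.rpow_add hv, Real.rpow_one]
    have r2 : coeffU Φ (t, x, v) ^ (E'.n - 1)
        = coeffU Φ (t, x, v) * coeffU Φ (t, x, v) ^ (E'.n - 2) := by
      rw [show E'.n - 1 = 1 + (E'.n - 2) by ring, Real.rpow_add hY, Real.rpow_one]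
    refine mul_left_cancel₀ (mul_ne_zero (mul_ne_zero hn (hΦ.partX_coeffX_ne_zero hP))
      (Real.rpow_pos_of_pos hv (E.n - 2)).ne') ?_
    rw [r1, r2] at e1
    linear_combination coeffU Φ (t, x, v) * e2 - (E'.n - 1) * partU (coeffU Φ) (t, x, v) * e1
  have hnn : E'.n = E.n := by
    obtain ⟨⟨t, x, v⟩, hP⟩ := hne
    have dUU := hasDerivAt_partU hΩ (contDiffOn_partU hΩ sU) hP
    rw [(hΦ.determining h0 hP).1] at dUU
    have dU := hasDerivAt_partU hΩ sU hP
    have h := derivU_unique hΩ key hP (((hasDerivAt_id v).mul dUU).const_mul (E'.n - 1))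
      (dU.const_mul (E.n - 1))
    have hU := hΦ.partU_coeffU_ne_zero hP
    refine mul_right_cancel₀ hU ?_
    simp only [mul_zero, add_zero, one_mul, id] at h
    linear_combination h
  refine ⟨hnn, fun _ P hP => ?_⟩
  have := key P hP
  rw [hnn] at this
  exact (mul_left_cancel₀ (sub_ne_zero.2 h1) this).symm

/-- The `x`- and `u`-components for `n ≠ 1`. -/
theorem Eqn.IsPointTransformation.components_of_ne_one (hΦ : E.IsPointTransformation E' Ω Φ)
    (h0 : ∀ t ∈ E'.I, E'.h t = 0) (hn : E.n ≠ 1) {P : Pt} (hP : P ∈ Ω) :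
    0 < partU (coeffU Φ) P ∧
    partT (coeffT Φ) P * partU (coeffU Φ) P ^ E.n = partX (coeffX Φ) P ∧
    partT (partX (coeffX Φ)) P = 0 ∧
    partT (partU (coeffU Φ)) P = E.h P.1 * partU (coeffU Φ) P := by
  have hΩ := hΦ.isOpen
  have sT := contDiffOn_coeffT hΦ.smooth
  have sX := contDiffOn_coeffX hΦ.smooth
  have sU := contDiffOn_coeffU hΦ.smooth
  obtain ⟨hnn, hY⟩ := hΦ.n_eq h0 ⟨P, hP⟩
  replace hY := hY hn
  have hv : ∀ P ∈ Ω, 0 < P.2.2 := fun P hP => Eqn.pos_of_mem_U hn (hΦ.subset hP).2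
  have hpos : ∀ P ∈ Ω, 0 < partU (coeffU Φ) P := fun P hP => by
    have : 0 < coeffU Φ P := Eqn.pos_of_mem_U (hnn ▸ hn) (hΦ.mapsTo hP).2
    rw [hY P hP] at this
    exact (mul_pos_iff_of_pos_left (hv P hP)).1 this
  have hθ : ∀ P ∈ Ω, partT (coeffT Φ) P * partU (coeffU Φ) P ^ E.n = partX (coeffX Φ) P := by
    rintro ⟨t, x, v⟩ hP
    have e1 := hΦ.first_u_derivative h0 hP
    have h1 := hv _ hP
    have h2 := hpos _ hP
    rw [hnn, hY _ hP, Real.mul_rpow h1.le h2.le] at e1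
    have r : partU (coeffU Φ) (t, x, v) ^ E.n
        = partU (coeffU Φ) (t, x, v) ^ (E.n - 1) * partU (coeffU Φ) (t, x, v) := by
      rw [← Real.rpow_add_one h2.ne', sub_add_cancel]
    refine mul_left_cancel₀ (mul_ne_zero E.n_ne_zero (Real.rpow_pos_of_pos h1 (E.n - 1)).ne') ?_
    rw [r]
    linear_combination e1
  have hXU : ∀ P ∈ Ω, partX (partU (coeffU Φ)) P = 0 := by
    rintro ⟨t, x, v⟩ hP
    have dT := hasDerivAt_partX hΩ (contDiffOn_partT hΩ sT) hP
    rw [partX_partT hΩ sT hP, partT_eq_zero hΩ (fun P hP => (hΦ.partXU_coeffT hP).1) _ hP] at dT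
    have dU := (hasDerivAt_partX hΩ (contDiffOn_partU hΩ sU) hP).rpow_const (p := E.n)
      (Or.inl (hpos _ hP).ne')
    have dX := hasDerivAt_partX hΩ (contDiffOn_partX hΩ sX) hP
    rw [hΦ.partX_partX_coeffX hP] at dX
    have h := derivX_unique hΩ hθ hP (dT.mul dU) dX
    simpa [hΦ.partT_coeffT_ne_zero hP, E.n_ne_zero, (Real.rpow_pos_of_pos (hpos _ hP) _).ne']
      using h
  have hXt : ∀ P ∈ Ω, partT (coeffX Φ) P = 0 := by
    rintro ⟨t, x, v⟩ hP
    have h := (hΦ.determining h0 hP).2.1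
    rw [hXU _ hP, hnn, hY _ hP, Real.mul_rpow (hv _ hP).le (hpos _ hP).le, ← hθ _ hP] at h
    refine (mul_eq_zero.1 (show partU (coeffU Φ) (t, x, v) * partT (coeffX Φ) (t, x, v) = 0 by
      linear_combination h)).resolve_left (hpos _ hP).ne'
  have hUx : ∀ P ∈ Ω, partX (coeffU Φ) P = 0 := by
    rintro ⟨t, x, v⟩ hP
    have d := (hasDerivAt_partX hΩ (contDiffOn_partU hΩ sU) hP).const_mul v
    rw [hXU _ hP, mul_zero] at d
    exact derivX_unique hΩ hY hP (hasDerivAt_partX hΩ sU hP) d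
  refine ⟨hpos P hP, hθ P hP, ?_, ?_⟩
  · rw [← partX_partT hΩ sX hP]
    exact partX_eq_zero hΩ hXt _ hP
  · obtain ⟨t, x, v⟩ := P
    have h := (hΦ.determining h0 hP).2.2
    rw [partX_eq_zero hΩ hUx _ hP, hUx _ hP, mul_zero, zero_mul, zero_mul, add_zero] at h
    have h1 := (mul_eq_zero.1 h.symm).resolve_left (hΦ.partX_coeffX_ne_zero hP)
    have d := (hasDerivAt_partT hΩ (contDiffOn_partU hΩ sU) hP).const_mul v
    have h2 := derivT_unique hΩ hY hP (hasDerivAt_partT hΩ sU hP) d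
    refine mul_left_cancel₀ (hv _ hP).ne' ?_
    linear_combination h1 - h2

/-- The `x`- and `u`-components for `n = 1`. -/
theorem Eqn.IsPointTransformation.components_of_eq_one (hΦ : E.IsPointTransformation E' Ω Φ)
    (h0 : ∀ t ∈ E'.I, E'.h t = 0) (hn : E.n = 1) {P : Pt} (hP : P ∈ Ω) :
    partT (coeffT Φ) P * partU (coeffU Φ) P = partX (coeffX Φ) P ∧
    partT (partX (coeffX Φ)) P = partT (coeffT Φ) P * partX (coeffU Φ) P ∧
    partT (partU (coeffU Φ)) P = E.h P.1 * partU (coeffU Φ) P - partX (coeffU Φ) P ∧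
    partT (partX (coeffU Φ)) P = 0 := by
  have hΩ := hΦ.isOpen
  have sT := contDiffOn_coeffT hΦ.smooth
  have sX := contDiffOn_coeffX hΦ.smooth
  have sU := contDiffOn_coeffU hΦ.smooth
  have hnn : E'.n = 1 := (hΦ.n_eq h0 ⟨P, hP⟩).1.trans hn
  have dT : ∀ t x v, (t, x, v) ∈ Ω → HasDerivAt (fun y => partT (coeffT Φ) (t, y, v)) 0 x := by
    intro t x v hP
    have dT := hasDerivAt_partX hΩ (contDiffOn_partT hΩ sT) hP
    rwa [partX_partT hΩ sT hP, partT_eq_zero hΩ (fun P hP => (hΦ.partXU_coeffT hP).1) _ hP] at dT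
  have dX : ∀ t x v, (t, x, v) ∈ Ω → HasDerivAt (fun y => partX (coeffX Φ) (t, y, v)) 0 x := by
    intro t x v hP
    have dX := hasDerivAt_partX hΩ (contDiffOn_partX hΩ sX) hP
    rwa [hΦ.partX_partX_coeffX hP] at dX
  have hθ : ∀ P ∈ Ω, partT (coeffT Φ) P * partU (coeffU Φ) P = partX (coeffX Φ) P := by
    rintro ⟨t, x, v⟩ hP
    have e1 := hΦ.first_u_derivative h0 hP
    simpa [hnn, hn] using e1
  have hXU : ∀ P ∈ Ω, partX (partU (coeffU Φ)) P = 0 := by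
    rintro ⟨t, x, v⟩ hP
    have h := derivX_unique hΩ hθ hP ((dT _ _ _ hP).mul
      (hasDerivAt_partX hΩ (contDiffOn_partU hΩ sU) hP)) (dX _ _ _ hP)
    simpa [hΦ.partT_coeffT_ne_zero hP] using h
  have hY : ∀ P ∈ Ω, partT (coeffT Φ) P * coeffU Φ P
      = partX (coeffX Φ) P * P.2.2 + partT (coeffX Φ) P := by
    rintro ⟨t, x, v⟩ hP
    have h := (hΦ.determining h0 hP).2.1
    rw [hXU _ hP, hnn, hn, Real.rpow_one, Real.rpow_one] at h
    refine mul_left_cancel₀ (hΦ.partU_coeffU_ne_zero hP) ?_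
    linear_combination -h
  have hYx : ∀ P ∈ Ω, partT (coeffT Φ) P * partX (coeffU Φ) P = partT (partX (coeffX Φ)) P := by
    rintro ⟨t, x, v⟩ hP
    have h := derivX_unique hΩ hY hP ((dT _ _ _ hP).mul (hasDerivAt_partX hΩ sU hP))
      (((dX _ _ _ hP).mul_const v).add (hasDerivAt_partX hΩ (contDiffOn_partT hΩ sX) hP))
    rw [partX_partT hΩ sX hP] at h
    linear_combination h
  have hYxx : ∀ P ∈ Ω, partX (partX (coeffU Φ)) P = 0 := by
    rintro ⟨t, x, v⟩ hP
    have d := hasDerivAt_partX hΩ (contDiffOn_partT hΩ (contDiffOn_partX hΩ sX)) hP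
    rw [partX_partT hΩ (contDiffOn_partX hΩ sX) hP,
      partT_eq_zero hΩ (fun P hP => hΦ.partX_partX_coeffX hP) _ hP] at d
    have h := derivX_unique hΩ hYx hP ((dT _ _ _ hP).mul
      (hasDerivAt_partX hΩ (contDiffOn_partX hΩ sU) hP)) d
    simpa [hΦ.partT_coeffT_ne_zero hP] using h
  have hYt : ∀ P ∈ Ω, partT (coeffU Φ) P
      = E.h P.1 * P.2.2 * partU (coeffU Φ) P - P.2.2 * partX (coeffU Φ) P := by
    rintro ⟨t, x, v⟩ hP
    have h := (hΦ.determining h0 hP).2.2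
    have h' := hY _ hP
    rw [hYxx _ hP, hnn, Real.rpow_one] at h
    refine mul_left_cancel₀ (hΦ.partX_coeffX_ne_zero hP) ?_
    linear_combination -h - partX (coeffU Φ) (t, x, v) * h'
  refine ⟨hθ P hP, (hYx P hP).symm, ?_, ?_⟩
  · obtain ⟨t, x, v⟩ := P
    rw [← partU_partT hΩ sU hP]
    have dUU := hasDerivAt_partU hΩ (contDiffOn_partU hΩ sU) hP
    rw [(hΦ.determining h0 hP).1] at dUU
    have dXU := hasDerivAt_partU hΩ (contDiffOn_partX hΩ sU) hP
    rw [partU_partX hΩ sU hP, hXU _ hP] at dXU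
    have h := derivU_unique hΩ hYt hP (hasDerivAt_partU hΩ (contDiffOn_partT hΩ sU) hP)
      ((((hasDerivAt_id v).const_mul (E.h t)).mul dUU).sub ((hasDerivAt_id v).mul dXU))
    simpa using h
  · obtain ⟨t, x, v⟩ := P
    rw [← partX_partT hΩ sU hP]
    have d1 := hasDerivAt_partX hΩ (contDiffOn_partU hΩ sU) hP
    rw [hXU _ hP] at d1
    have d2 := hasDerivAt_partX hΩ (contDiffOn_partX hΩ sU) hP
    rw [hYxx _ hP] at d2
    have h := derivX_unique hΩ hYt hP (hasDerivAt_partX hΩ (contDiffOn_partT hΩ sU) hP)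
      ((d1.const_mul (E.h t * v)).sub (d2.const_mul v))
    simpa using h

/-- A point transformation to an equation with `h = 0`, on a box, is given by a link. -/
theorem Eqn.IsPointTransformation.exists_link {J K L : Set ℝ}
    (hΦ : E.IsPointTransformation E' (J ×ˢ K ×ˢ L) Φ) (h0 : ∀ t ∈ E'.I, E'.h t = 0)
    (hJ : IsOpen J) (hJc : IsPreconnected J) (hK : IsOpen K) (hKc : IsPreconnected K)
    (hL : IsOpen L) (hLc : IsPreconnected L) {t₀ x₀ v₀ : ℝ} (ht₀ : t₀ ∈ J) (hx₀ : x₀ ∈ K)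
    (hv₀ : v₀ ∈ L) :
    ∃ (θ θ1 X Y : ℝ → ℝ) (Z : ℝ), Link E E' J θ θ1 X Y Z ∧
      ∀ P ∈ J ×ˢ K ×ˢ L, coeffT Φ P = θ P.1 := by
  have hΩ := hΦ.isOpen
  have sT := contDiffOn_coeffT hΦ.smooth
  have sX := contDiffOn_coeffX hΦ.smooth
  have sU := contDiffOn_coeffU hΦ.smooth
  have hm : ∀ t ∈ J, (t, x₀, v₀) ∈ J ×ˢ K ×ˢ L := fun t ht => ⟨ht, hx₀, hv₀⟩
  obtain ⟨hnn, -⟩ := hΦ.n_eq h0 ⟨_, hm t₀ ht₀⟩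
  have hθ : ∀ P ∈ J ×ˢ K ×ˢ L, coeffT Φ P = coeffT Φ (P.1, x₀, v₀) := by
    rintro ⟨t, x, v⟩ ⟨ht, hx, hv⟩
    have e1 : coeffT Φ (t, x, v) = coeffT Φ (t, x₀, v) :=
      eq_of_hasDerivAt_zero hK hKc (f := fun y => coeffT Φ (t, y, v)) (fun y hy => by
        have hP : (t, y, v) ∈ J ×ˢ K ×ˢ L := ⟨ht, hy, hv⟩
        simpa [(hΦ.partXU_coeffT hP).1] using hasDerivAt_partX hΩ sT hP) hx hx₀
    have e2 : coeffT Φ (t, x₀, v) = coeffT Φ (t, x₀, v₀) :=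
      eq_of_hasDerivAt_zero hL hLc (f := fun w => coeffT Φ (t, x₀, w)) (fun w hw => by
        have hP : (t, x₀, w) ∈ J ×ˢ K ×ˢ L := ⟨ht, hx₀, hw⟩
        simpa [(hΦ.partXU_coeffT hP).2] using hasDerivAt_partU hΩ sT hP) hv hv₀
    exact e1.trans e2
  by_cases hn : E.n = 1
  · have hZ : ∀ t ∈ J, partX (coeffU Φ) (t, x₀, v₀) = partX (coeffU Φ) (t₀, x₀, v₀) :=
      fun t ht => eq_of_hasDerivAt_zero hJ hJc (f := fun t => partX (coeffU Φ) (t, x₀, v₀))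
        (fun t ht => by
          have := hasDerivAt_partT hΩ (contDiffOn_partX hΩ sU) (hm t ht)
          rwa [(hΦ.components_of_eq_one h0 hn (hm t ht)).2.2.2] at this) ht ht₀
    refine ⟨_, fun t => partT (coeffT Φ) (t, x₀, v₀), fun t => partX (coeffX Φ) (t, x₀, v₀),
      fun t => partU (coeffU Φ) (t, x₀, v₀), partX (coeffU Φ) (t₀, x₀, v₀),
      ⟨hnn, fun t ht => (hΦ.mapsTo (hm t ht)).1, fun t ht => hasDerivAt_partT hΩ sT (hm t ht),
        fun t ht => hΦ.partT_coeffT_ne_zero (hm t ht), fun t ht => ?_,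
        fun t ht => hΦ.partX_coeffX_ne_zero (hm t ht), fun t ht => ?_, fun t ht => ?_,
        fun t ht => hΦ.g_eq (hm t ht), fun h => absurd hn h, fun h => absurd hn h⟩, hθ⟩
    · rw [← hZ t ht, ← (hΦ.components_of_eq_one h0 hn (hm t ht)).2.1]
      exact hasDerivAt_partT hΩ (contDiffOn_partX hΩ sX) (hm t ht)
    · have := (hΦ.components_of_eq_one h0 hn (hm t ht)).2.2.1
      rw [hZ t ht] at this
      exact this ▸ hasDerivAt_partT hΩ (contDiffOn_partU hΩ sU) (hm t ht)
    · rw [hn, Real.rpow_one]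
      exact (hΦ.components_of_eq_one h0 hn (hm t ht)).1
  · refine ⟨_, fun t => partT (coeffT Φ) (t, x₀, v₀), fun t => partX (coeffX Φ) (t, x₀, v₀),
      fun t => partU (coeffU Φ) (t, x₀, v₀), 0,
      ⟨hnn, fun t ht => (hΦ.mapsTo (hm t ht)).1, fun t ht => hasDerivAt_partT hΩ sT (hm t ht),
        fun t ht => hΦ.partT_coeffT_ne_zero (hm t ht), fun t ht => ?_,
        fun t ht => hΦ.partX_coeffX_ne_zero (hm t ht), fun t ht => ?_,
        fun t ht => (hΦ.components_of_ne_one h0 hn (hm t ht)).2.1,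
        fun t ht => hΦ.g_eq (hm t ht), fun _ => rfl,
        fun _ t ht => (hΦ.components_of_ne_one h0 hn (hm t ht)).1⟩, hθ⟩
    · rw [mul_zero, ← (hΦ.components_of_ne_one h0 hn (hm t ht)).2.2.1]
      exact hasDerivAt_partT hΩ (contDiffOn_partX hΩ sX) (hm t ht)
    · have := (hΦ.components_of_ne_one h0 hn (hm t ht)).2.2.2
      rw [sub_zero]
      exact this ▸ hasDerivAt_partT hΩ (contDiffOn_partU hΩ sU) (hm t ht)

end Transformation

section Moebius

variable {E E' : Eqn} {T Tt θ θ1 X Y : ℝ → ℝ} {J : Set ℝ} {Z α β γ δ μ : ℝ}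

/-- The function `θ` is the fractional linear function of `T` with the given coefficients, and the
values of `g` are related correspondingly. -/
structure MoebiusLink (E E' : Eqn) (T Tt : ℝ → ℝ) (J : Set ℝ) (θ : ℝ → ℝ) (α β γ δ μ : ℝ) :
    Prop where
  n_eq : E'.n = E.n
  subset : J ⊆ E.I
  isOpen : IsOpen J
  mem : ∀ t ∈ J, θ t ∈ E'.I
  hasDerivAt_θ : ∀ t ∈ J, HasDerivAt θ ((α * δ - β * γ) * Tt t / (γ * T t + δ) ^ 2) t
  pos : 0 < μ * (α * δ - β * γ)
  of_ne_one : E.n ≠ 1 → γ = 0 ∧ δ = 1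
  denom_ne_zero : ∀ t ∈ J, γ * T t + δ ≠ 0
  θ_eq : ∀ t ∈ J, θ t * (γ * T t + δ) = α * T t + β
  g_eq : ∀ t ∈ J, E'.g (θ t) * Tt t = μ * E.g t

theorem Link.exists_moebiusLink (hL : Link E E' J θ θ1 X Y Z) (hT : E.IsGauge T Tt)
    (hJI : J ⊆ E.I) (hJ : IsOpen J) (hJc : IsConnected J) :
    ∃ α β γ δ μ, MoebiusLink E E' T Tt J θ α β γ δ μ := by
  obtain ⟨t₀, ht₀⟩ := hJc.nonempty
  have dT : ∀ t ∈ J, HasDerivAt T (Tt t) t := fun t ht => hT.hasDerivAt (hJI ht)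
  have dTt := fun t (ht : t ∈ J) => hT.hasDerivAt_Tt (hJI ht)
  have hT0 : ∀ t ∈ J, Tt t ≠ 0 := fun t ht => hT.ne_zero (hJI ht)
  by_cases hn : E.n = 1
  · have hYX : ∀ t ∈ J, θ1 t * Y t = X t := fun t ht => by
      simpa [hn] using hL.Y_rpow t ht
    obtain ⟨δ, hδ⟩ := exists_const_of_hasDerivAt_zero hJ hJc (f := fun t => Y t * Tt t + Z * T t)
      fun t ht => by
        refine (((hL.hasDerivAt_Y t ht).mul (dTt t ht)).add
          ((dT t ht).const_mul Z)).congr_deriv ?_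
        rw [hn]
        ring
    obtain ⟨α, hα⟩ := exists_const_of_hasDerivAt_zero hJ hJc (f := fun t => X t - Z * θ t)
      fun t ht => by
        refine ((hL.hasDerivAt_X t ht).sub ((hL.hasDerivAt_θ t ht).const_mul Z)).congr_deriv ?_
        ring
    have hP : ∀ t ∈ J, -Z * T t + δ = Y t * Tt t := fun t ht => by linear_combination -hδ t ht
    have hP0 : ∀ t ∈ J, -Z * T t + δ ≠ 0 := fun t ht => by
      rw [hP t ht]
      exact mul_ne_zero (hL.Y_ne_zero ht) (hT0 t ht)
    obtain ⟨β, hβ⟩ := exists_const_of_hasDerivAt_zero hJ hJc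
      (f := fun t => θ t * (-Z * T t + δ) - α * T t) fun t ht => by
        refine (((hL.hasDerivAt_θ t ht).mul (((dT t ht).const_mul (-Z)).add_const δ)).sub
          ((dT t ht).const_mul α)).congr_deriv ?_
        rw [hP t ht]
        linear_combination Tt t * hYX t ht + Tt t * hα t ht
    have hΔ : ∀ t ∈ J, α * δ - β * -Z = X t * (-Z * T t + δ) := fun t ht => by
      linear_combination (-(-Z * T t + δ)) * hα t ht + (-Z) * hβ t ht
    have hΔ0 : α * δ - β * -Z ≠ 0 := by
      rw [hΔ t₀ ht₀]
      exact mul_ne_zero (hL.X_ne_zero t₀ ht₀) (hP0 t₀ ht₀)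
    refine ⟨α, β, -Z, δ, α * δ - β * -Z, hL.n_eq, hJI, hJ, hL.mem, fun t ht => ?_,
      mul_self_pos.2 hΔ0, fun h => absurd hn h, hP0, fun t ht => ?_, fun t ht => ?_⟩
    · refine (hL.hasDerivAt_θ t ht).congr_deriv ?_
      rw [eq_div_iff (pow_ne_zero 2 (hP0 t ht)), hΔ t ht, ← hYX t ht, hP t ht]
      ring
    · linear_combination hβ t ht
    · refine mul_right_cancel₀ (hL.θ1_ne_zero t ht) ?_
      have hg := hL.g_eq t ht
      rw [hΔ t ht, hP t ht]
      linear_combination Tt t * hg - X t * E.g t * Tt t * hYX t ht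
  · have hZ := hL.Z_eq hn
    subst hZ
    obtain ⟨α, hα⟩ := exists_const_of_hasDerivAt_zero hJ hJc (f := X) fun t ht => by
      simpa using hL.hasDerivAt_X t ht
    have hYp := hL.Y_pos hn
    obtain ⟨c, hc⟩ := exists_const_of_hasDerivAt_zero hJ hJc (f := fun t => Y t ^ E.n * Tt t)
      fun t ht => by
        refine ((((hL.hasDerivAt_Y t ht).rpow_const (p := E.n)
          (Or.inl (hYp t ht).ne'))).mul (dTt t ht)).congr_deriv ?_
        rw [Real.rpow_sub_one (hYp t ht).ne']
        field_simp [(hYp t ht).ne']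
        ring
    have hcp : 0 < c := by
      rw [← hc t₀ ht₀]
      exact mul_pos (Real.rpow_pos_of_pos (hYp t₀ ht₀) _) (hT.pos (hJI ht₀))
    have hα0 : α ≠ 0 := by
      rw [← hα t₀ ht₀]
      exact hL.X_ne_zero t₀ ht₀
    have hθ1 : ∀ t ∈ J, θ1 t = α * Tt t / c := fun t ht => by
      rw [eq_div_iff hcp.ne', ← hc t ht, ← hα t ht, ← hL.Y_rpow t ht]
      ring
    obtain ⟨β, hβ⟩ := exists_const_of_hasDerivAt_zero hJ hJc (f := fun t => θ t - α / c * T t)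
      fun t ht => by
        refine ((hL.hasDerivAt_θ t ht).sub ((dT t ht).const_mul (α / c))).congr_deriv ?_
        rw [hθ1 t ht]
        ring
    refine ⟨α / c, β, 0, 1, α * c, hL.n_eq, hJI, hJ, hL.mem, fun t ht => ?_, ?_,
      fun _ => ⟨rfl, rfl⟩, fun t ht => by simp, fun t ht => ?_, fun t ht => ?_⟩
    · refine (hL.hasDerivAt_θ t ht).congr_deriv ?_
      rw [hθ1 t ht]
      ring
    · have : α * c * (α / c * 1 - β * 0) = α ^ 2 := by field_simp; ring
      rw [this]
      positivity
    · linear_combination hβ t ht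
    · refine mul_right_cancel₀ (hL.θ1_ne_zero t ht) ?_
      have hg := hL.g_eq t ht
      rw [hα t ht] at hg
      rw [hθ1 t ht] at hg ⊢
      field_simp at hg ⊢
      linear_combination Tt t * hg

/-- The pull-back of a quadratic polynomial by a fractional linear transformation. -/
def Params.pull (P : Params) (α β γ δ : ℝ) : Params :=
  ⟨(P.a * α ^ 2 + P.k * α * γ + P.m * γ ^ 2) / (α * δ - β * γ),
    (2 * P.a * α * β + P.k * (α * δ + β * γ) + 2 * P.m * γ * δ) / (α * δ - β * γ),
    (P.a * β ^ 2 + P.k * β * δ + P.m * δ ^ 2) / (α * δ - β * γ), P.C, 0, 0⟩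

theorem Params.pull_σ (P : Params) {s y : ℝ} (hΔ : α * δ - β * γ ≠ 0)
    (h : y * (γ * s + δ) = α * s + β) :
    (P.pull α β γ δ).σ s * (α * δ - β * γ) = P.σ y * (γ * s + δ) ^ 2 := by
  have : P.σ y * (γ * s + δ) ^ 2 = P.a * (α * s + β) ^ 2 + P.k * (α * s + β) * (γ * s + δ)
      + P.m * (γ * s + δ) ^ 2 := by
    rw [← h, Params.σ]
    ring
  rw [this]
  simp only [Params.pull, Params.σ]
  generalize hD : α * δ - β * γ = Δ at hΔ ⊢
  field_simp
  ring

theorem Params.pull_pull (P : Params) (hΔ : α * δ - β * γ ≠ 0) :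
    ((P.pull δ (-β) (-γ) α).pull α β γ δ).a = P.a ∧
      ((P.pull δ (-β) (-γ) α).pull α β γ δ).k = P.k ∧
      ((P.pull δ (-β) (-γ) α).pull α β γ δ).m = P.m := by
  have hΔ' : δ * α - -β * -γ ≠ 0 := by
    convert hΔ using 1
    ring
  have e : δ * α - -β * -γ = α * δ - β * γ := by ring
  simp only [Params.pull, e]
  refine ⟨?_, ?_, ?_⟩ <;> rw [div_eq_iff hΔ] <;> generalize hD : α * δ - β * γ = Δ at hΔ ⊢ <;>
    field_simp <;> subst hD <;> ring

theorem Params.pull_disc (P : Params) (hΔ : α * δ - β * γ ≠ 0) :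
    (P.pull α β γ δ).k ^ 2 - 4 * (P.pull α β γ δ).a * (P.pull α β γ δ).m
      = P.k ^ 2 - 4 * P.a * P.m := by
  simp only [Params.pull]
  generalize hD : α * δ - β * γ = Δ at hΔ ⊢
  field_simp
  subst hD
  ring

theorem MoebiusLink.det_ne_zero (hM : MoebiusLink E E' T Tt J θ α β γ δ μ) :
    α * δ - β * γ ≠ 0 := right_ne_zero_of_mul hM.pos.ne'

theorem MoebiusLink.scale_ne_zero (hM : MoebiusLink E E' T Tt J θ α β γ δ μ) : μ ≠ 0 :=
  left_ne_zero_of_mul hM.pos.ne'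

theorem MoebiusLink.deriv_eq (hM : MoebiusLink E E' T Tt J θ α β γ δ μ) (hT : E.IsGauge T Tt)
    {t : ℝ} (ht : t ∈ J) :
    μ * (deriv E.g t + E.n * E.h t * E.g t) * (γ * T t + δ) ^ 2
      = deriv E'.g (θ t) * (α * δ - β * γ) * Tt t ^ 2 := by
  have d1 := ((E'.hasDerivAt_g (hM.mem t ht)).comp t (hM.hasDerivAt_θ t ht)).mul
    (hT.hasDerivAt_Tt (hM.subset ht))
  have d2 := (E.hasDerivAt_g (hM.subset ht)).const_mul μ
  have h := d1.unique (d2.congr_of_eventuallyEq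
    (eventually_of_mem (hM.isOpen.mem_nhds ht) hM.g_eq))
  have hg := hM.g_eq t ht
  have h0 := hM.denom_ne_zero t ht
  simp only [Function.comp] at h
  field_simp at h
  linear_combination -h - E.n * E.h t * (γ * T t + δ) ^ 2 * hg

theorem MoebiusLink.ode_iff (hM : MoebiusLink E E' T Tt J θ α β γ δ μ) (hT : E.IsGauge T Tt)
    (h0 : ∀ t ∈ E'.I, E'.h t = 0) (P : Params) {t : ℝ} (ht : t ∈ J) :
    (P.pull α β γ δ).σ (T t) * (deriv E.g t + E.n * E.h t * E.g t)
        = (P.pull α β γ δ).C * Tt t * E.g t ↔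
      P.σ (θ t) * (deriv E'.g (θ t) + E'.n * E'.h (θ t) * E'.g (θ t))
        = P.C * 1 * E'.g (θ t) := by
  have hd := hM.deriv_eq hT ht
  have hg := hM.g_eq t ht
  have hΔ := hM.det_ne_zero
  have hσ := P.pull_σ hΔ (hM.θ_eq t ht)
  have hμ := hM.scale_ne_zero
  have hTt := hT.ne_zero (hM.subset ht)
  have hP := hM.denom_ne_zero t ht
  rw [h0 _ (hM.mem t ht), mul_zero, zero_mul, add_zero, mul_one]
  have hC : (P.pull α β γ δ).C = P.C := rfl
  rw [hC]
  have key : (α * δ - β * γ) * μ * (γ * T t + δ) ^ 2 * ((P.pull α β γ δ).σ (T t)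
        * (deriv E.g t + E.n * E.h t * E.g t) - P.C * Tt t * E.g t)
      = (α * δ - β * γ) * Tt t ^ 2 * (γ * T t + δ) ^ 2
        * (P.σ (θ t) * deriv E'.g (θ t) - P.C * E'.g (θ t)) := by
    linear_combination (γ * T t + δ) ^ 2 * μ * (deriv E.g t + E.n * E.h t * E.g t) * hσ
      + (γ * T t + δ) ^ 2 * P.σ (θ t) * hd
      + (α * δ - β * γ) * (γ * T t + δ) ^ 2 * P.C * Tt t * hg
  rw [← sub_eq_zero, ← sub_eq_zero (a := P.σ (θ t) * _)]
  constructor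
  · intro h
    rw [h, mul_zero] at key
    exact (mul_eq_zero.1 key.symm).resolve_left (by positivity)
  · intro h
    rw [h, mul_zero] at key
    exact (mul_eq_zero.1 key).resolve_left (by positivity)

/-- A pair is nontrivial if its quadratic polynomial is. -/
def Params.IsNontrivial (P : Params) : Prop := ¬ (P.a = 0 ∧ P.k = 0 ∧ P.m = 0)

theorem Params.IsNontrivial.pull {P : Params} (hP : P.IsNontrivial) (hΔ : α * δ - β * γ ≠ 0) :
    (P.pull α β γ δ).IsNontrivial := by
  have hΔ' : δ * α - -β * -γ ≠ 0 := by
    convert hΔ using 1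
    ring
  rintro ⟨h1, h2, h3⟩
  obtain ⟨e1, e2, e3⟩ := P.pull_pull hΔ'
  rw [neg_neg, neg_neg] at e1 e2 e3
  refine hP ⟨?_, ?_, ?_⟩
  · rw [← e1, Params.pull, h1, h2, h3]; simp
  · rw [← e2, Params.pull, h1, h2, h3]; simp
  · rw [← e3, Params.pull, h1, h2, h3]; simp

/-- The equation has Lie symmetries with nonvanishing coefficient of `∂_t`. -/
def Eqn.IsSpecial (E : Eqn) (T Tt : ℝ → ℝ) : Prop := ∃ P, E.Admits T Tt P ∧ P.IsNontrivial

theorem MoebiusLink.isSpecial_iff (hM : MoebiusLink E E' T Tt E.I θ α β γ δ μ)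
    (hT : E.IsGauge T Tt) (h0 : ∀ t ∈ E'.I, E'.h t = 0) (hθ : θ '' E.I = E'.I) :
    E'.IsSpecial (fun t => t) (fun _ => 1) ↔ E.IsSpecial T Tt := by
  have hΔ := hM.det_ne_zero
  have hΔ' : δ * α - -β * -γ ≠ 0 := by
    convert hΔ using 1
    ring
  constructor
  · rintro ⟨P, hP, hP0⟩
    refine ⟨P.pull α β γ δ, ⟨fun hn => ?_, fun _ => rfl, fun t ht => ?_⟩, hP0.pull hΔ⟩
    · simp [Params.pull, (hM.of_ne_one hn).1, hP.a_eq (hM.n_eq ▸ hn)]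
    · exact (hM.ode_iff hT h0 P ht).2 (hP.ode _ (hM.mem t ht))
  · rintro ⟨P, hP, hP0⟩
    refine ⟨P.pull δ (-β) (-γ) α, ⟨fun hn => ?_, fun _ => rfl, ?_⟩, hP0.pull hΔ'⟩
    · have hn' : E.n ≠ 1 := hM.n_eq ▸ hn
      simp [Params.pull, (hM.of_ne_one hn').1, hP.a_eq hn']
    · rw [← hθ]
      rintro _ ⟨t, ht, rfl⟩
      refine (hM.ode_iff hT h0 _ ht).1 ?_
      obtain ⟨e1, e2, e3⟩ := P.pull_pull hΔ
      rw [Params.σ, e1, e2, e3]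
      exact hP.ode t ht

theorem Eqn.PointEquiv.exists_moebiusLink (h : E.PointEquiv E') (hT : E.IsGauge T Tt)
    (h0 : ∀ t ∈ E'.I, E'.h t = 0) : ∃ θ α β γ δ μ,
      MoebiusLink E E' T Tt E.I θ α β γ δ μ ∧ θ '' E.I = E'.I := by
  obtain ⟨Φ, hΦ, hbij⟩ := h
  obtain ⟨t₀, ht₀⟩ := E.isConnected_I.nonempty
  have hdom : E.domain = E.I ×ˢ (univ : Set ℝ) ×ˢ E.U := by
    ext ⟨t, x, v⟩
    simp [Eqn.domain]
  rw [hdom] at hΦ hbij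
  obtain ⟨θ, θ1, X, Y, Z, hL, hθ⟩ := hΦ.exists_link h0 E.isOpen_I E.isConnected_I.isPreconnected
    isOpen_univ isPreconnected_univ E.isOpen_U E.isPreconnected_U ht₀ (mem_univ 0) E.one_mem_U
  obtain ⟨α, β, γ, δ, μ, hM⟩ :=
    hL.exists_moebiusLink hT Subset.rfl E.isOpen_I E.isConnected_I
  refine ⟨θ, α, β, γ, δ, μ, hM, Subset.antisymm ?_ fun s hs => ?_⟩
  · rintro _ ⟨t, ht, rfl⟩
    exact hM.mem t ht
  · obtain ⟨P, hP, hPs⟩ := hbij.surjOn (show (s, 0, 1) ∈ E'.domain from ⟨hs, E'.one_mem_U⟩)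
    refine ⟨P.1, hP.1, ?_⟩
    rw [← hθ P hP, coeffT, hPs]

theorem Eqn.PointEquiv.isSpecial_iff (h : E.PointEquiv E') (hT : E.IsGauge T Tt)
    (h0 : ∀ t ∈ E'.I, E'.h t = 0) :
    E'.IsSpecial (fun t => t) (fun _ => 1) ↔ E.IsSpecial T Tt := by
  obtain ⟨θ, α, β, γ, δ, μ, hM, hθ⟩ := h.exists_moebiusLink hT h0
  exact hM.isSpecial_iff hT h0 hθ

theorem Eqn.IsRow1.isSpecial {r : Row1} (hr : E.IsRow1 r) :
    E.IsSpecial (fun t => t) (fun _ => 1) := by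
  by_cases hc : r.IsConst
  · have hk := hr.isRow3.const (E.isGauge_id hr.h_eq_zero) (r.isConst_toRow.2 hc)
    exact ⟨⟨0, 0, 1, 0, 0, 0⟩, ⟨fun _ => rfl, fun _ => rfl, fun t ht => by simp [hk t ht]⟩,
      fun h => one_ne_zero h.2.2⟩
  · refine ⟨_, hr.admits hc, fun h => hr.1.params_C E.n_ne_zero hc ?_⟩
    exact (hr.admits hc).C_eq_zero (E.isGauge_id hr.h_eq_zero) h

theorem Eqn.not_isSpecial_of_generic (h0 : ∀ t ∈ E.I, E.h t = 0)
    (h : E.HasMaxAlgebra (genericBasis E.n)) : ¬ E.IsSpecial (fun t => t) (fun _ => 1) := by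
  rintro ⟨P, hP, hP0⟩
  have hT := E.isGauge_id h0
  have hmem : E.domain.domRestrict (field E.n E.h (fun t => t) (fun _ => 1) P) ∈ E.maxAlgebra :=
    ⟨_, hP.isLieSymmetry hT fun _ _ => rfl, rfl⟩
  rw [h.2] at hmem
  let N : Submodule ℝ (E.domain → Pt) :=
    { carrier := {V | ∀ p, (V p).1 = 0}
      add_mem' := fun hV hW p => by simp [hV p, hW p]
      zero_mem' := fun p => rfl
      smul_mem' := fun c V hV p => by simp [hV p] }
  have hle : Submodule.span ℝ (Set.range fun i : Fin (genericBasis E.n).length =>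
      E.domain.domRestrict ((genericBasis E.n).get i)) ≤ N := by
    refine Submodule.span_le.2 ?_
    rintro _ ⟨i, rfl⟩ p
    have : ∀ V ∈ genericBasis E.n, (V p).1 = 0 := by
      unfold genericBasis
      split_ifs <;> simp [delX, vf]
    exact this _ (List.get_mem _ _)
  have hN := hle hmem
  obtain ⟨t, ht⟩ := E.isConnected_I.nonempty
  refine hP0 (hT.eq_zero_of_quadratic ht ?_)
  filter_upwards [E.isOpen_I.mem_nhds ht] with s hs
  have := hN ⟨(s, 0, 1), hs, E.one_mem_U⟩
  simpa [field, vf, Params.σ] using this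

/-- Table 1 is exhaustive, and its special and generic cases exclude each other. -/
theorem Eqn.table_one_xor (E : Eqn) : Xor
    (∃ (r : Row1) (E' : Eqn), E'.n = E.n ∧ E'.IsRow1 r ∧ E.PointEquiv E')
    (∃ E' : Eqn, E'.n = E.n ∧ (∀ t ∈ E'.I, E'.h t = 0) ∧ E.PointEquiv E' ∧
      E'.HasMaxAlgebra (genericBasis E'.n)) := by
  obtain ⟨T, Tt, hT⟩ := E.exists_isGauge
  have hA : (∃ (r : Row1) (E' : Eqn), E'.n = E.n ∧ E'.IsRow1 r ∧ E.PointEquiv E') ↔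
      E.IsSpecial T Tt := by
    refine ⟨fun ⟨r, E', _, hr, he⟩ => (he.isSpecial_iff hT hr.h_eq_zero).1 hr.isSpecial,
      fun ⟨P, hP, hP0⟩ => ?_⟩
    obtain ⟨r, hr⟩ := hP.exists_row hT hP0
    exact hr.exists_row1 hT
  have hB : (∃ E' : Eqn, E'.n = E.n ∧ (∀ t ∈ E'.I, E'.h t = 0) ∧ E.PointEquiv E' ∧
      E'.HasMaxAlgebra (genericBasis E'.n)) ↔ ¬ E.IsSpecial T Tt := by
    refine ⟨fun ⟨E', _, h0, he, hg⟩ hs =>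
      E'.not_isSpecial_of_generic h0 hg ((he.isSpecial_iff hT h0).2 hs), fun hs => ?_⟩
    obtain ⟨E', h1, -, h0, -, he⟩ := hT.exists_moebius_target (α := 1) (β := 0) (γ := 0) (δ := 1)
      (κ := 1) (by simp) (fun t _ => by simp) one_ne_zero fun _ => ⟨rfl, rfl, by simp⟩
    refine ⟨E', h1, h0, he, ?_⟩
    have hT' := E'.isGauge_id h0
    rw [← genericBasis3_id]
    exact E'.hasMaxAlgebra_generic hT' fun P hP => by_contra fun hP0 =>
      hs ((he.isSpecial_iff hT h0).1 ⟨P, hP, hP0⟩)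
  rw [hA, hB]
  exact xor_not_right.2 Iff.rfl

end Moebius

section Inequivalence

variable {E E' : Eqn} {T Tt θ : ℝ → ℝ} {J : Set ℝ} {α β γ δ μ : ℝ}

theorem exists_open_interval_box {Ω : Set Pt} (hΩ : IsOpen Ω) {t x v : ℝ} (hP : (t, x, v) ∈ Ω) :
    ∃ r > 0, Metric.ball t r ×ˢ Metric.ball x r ×ˢ Metric.ball v r ⊆ Ω := by
  obtain ⟨r, hr, h⟩ := Metric.isOpen_iff.1 hΩ _ hP
  refine ⟨r, hr, ?_⟩
  rwa [ball_prod_same, ball_prod_same]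

theorem Eqn.LocallyPointEquiv.exists_moebiusLink (h : E.LocallyPointEquiv E')
    (hT : E.IsGauge T Tt) (h0 : ∀ t ∈ E'.I, E'.h t = 0) : ∃ J θ α β γ δ μ,
      MoebiusLink E E' T Tt J θ α β γ δ μ ∧ J.Nonempty := by
  obtain ⟨Ω, Φ, ⟨⟨t, x, v⟩, hP⟩, hΦ⟩ := h
  obtain ⟨r, hr, hsub⟩ := exists_open_interval_box hΦ.isOpen hP
  have hΦ' := hΦ.mono hsub (Metric.isOpen_ball.prod (Metric.isOpen_ball.prod Metric.isOpen_ball))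
  have hc : ∀ y : ℝ, IsPreconnected (Metric.ball y r) := fun y =>
    (convex_ball y r).isPreconnected
  obtain ⟨θ, θ1, X, Y, Z, hL, -⟩ := hΦ'.exists_link h0 Metric.isOpen_ball (hc t)
    Metric.isOpen_ball (hc x) Metric.isOpen_ball (hc v) (Metric.mem_ball_self hr)
    (Metric.mem_ball_self hr) (Metric.mem_ball_self hr)
  obtain ⟨α, β, γ, δ, μ, hM⟩ := hL.exists_moebiusLink hT
    (fun s hs => (hΦ.subset (hsub (show (s, x, v) ∈ _ from
      ⟨hs, Metric.mem_ball_self hr, Metric.mem_ball_self hr⟩))).1)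
    Metric.isOpen_ball ⟨⟨t, Metric.mem_ball_self hr⟩, hc t⟩
  exact ⟨_, θ, α, β, γ, δ, μ, hM, t, Metric.mem_ball_self hr⟩

theorem MoebiusLink.isConst_iff (hM : MoebiusLink E E' T Tt J θ α β γ δ μ) (hT : E.IsGauge T Tt)
    {t : ℝ} (ht : t ∈ J) :
    deriv E.g t + E.n * E.h t * E.g t = 0 ↔ deriv E'.g (θ t) = 0 := by
  have h := hM.deriv_eq hT ht
  have hμ := hM.scale_ne_zero
  have hΔ := hM.det_ne_zero
  have hP := hM.denom_ne_zero t ht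
  have hTt := hT.ne_zero (hM.subset ht)
  constructor
  · intro h1
    rw [h1] at h
    simpa [hΔ, hTt] using h.symm
  · intro h1
    rw [h1] at h
    simpa [hμ, hP] using h

theorem Eqn.IsRow1.isConst_iff {r : Row1} (hr : E.IsRow1 r) {t : ℝ} (ht : t ∈ E.I) :
    r.IsConst ↔ deriv E.g t = 0 := by
  have hT := E.isGauge_id hr.h_eq_zero
  refine ⟨fun hc => ?_, fun h => ?_⟩
  · simpa [hr.h_eq_zero t ht] using hr.isRow3.const hT (r.isConst_toRow.2 hc) t ht
  · by_contra hc
    have := (hr.admits hc).ode t ht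
    simp [h, hr.h_eq_zero t ht, hr.1.params_C E.n_ne_zero hc, E.g_ne_zero t ht] at this

/-- The sign in a row of Table 1. -/
def Row1.sign : Row1 → ℝ
  | case2 ε _ => ε
  | case3 ε => ε
  | case6 ε _ => ε
  | case7 ε => ε
  | case8 ε _ => ε
  | _ => 1

theorem Row1.g_mul_sign_pos {r : Row1} {n t : ℝ} (hr : r.Valid n) (ht : t ∈ r.tDomain) :
    0 < r.sign * r.g t := by
  have hε : ∀ ε y : ℝ, (ε = 1 ∨ ε = -1) → 0 < y → 0 < ε * (ε * y) := by
    rintro ε y (rfl | rfl) hy <;> simpa using hy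
  cases r with
  | case2 ε ρ => exact hε _ _ hr.2.1 (Real.rpow_pos_of_pos ht ρ)
  | case3 ε => exact hε _ _ hr.2 (Real.exp_pos _)
  | case6 ε ρ => exact hε _ _ hr.2.1 (Real.rpow_pos_of_pos ht ρ)
  | case7 ε => exact hε _ _ hr.2 (Real.exp_pos _)
  | case8 ε ρ => exact hε _ _ hr.2.1 (Real.exp_pos _)
  | case4 => simp [Row1.sign, Row1.g]
  | case9 => simp [Row1.sign, Row1.g]

theorem Row1.mul_params_σ_pos {r : Row1} {n t : ℝ} (hn : n ≠ 0) (ht : t ∈ r.tDomain)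
    (hc : ¬ r.IsConst) (hr : r.Valid n) : 0 < (if n = 1 then 1 else n) * (r.params n).σ t := by
  have hn2 : 0 < n ^ 2 := by positivity
  cases r with
  | case2 ε ρ =>
    have ht : 0 < t := ht
    simp only [Row1.params, Params.σ, if_neg hr.1]
    have : 0 < n ^ 2 * t := by positivity
    linarith
  | case3 ε =>
    simp only [Row1.params, Params.σ, if_neg hr.1]
    linarith
  | case6 ε ρ =>
    have ht : 0 < t := ht
    simp only [Row1.params, Params.σ, if_pos hr.1]
    linarith
  | case7 ε =>
    simp only [Row1.params, Params.σ, if_pos hr.1]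
    norm_num
  | case8 ε ρ =>
    simp only [Row1.params, Params.σ, if_pos hr.1]
    linarith [sq_nonneg t]
  | _ => exact absurd trivial hc

theorem eq_of_mul_pos {ε ε' : ℝ} (h : ε = 1 ∨ ε = -1) (h' : ε' = 1 ∨ ε' = -1)
    (hp : 0 < ε * ε') : ε' = ε := by
  rcases h with rfl | rfl <;> rcases h' with rfl | rfl <;> linarith

/-- The invariants of linked equations from Table 1 with nonconstant `g`. -/
theorem MoebiusLink.row1_invariants (hM : MoebiusLink E E' (fun t => t) (fun _ => 1) J θ α β γ δ μ)
    {r r' : Row1} (hr : E.IsRow1 r) (hr' : E'.IsRow1 r') (hc : ¬ r.IsConst) (hc' : ¬ r'.IsConst)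
    (hne : J.Nonempty) :
    (E.n ≠ 1 → (r.params E.n).C * (r'.params E.n).k = (r'.params E.n).C * (r.params E.n).k) ∧
    (r.params E.n).C ^ 2 * ((r'.params E.n).k ^ 2 - 4 * (r'.params E.n).a * (r'.params E.n).m)
      = (r'.params E.n).C ^ 2 * ((r.params E.n).k ^ 2 - 4 * (r.params E.n).a * (r.params E.n).m) ∧
    0 < (r.params E.n).C * (r'.params E.n).C * (r.sign * r'.sign) := by
  obtain ⟨t, ht⟩ := hne
  have hT := E.isGauge_id hr.h_eq_zero
  have hΔ := hM.det_ne_zero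
  have hn0 := E.n_ne_zero
  have hP := hr.admits hc
  have hP' := hr'.admits hc'
  have hC := hr.1.params_C hn0 hc
  have hC' := hr'.1.params_C E'.n_ne_zero hc'
  have s1 := Row1.mul_params_σ_pos hn0 (hr.2.1 (hM.subset ht)) hc hr.1
  have s2 := Row1.mul_params_σ_pos E'.n_ne_zero (hr'.2.1 (hM.mem t ht)) hc' hr'.1
  have p1 := Row1.g_mul_sign_pos hr.1 (hr.2.1 (hM.subset ht))
  have p2 := Row1.g_mul_sign_pos hr'.1 (hr'.2.1 (hM.mem t ht))
  rw [← (hr.2.2 t (hM.subset ht)).2] at p1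
  rw [← (hr'.2.2 _ (hM.mem t ht)).2] at p2
  have hode : ∀ᶠ s in 𝓝 t, ((r'.params E'.n).pull α β γ δ).σ s
      * (deriv E.g s + E.n * E.h s * E.g s)
      = ((r'.params E'.n).pull α β γ δ).C * 1 * E.g s := by
    filter_upwards [hM.isOpen.mem_nhds ht] with s hs
    exact (hM.ode_iff hT hr'.h_eq_zero _ hs).2 (hP'.ode _ (hM.mem s hs))
  obtain ⟨u1, u2, u3⟩ := hP.unique hT hC (hM.subset ht) hode
  have hdisc := (r'.params E'.n).pull_disc (α := α) (β := β) (γ := γ) (δ := δ) hΔ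
  have hσ := (r'.params E'.n).pull_σ hΔ (hM.θ_eq t ht)
  have hg := hM.g_eq t ht
  have hD := hM.denom_ne_zero t ht
  have hpos := hM.pos
  have hcC : ((r'.params E'.n).pull α β γ δ).C = (r'.params E'.n).C := rfl
  have hkn : E.n ≠ 1 → ((r'.params E'.n).pull α β γ δ).k = (r'.params E'.n).k := by
    intro hn
    obtain ⟨rfl, rfl⟩ := hM.of_ne_one hn
    have ha := hP'.a_eq (hM.n_eq ▸ hn)
    simp only [mul_one, mul_zero, sub_zero] at hΔ
    simp [Params.pull, ha, hΔ]
  rw [hcC] at u1 u2 u3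
  rw [hM.n_eq] at *
  generalize r.params E.n = R at *
  generalize r'.params E.n = R' at *
  generalize R'.pull α β γ δ = S at *
  refine ⟨fun hn => ?_, ?_, ?_⟩
  · rw [← hkn hn]
    exact u2
  · rw [← hdisc]
    linear_combination (R.C * S.k + R'.C * R.k) * u2 - 4 * R.C * S.m * u1
      - 4 * R'.C * R.a * u3
  · have e1 : R'.C * R.σ t * (α * δ - β * γ) = R.C * R'.σ (θ t) * (γ * t + δ) ^ 2 := by
      simp only [Params.σ] at hσ ⊢
      linear_combination R.C * hσ - (α * δ - β * γ) * (t ^ 2 * u1 + t * u2 + u3)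
    rw [mul_one] at hg
    set ν : ℝ := if E.n = 1 then 1 else E.n with hν
    have hσσ : 0 < R.σ t * R'.σ (θ t) := by
      have h1 := mul_pos s1 s2
      have h2 : 0 < ν ^ 2 * (R.σ t * R'.σ (θ t)) := by linarith
      exact pos_of_mul_pos_right h2 (sq_nonneg ν)
    have h3 : 0 < R.C * R'.C * (α * δ - β * γ) := by
      have : 0 < (R.C * R'.C * (α * δ - β * γ)) * (R.σ t) ^ 2 := by
        have e2 : (R.C * R'.C * (α * δ - β * γ)) * (R.σ t) ^ 2
            = R.C ^ 2 * (γ * t + δ) ^ 2 * (R.σ t * R'.σ (θ t)) := by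
          linear_combination R.C * R.σ t * e1
        rw [e2]
        positivity
      exact pos_of_mul_pos_left this (sq_nonneg _)
    have h4 : 0 < R.C * R'.C * μ := by
      have : 0 < (R.C * R'.C * μ) * (α * δ - β * γ) ^ 2 := by
        have := mul_pos h3 hpos
        linarith
      exact pos_of_mul_pos_left this (sq_nonneg _)
    have h5 : 0 < r.sign * r'.sign * μ := by
      have : 0 < (r.sign * r'.sign * μ) * E.g t ^ 2 := by
        have := mul_pos p1 p2
        rw [hg] at this
        linarith
      exact pos_of_mul_pos_left this (sq_nonneg _)
    have : 0 < (R.C * R'.C * (r.sign * r'.sign)) * μ ^ 2 := by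
      have := mul_pos h4 h5
      linarith
    exact pos_of_mul_pos_left this (sq_nonneg _)

/-- Inequivalence of the equations of Table 1. -/
theorem Eqn.IsRow1.eq_or_eq_flip {r r' : Row1} (hr : E.IsRow1 r) (hr' : E'.IsRow1 r')
    (h : E.LocallyPointEquiv E') : E'.n = E.n ∧ (r' = r ∨ r' = r.flip) := by
  obtain ⟨J, θ, α, β, γ, δ, μ, hM, t, ht⟩ :=
    h.exists_moebiusLink (E.isGauge_id hr.h_eq_zero) hr'.h_eq_zero
  refine ⟨hM.n_eq, ?_⟩
  have hT := E.isGauge_id hr.h_eq_zero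
  have hcc : r.IsConst ↔ r'.IsConst := by
    rw [hr.isConst_iff (hM.subset ht), hr'.isConst_iff (hM.mem t ht), ← hM.isConst_iff hT ht,
      hr.h_eq_zero t (hM.subset ht), mul_zero, zero_mul, add_zero]
  have hn0 := E.n_ne_zero
  have hv := hr.1
  have hv' := hr'.1
  rw [hM.n_eq] at hv'
  by_cases hc : r.IsConst
  · have hc' := hcc.1 hc
    cases r with
    | case4 =>
      cases r' with
      | case4 => exact Or.inl rfl
      | case9 => exact absurd hv' hv
      | _ => exact hc'.elim
    | case9 =>
      cases r' with
      | case9 => exact Or.inl rfl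
      | case4 => exact absurd hv hv'
      | _ => exact hc'.elim
    | _ => exact hc.elim
  · have hc' := fun h => hc (hcc.2 h)
    obtain ⟨hk, hd, hs⟩ := hM.row1_invariants hr hr' hc hc' ⟨t, ht⟩
    have hsq : ∀ ρ ρ' : ℝ, ρ ^ 2 = ρ' ^ 2 → ρ ≠ 0 → ∀ ε ε' : ℝ, (ε = 1 ∨ ε = -1) →
        (ε' = 1 ∨ ε' = -1) → 0 < ρ * ρ' * (ε * ε') →
        (ε' = ε ∧ ρ' = ρ) ∨ (ε' = -ε ∧ ρ' = -ρ) := by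
      intro ρ ρ' hρ h0 ε ε' hε hε' hp
      have hρ2 : 0 < ρ ^ 2 := by positivity
      rcases sq_eq_sq_iff_eq_or_eq_neg.1 hρ.symm with rfl | rfl
      · refine Or.inl ⟨eq_of_mul_pos hε hε' ?_, rfl⟩
        exact (mul_pos_iff_of_pos_left hρ2).1 (by linarith)
      · refine Or.inr ⟨?_, rfl⟩
        have hneg : -ε = 1 ∨ -ε = -1 := by
          rcases hε with rfl | rfl <;> norm_num
        refine eq_of_mul_pos hneg hε' ?_
        exact (mul_pos_iff_of_pos_left hρ2).1 (by linarith)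
    cases r with
    | case2 ε ρ =>
      have hn := hv.1
      replace hk := hk hn
      cases r' with
      | case2 ε' ρ' =>
        simp only [Row1.params, Row1.sign] at hk hs
        obtain rfl : ρ' = ρ := by
          refine mul_left_cancel₀ (mul_ne_zero (mul_ne_zero two_ne_zero hn0)
            (mul_ne_zero two_ne_zero hn0)) ?_
          linear_combination -hk
        have hp : 0 < (2 * E.n * ρ') ^ 2 := by
          have := hv.2.2
          positivity
        rw [eq_of_mul_pos hv.2.1 hv'.2.1 ((mul_pos_iff_of_pos_left hp).1 (by linarith))]
        exact Or.inl rfl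
      | case3 ε' => simp [Row1.params, hn0] at hk
      | case4 => exact absurd trivial hc'
      | case9 => exact absurd trivial hc'
      | case6 ε' ρ' => exact absurd hv'.1 hn
      | case7 ε' => exact absurd hv'.1 hn
      | case8 ε' ρ' => exact absurd hv'.1 hn
    | case3 ε =>
      have hn := hv.1
      replace hk := hk hn
      cases r' with
      | case2 ε' ρ' => simp [Row1.params, hn0] at hk
      | case3 ε' =>
        simp only [Row1.params, Row1.sign] at hs
        have hp : 0 < (2 * E.n) ^ 2 := by positivity
        rw [eq_of_mul_pos hv.2 hv'.2 ((mul_pos_iff_of_pos_left hp).1 (by linarith))]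
        exact Or.inl rfl
      | case4 => exact absurd trivial hc'
      | case9 => exact absurd trivial hc'
      | case6 ε' ρ' => exact absurd hv'.1 hn
      | case7 ε' => exact absurd hv'.1 hn
      | case8 ε' ρ' => exact absurd hv'.1 hn
    | case6 ε ρ =>
      have hρ := hv.2.2
      have hρ2 : 0 < ρ ^ 2 := by positivity
      cases r' with
      | case6 ε' ρ' =>
        simp only [Row1.params, Row1.sign] at hd hs
        rcases hsq ρ ρ' (by linarith) hρ ε ε' hv.2.1 hv'.2.1 (by linarith) with
          ⟨rfl, rfl⟩ | ⟨rfl, rfl⟩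
        exacts [Or.inl rfl, Or.inr rfl]
      | case7 ε' =>
        simp only [Row1.params] at hd
        linarith
      | case8 ε' ρ' =>
        simp only [Row1.params] at hd
        nlinarith [sq_nonneg ρ']
      | case4 => exact absurd trivial hc'
      | case9 => exact absurd trivial hc'
      | case2 ε' ρ' => exact absurd hv.1 hv'.1
      | case3 ε' => exact absurd hv.1 hv'.1
    | case7 ε =>
      cases r' with
      | case6 ε' ρ' =>
        simp only [Row1.params] at hd
        linarith
      | case7 ε' =>
        simp only [Row1.params, Row1.sign] at hs
        rw [eq_of_mul_pos hv.2 hv'.2 (by linarith)]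
        exact Or.inl rfl
      | case8 ε' ρ' =>
        simp only [Row1.params] at hd
        linarith
      | case4 => exact absurd trivial hc'
      | case9 => exact absurd trivial hc'
      | case2 ε' ρ' => exact absurd hv.1 hv'.1
      | case3 ε' => exact absurd hv.1 hv'.1
    | case8 ε ρ =>
      have hρ := hv.2.2
      have hρ2 : 0 < ρ ^ 2 := by positivity
      cases r' with
      | case6 ε' ρ' =>
        simp only [Row1.params] at hd
        nlinarith [sq_nonneg ρ']
      | case7 ε' =>
        simp only [Row1.params] at hd
        linarith
      | case8 ε' ρ' =>
        simp only [Row1.params, Row1.sign] at hd hs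
        rcases hsq ρ ρ' (by linarith) hρ ε ε' hv.2.1 hv'.2.1 (by linarith) with
          ⟨rfl, rfl⟩ | ⟨rfl, rfl⟩
        exacts [Or.inl rfl, Or.inr rfl]
      | case4 => exact absurd trivial hc'
      | case9 => exact absurd trivial hc'
      | case2 ε' ρ' => exact absurd hv.1 hv'.1
      | case3 ε' => exact absurd hv.1 hv'.1
    | _ => exact absurd trivial hc

end Inequivalence

end Burgers

end

/-- Group classification of the class `u_t + u ^ n u_x + h(t) u = g(t) u_xx`, `n g ≠ 0`. -/
theorem mainTheorem4 :
    -- Table 1, exhaustiveness: every equation is point equivalent to one with `h = 0` that is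
    -- either in one of the Cases 2-4, 6-9 or in Case 1 or 5, and never to both kinds
    (∀ E : Burgers.Eqn, Xor
      (∃ (r : Burgers.Row1) (E' : Burgers.Eqn), E'.n = E.n ∧ E'.IsRow1 r ∧ E.PointEquiv E')
      (∃ E' : Burgers.Eqn, E'.n = E.n ∧ (∀ t ∈ E'.I, E'.h t = 0) ∧ E.PointEquiv E' ∧
        E'.HasMaxAlgebra (Burgers.genericBasis E'.n))) ∧
    -- Table 1, maximal Lie invariance algebras
    (∀ (r : Burgers.Row1) (E : Burgers.Eqn), E.IsRow1 r → E.HasMaxAlgebra (r.basis E.n)) ∧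
    -- Table 1, inequivalence: only `(ε, ρ)` and `(-ε, -ρ)` are equivalent, in Cases 6 and 8
    (∀ (r r' : Burgers.Row1) (E E' : Burgers.Eqn), E.IsRow1 r → E'.IsRow1 r' →
      E.LocallyPointEquiv E' → E'.n = E.n ∧ (r' = r ∨ r' = r.flip)) ∧
    (∀ (r : Burgers.Row1) (E : Burgers.Eqn), E.IsRow1 r →
      ∃ E' : Burgers.Eqn, E'.n = E.n ∧ E'.IsRow1 r.flip ∧ E.PointEquiv E') ∧
    -- Table 2: the complete list for `h = 0`
    (∀ E : Burgers.Eqn, (∀ t ∈ E.I, E.h t = 0) →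
      (∀ r : Burgers.Row, E.IsRow2 r → E.HasMaxAlgebra (r.basis2 E.n)) ∧
      ((∀ r : Burgers.Row, ¬ E.IsRow2 r) → E.HasMaxAlgebra (Burgers.genericBasis E.n))) ∧
    -- Table 3: the complete list for arbitrary `h`
    (∀ (E : Burgers.Eqn) (T Tt : ℝ → ℝ), E.IsGauge T Tt →
      (∀ r : Burgers.Row, E.IsRow3 T Tt r → E.HasMaxAlgebra (r.basis3 E.n E.h T Tt)) ∧
      ((∀ r : Burgers.Row, ¬ E.IsRow3 T Tt r) →
        E.HasMaxAlgebra (Burgers.genericBasis3 E.n T Tt)) ∧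
      -- Cases 1 and 5 occur for any given `n`, `h`
      (∃ E' : Burgers.Eqn, E'.n = E.n ∧ E'.I = E.I ∧ E'.h = E.h ∧
        E'.HasMaxAlgebra (Burgers.genericBasis3 E.n T Tt)) ∧
      -- normalization of the parameters in Case 7
      (∀ lam α β γ δ : ℝ, E.IsRow3 T Tt (.case7 lam α β γ δ) →
        (∃ lam' α' : ℝ, E.IsRow3 T Tt (.case7 lam' α' 0 0 1)) ∨
        (∃ lam' β' δ' : ℝ, E.IsRow3 T Tt (.case7 lam' 0 β' 1 δ')))) := by
  refine ⟨fun E => E.table_one_xor, fun r E hr => hr.hasMaxAlgebra,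
    fun r r' E E' hr hr' h => hr.eq_or_eq_flip hr' h, fun r E hr => hr.exists_flip,
    fun E h0 => ⟨fun r hr => hr.hasMaxAlgebra h0, fun h => ?_⟩,
    fun E T Tt hT => ⟨fun r hr => hr.hasMaxAlgebra hT, hT.hasMaxAlgebra_of_no_row,
      hT.exists_generic, fun lam α β γ δ h => h.normalize_case7⟩⟩
  rw [← Burgers.genericBasis3_id]
  exact (E.isGauge_id h0).hasMaxAlgebra_of_no_row fun r hr => h r ((E.isRow2_iff h0).2 hr)
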